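/- Consider $n$ fermionic modes with Majorana operators $c_1,\dots,c_{2n}$ (Hermitian, $\{c_k,c_l\}=2\delta_{kl}$). The covariance matrix of a state $\rho$ is $\gamma_{kl}=\frac{i}{2}\mathrm{tr}(\rho[c_k,c_l])$, and a state is Gaussian if Wick's theorem holds for it. A fermionic Gaussian channel ${\cal T}_{(A;B)}$ from $n$ to $n$ modes, with $A$ a real $2n\times 2n$ matrix and $B$ a real antisymmetric $2n\times 2n$ matrix, is a completely positive trace-preserving map that sends Gaussian states to Gaussian states, also when it is applied to $n$ modes of a larger system, and that acts on covariance matrices as $\gamma\mapsto A\gamma A^T+B$ (as $\gamma\mapsto(\mathbb 1\oplus A)\gamma(\mathbb 1\oplus A)^T+(0\oplus B)$ in the presence of further modes). A channel ${\cal T}$ is degradable if there is a quantum channel ${\cal W}$ with ${\cal W}\circ{\cal T}={\cal T}^c$. Here ${\cal T}^c$ is a complementary channel of ${\cal T}$: if ${\cal T}$ is obtained by coupling the $n$ modes by a parity-preserving unitary to finitely many environment modes in a pure state of definite parity, then ${\cal T}^c$ maps the input to the final (fermionic) reduced state of the environment. A Gaussian unitary is a unitary $U$ with $U^\dagger c_kU=\sum_l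 O_{kl}c_l$ for some $O\in\mathrm{O}(2n)$. Theorem (degradable $n\to n$ fermionic Gaussian channels). Let ${\cal T}$ be a degradable fermionic Gaussian channel from $n$ to $n$ modes. Then there are Gaussian unitaries $U,V$ of $n$ modes and numbers $p_1,\dots,p_n\in[\frac12,1]$ such that $${\cal T}(\rho)=U\,{\cal L}(V\rho V^\dagger)\,U^\dagger\quad\text{for all }\rho,$$ where ${\cal L}$ is the direct sum of the one-mode lossy channels ${\cal T}_{p_j}:\gamma\mapsto p_j\gamma+(1-p_j)J$, $J=\begin{pmatrix}0&-1\\1&0\end{pmatrix}$; that is, ${\cal L}={\cal T}_{(A;B)}$ with $A=\bigoplus_{j=1}^n\sqrt{p_j}\,\mathbb 1_2$ and $B=\bigoplus_{j=1}^n(1-p_j)J$. -/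

import Mathlib

open scoped Matrix Kronecker ComplexOrder

noncomputable section

namespace FermionicGaussian

/-! ### Fermionic modes, in the Jordan-Wigner representation -/

/-- Occupation-number configurations of `n` modes; they index the standard basis of the
`2 ^ n`-dimensional Fock space. -/
abbrev Fock (n : ℕ) : Type := Fin n → Fin 2

/-- Labels of the `2 n` Majorana operators of `n` modes: the pair `(0, j)`, `(1, j)` belongs to
mode `j`. -/
abbrev Maj (n : ℕ) : Type := Fin 2 × Fin n

/-- The Majorana operators of `n` modes: with Pauli matrices `X, Y, Z`,
`c (0, j) = Z ⊗ ⋯ ⊗ Z ⊗ X ⊗ 1 ⊗ ⋯ ⊗ 1` and `c (1, j) = Z ⊗ ⋯ ⊗ Z ⊗ Y ⊗ 1 ⊗ ⋯ ⊗ 1`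
(`X`, `Y` in position `j`). -/
def majorana (n : ℕ) (k : Maj n) : Matrix (Fock n) (Fock n) ℂ :=
  Matrix.of fun s t =>
    if s = Function.update t k.2 (1 - t k.2) then
      (∏ i ∈ Finset.univ.filter (fun i => i < k.2), (-1 : ℂ) ^ (t i : ℕ)) *
        (if k.1 = 0 then 1 else if t k.2 = 0 then Complex.I else -Complex.I)
    else 0

/-- The fermion parity operator `Z ⊗ ⋯ ⊗ Z` of `n` modes. -/
def parity (n : ℕ) : Matrix (Fock n) (Fock n) ℂ :=
  Matrix.diagonal fun s => ∏ i, (-1 : ℂ) ^ (s i : ℕ)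

/-- The Majorana operators of a bipartite system of `r + n` modes, acting on the tensor product of
the two Fock spaces: `c k ⊗ 1` for the first part and `parity ⊗ c k` for the second, so that
operators of different parts anticommute. -/
def jointMajorana (r n : ℕ) : Maj r ⊕ Maj n → Matrix (Fock r × Fock n) (Fock r × Fock n) ℂ :=
  Sum.elim (fun k => majorana r k ⊗ₖ (1 : Matrix (Fock n) (Fock n) ℂ))
    (fun k => parity r ⊗ₖ majorana n k)

/-! ### States -/

/-- Density operators. -/
def IsState {h : Type*} [Fintype h] [DecidableEq h] (ρ : Matrix h h ℂ) : Prop :=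
  ρ.PosSemidef ∧ ρ.trace = 1

/-- The covariance matrix `γ k l = (i / 2) tr (ρ [c k, c l])` of `ρ` with respect to the Majorana
operators `c`. -/
def covariance {ι h : Type*} [Fintype h] [DecidableEq h] (c : ι → Matrix h h ℂ)
    (ρ : Matrix h h ℂ) : Matrix ι ι ℂ :=
  Matrix.of fun k l => Complex.I / 2 * (ρ * (c k * c l - c l * c k)).trace

/-- Fermionic Gaussian states: density operators for which Wick's theorem holds. It is stated
recursively: the expectation of `c k * c l₀ * c l₁ * ⋯` is the alternating sum, over the possible
partners `l_j` of `k`, of the two-point function of `k` and `l_j` times the expectation of the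
product of the remaining operators. (For the empty list this says that `c k` has expectation `0`;
by recursion all odd moments vanish and the even ones are Pfaffians of two-point functions.) -/
def IsGaussianState {ι h : Type*} [Fintype h] [DecidableEq h] (c : ι → Matrix h h ℂ)
    (ρ : Matrix h h ℂ) : Prop :=
  IsState ρ ∧ ∀ (k : ι) (l : List ι),
    (ρ * (c k * (l.map c).prod)).trace =
      ∑ j : Fin l.length, (-1 : ℂ) ^ (j : ℕ) * (ρ * (c k * c (l.get j))).trace *
        (ρ * ((l.eraseIdx j).map c).prod).trace

/-! ### Channels -/

/-- `id ⊗ T`, acting on the second factor of a bipartite system. -/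
def ampliation (r : Type*) {h h' : Type*} (T : Matrix h h ℂ →ₗ[ℂ] Matrix h' h' ℂ)
    (X : Matrix (r × h) (r × h) ℂ) : Matrix (r × h') (r × h') ℂ :=
  Matrix.of fun x y => T (Matrix.of fun i j => X (x.1, i) (y.1, j)) x.2 y.2

/-- Quantum channels: completely positive trace-preserving linear maps. -/
def IsChannel {h h' : Type*} [Fintype h] [DecidableEq h] [Fintype h'] [DecidableEq h']
    (T : Matrix h h ℂ →ₗ[ℂ] Matrix h' h' ℂ) : Prop :=
  (∀ (d : ℕ) (X : Matrix (Fin d × h) (Fin d × h) ℂ), X.PosSemidef →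
    (ampliation (Fin d) T X).PosSemidef) ∧
  ∀ X, (T X).trace = X.trace

/-- The block matrix `1 ⊕ A`, with the identity on `r` reference modes. -/
def padOne {n m : ℕ} (r : ℕ) (A : Matrix (Maj m) (Maj n) ℝ) :
    Matrix (Maj r ⊕ Maj m) (Maj r ⊕ Maj n) ℂ :=
  Matrix.fromBlocks 1 0 0 (A.map Complex.ofReal)

/-- The block matrix `0 ⊕ B`, with zero on `r` reference modes. -/
def padZero {m : ℕ} (r : ℕ) (B : Matrix (Maj m) (Maj m) ℝ) :
    Matrix (Maj r ⊕ Maj m) (Maj r ⊕ Maj m) ℂ :=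
  Matrix.fromBlocks 0 0 0 (B.map Complex.ofReal)

/-- `T` is the `n → m` mode fermionic Gaussian channel `γ ↦ A γ Aᵀ + B`: a quantum channel which,
applied to `n` modes of any Gaussian state of `r + n` modes, returns a Gaussian state, and which
transforms covariance matrices accordingly (`1 ⊕ A` and `0 ⊕ B`
replacing `A` and `B`; `r = 0` is the channel itself). -/
def IsGaussianChannelWith {n m : ℕ}
    (T : Matrix (Fock n) (Fock n) ℂ →ₗ[ℂ] Matrix (Fock m) (Fock m) ℂ)
    (A : Matrix (Maj m) (Maj n) ℝ) (B : Matrix (Maj m) (Maj m) ℝ) : Prop :=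
  IsChannel T ∧ Bᵀ = -B ∧
  ∀ (r : ℕ) (ρ : Matrix (Fock r × Fock n) (Fock r × Fock n) ℂ),
    IsGaussianState (jointMajorana r n) ρ →
      IsGaussianState (jointMajorana r m) (ampliation (Fock r) T ρ) ∧
      covariance (jointMajorana r m) (ampliation (Fock r) T ρ) =
        padOne r A * covariance (jointMajorana r n) ρ * (padOne r A)ᵀ + padZero r B

/-- Fermionic Gaussian channels. -/
def IsGaussianChannel {n m : ℕ}
    (T : Matrix (Fock n) (Fock n) ℂ →ₗ[ℂ] Matrix (Fock m) (Fock m) ℂ) : Prop :=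
  ∃ A B, IsGaussianChannelWith T A B

/-- Gaussian unitaries of `n` modes: unitaries acting on the Majorana operators by a real
orthogonal transformation. -/
def IsGaussianUnitary {n : ℕ} (U : Matrix (Fock n) (Fock n) ℂ) : Prop :=
  U ∈ Matrix.unitaryGroup (Fock n) ℂ ∧
  ∃ O ∈ Matrix.orthogonalGroup (Maj n) ℝ,
    ∀ k, Uᴴ * majorana n k * U = ∑ l, (O k l : ℂ) • majorana n l

/-- The map `ρ ↦ U ρ U†`. -/
def conjBy {h : Type*} [Fintype h] [DecidableEq h] (U : Matrix h h ℂ) :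
    Matrix h h ℂ →ₗ[ℂ] Matrix h h ℂ :=
  LinearMap.mulLeft ℂ U ∘ₗ LinearMap.mulRight ℂ Uᴴ

/-! ### Complementary channels and degradability -/

/-- Pure states of `k` fermionic modes: projectors on unit vectors, of definite parity (as the
parity superselection rule demands). -/
def IsPureState {k : ℕ} (ρ : Matrix (Fock k) (Fock k) ℂ) : Prop :=
  IsState ρ ∧ (∃ φ : Fock k → ℂ, ρ = Matrix.vecMulVec φ (star φ)) ∧ Commute ρ (parity k)

/-- `σ` is the fermionic reduced state of `X` on the first `n` of `n + k` modes: it reproduces the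
expectations of all products of Majorana operators of these modes. -/
def IsMarginalFst {n k : ℕ} (X : Matrix (Fock n × Fock k) (Fock n × Fock k) ℂ)
    (σ : Matrix (Fock n) (Fock n) ℂ) : Prop :=
  ∀ l : List (Maj n), (σ * (l.map (majorana n)).prod).trace =
    (X * (l.map fun i => jointMajorana n k (Sum.inl i)).prod).trace

/-- `σ` is the fermionic reduced state of `X` on the last `k` of `n + k` modes. -/
def IsMarginalSnd {n k : ℕ} (X : Matrix (Fock n × Fock k) (Fock n × Fock k) ℂ)
    (σ : Matrix (Fock k) (Fock k) ℂ) : Prop :=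
  ∀ l : List (Maj k), (σ * (l.map (majorana k)).prod).trace =
    (X * (l.map fun i => jointMajorana n k (Sum.inr i)).prod).trace

/-- `Tc` is a complementary channel of the `n → n` mode channel `T`, with a `k`-mode environment:
there are a pure environment state `ρE` and a (parity-preserving) unitary `U` coupling system and
environment such that, for every input `ρ`, the system part of `U (ρ ⊗ ρE) U†` is `T ρ` and the
environment part is `Tc ρ`. -/
def IsComplementary {n k : ℕ} (T : Matrix (Fock n) (Fock n) ℂ →ₗ[ℂ] Matrix (Fock n) (Fock n) ℂ)
    (Tc : Matrix (Fock n) (Fock n) ℂ →ₗ[ℂ] Matrix (Fock k) (Fock k) ℂ) : Prop :=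
  ∃ (ρE : Matrix (Fock k) (Fock k) ℂ) (U : Matrix (Fock n × Fock k) (Fock n × Fock k) ℂ),
    IsPureState ρE ∧ U ∈ Matrix.unitaryGroup (Fock n × Fock k) ℂ ∧
    Commute U (parity n ⊗ₖ parity k) ∧
    ∀ ρ, IsMarginalFst (U * (ρ ⊗ₖ ρE) * Uᴴ) (T ρ) ∧ IsMarginalSnd (U * (ρ ⊗ₖ ρE) * Uᴴ) (Tc ρ)

/-- Degradable channels: some quantum channel `W` turns the output of the channel into the output
of a complementary channel. (Complementary channels of `T` differ by isometries of the
environment, so it does not matter which one is taken.) -/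
def IsDegradable {n : ℕ} (T : Matrix (Fock n) (Fock n) ℂ →ₗ[ℂ] Matrix (Fock n) (Fock n) ℂ) :
    Prop :=
  ∃ (k : ℕ) (Tc : Matrix (Fock n) (Fock n) ℂ →ₗ[ℂ] Matrix (Fock k) (Fock k) ℂ),
    IsComplementary T Tc ∧
    ∃ W : Matrix (Fock n) (Fock n) ℂ →ₗ[ℂ] Matrix (Fock k) (Fock k) ℂ, IsChannel W ∧ W ∘ₗ T = Tc

/-! ### Lossy channels -/

/-- The one-mode covariance matrix `J`. -/
def J : Matrix (Fin 2) (Fin 2) ℝ := !![0, -1; 1, 0]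

/-- `L` is the direct sum of the one-mode lossy channels `T_p : γ ↦ p γ + (1 - p) J` with
`p = p j`, i.e. of the one-mode Gaussian channels given by `√p • 1` and `(1 - p) • J`. -/
def IsLossySum {n : ℕ} (p : Fin n → ℝ)
    (L : Matrix (Fock n) (Fock n) ℂ →ₗ[ℂ] Matrix (Fock n) (Fock n) ℂ) : Prop :=
  IsGaussianChannelWith L (Matrix.blockDiagonal fun j => √(p j) • (1 : Matrix (Fin 2) (Fin 2) ℝ))
    (Matrix.blockDiagonal fun j => (1 - p j) • J)

end FermionicGaussian

end

/-! Write c(v) = Σ v_k c_k, P for the parity, T* for the dual (Heisenberg) map, ι_v for contraction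
and v ∧ for exterior multiplication by c(v). Wick's theorem, applied to the output of T on one half
of a maximally entangled Gaussian state, determines T* completely: ι_v T*(X) = T*(ι_{Av} X) and T*(v
∧ X) = Aᵀv ∧ T*(X) - i T*(ι_{Bᵀv} X) (`contract_heisenberg`, `heisenberg_wedge`).

Let V be the isometry of a dilation, so that T*(X) = V†(X ⊗ 1)V, and put N = 1 - AAᵀ + iB. Whenever
x + Ay lies in the range of N, the operator (c(x) ⊗ 1)V + V c(y) equals (P ⊗ Y)V for some odd
environment operator Y (`IsDilation.exists_odd`). Degradability gives a channel W with Tc* = T* ∘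
W*. If Ay = 0, then c(y) is such an environment signal and hence lies in the range of T*; but ι_y
kills that range, so y = 0. Thus A is invertible, the kernel of T* is a proper two-sided ideal of a
simple algebra, and T* is injective. Therefore W*(Y) can be computed by comparing images under T*.

Two families of Y suffice (`IsDegradable.noise`). With y = 0 and x = Nb, Y lies in the
multiplicative domain of W*, and pairing it with the second family forces (1 - AAᵀ - iB)(1 - AAᵀ +
iB) = 0. With y = Aᵀw and x = -AAᵀw, Schwarz's inequality for W* gives 2Q² ≤ Q for Q = 1 - AAᵀ.

What remains is linear algebra (`exists_normal_form`): Q² = -B² and 0 ≤ Q ≤ 1/2, so in an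
orthonormal basis where B = ⊕ b_j J the matrix Q is the positive square root ⊕ b_j 1. With p_j = 1 -
b_j, the polar decomposition of A supplies the second rotation. Both rotations are implemented by
unitaries, since reflections generate O(2n) (`exists_implements`). -/

namespace FermionicGaussian

/-! ### Majorana operators as signed bit flips -/

/-- The configuration `t` with the occupation of mode `j` flipped. -/
def flip {n : ℕ} (j : Fin n) (t : Fock n) : Fock n := Function.update t j (1 - t j)

/-- The Jordan-Wigner sign of mode `j`. -/
noncomputable def jwSign {n : ℕ} (j : Fin n) (t : Fock n) : ℂ :=
  ∏ i ∈ Finset.univ.filter (fun i => i < j), (-1 : ℂ) ^ (t i : ℕ)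

/-- The entries of the Pauli matrices `X` and `Y` in the column `x`. -/
noncomputable def pauliPhase (a x : Fin 2) : ℂ :=
  if a = 0 then 1 else if x = 0 then Complex.I else -Complex.I

/-- The parity of a configuration. -/
noncomputable def paritySign {n : ℕ} (s : Fock n) : ℂ := ∏ i, (-1 : ℂ) ^ (s i : ℕ)

section Flip

variable {n : ℕ}

lemma one_sub_one_sub (x : Fin 2) : 1 - (1 - x) = x := by
  fin_cases x <;> rfl

lemma flip_apply_self (j : Fin n) (t : Fock n) : flip j t j = 1 - t j := by
  simp [flip]

lemma flip_apply_of_ne {i j : Fin n} (h : i ≠ j) (t : Fock n) : flip j t i = t i := by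
  simp [flip, h]

lemma flip_flip (j : Fin n) (t : Fock n) : flip j (flip j t) = t := by
  ext i
  by_cases h : i = j
  · subst h; rw [flip_apply_self, flip_apply_self, one_sub_one_sub]
  · rw [flip_apply_of_ne h, flip_apply_of_ne h]

lemma flip_comm {i j : Fin n} (h : i ≠ j) (t : Fock n) : flip i (flip j t) = flip j (flip i t) := by
  ext m
  by_cases hi : m = i
  · subst hi
    rw [flip_apply_self, flip_apply_of_ne h, flip_apply_of_ne h, flip_apply_self]
  · rw [flip_apply_of_ne hi]
    by_cases hj : m = j
    · subst hj
      rw [flip_apply_self, flip_apply_self, flip_apply_of_ne hi]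
    · rw [flip_apply_of_ne hj, flip_apply_of_ne hj, flip_apply_of_ne hi]

lemma eq_flip_iff {j : Fin n} {s t : Fock n} : s = flip j t ↔ t = flip j s :=
  ⟨fun h => by rw [h, flip_flip], fun h => by rw [h, flip_flip]⟩

lemma neg_one_pow_one_sub (x : Fin 2) :
    (-1 : ℂ) ^ ((1 - x : Fin 2) : ℕ) = -(-1 : ℂ) ^ (x : ℕ) := by
  fin_cases x <;> simp

lemma jwSign_flip_of_not_lt {i j : Fin n} (h : ¬ i < j) (t : Fock n) :
    jwSign j (flip i t) = jwSign j t := by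
  unfold jwSign
  refine Finset.prod_congr rfl fun m hm => ?_
  rw [flip_apply_of_ne]
  rintro rfl
  exact h (by simpa using hm)

lemma jwSign_flip_of_lt {i j : Fin n} (h : i < j) (t : Fock n) :
    jwSign j (flip i t) = -jwSign j t := by
  unfold jwSign
  have hi : i ∈ Finset.univ.filter (fun i => i < j) := by simpa using h
  rw [← Finset.mul_prod_erase _ _ hi, ← Finset.mul_prod_erase _ _ hi, flip_apply_self,
    neg_one_pow_one_sub, neg_mul]
  congr 2
  refine Finset.prod_congr rfl fun m hm => ?_
  rw [flip_apply_of_ne (Finset.ne_of_mem_erase hm)]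

lemma neg_one_pow_mul_self (x : ℕ) : (-1 : ℂ) ^ x * (-1 : ℂ) ^ x = 1 := by
  rw [← mul_pow]; simp

lemma jwSign_mul_self (j : Fin n) (t : Fock n) : jwSign j t * jwSign j t = 1 := by
  unfold jwSign
  rw [← Finset.prod_mul_distrib]
  exact Finset.prod_eq_one fun i _ => neg_one_pow_mul_self _

lemma star_jwSign (j : Fin n) (t : Fock n) : star (jwSign j t) = jwSign j t := by
  simp [jwSign, star_prod]

lemma star_pauliPhase (a x : Fin 2) : star (pauliPhase a x) = pauliPhase a (1 - x) := by
  fin_cases a <;> fin_cases x <;> simp [pauliPhase]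

lemma paritySign_mul_self (s : Fock n) : paritySign s * paritySign s = 1 := by
  unfold paritySign
  rw [← Finset.prod_mul_distrib]
  exact Finset.prod_eq_one fun i _ => neg_one_pow_mul_self _

lemma star_paritySign (s : Fock n) : star (paritySign s) = paritySign s := by
  simp [paritySign, star_prod]

lemma paritySign_flip (j : Fin n) (s : Fock n) : paritySign (flip j s) = -paritySign s := by
  unfold paritySign
  rw [← Finset.mul_prod_erase _ _ (Finset.mem_univ j), ← Finset.mul_prod_erase _ _ (Finset.mem_univ j),
    flip_apply_self, neg_one_pow_one_sub, neg_mul]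
  congr 2
  refine Finset.prod_congr rfl fun m hm => ?_
  rw [flip_apply_of_ne (Finset.ne_of_mem_erase hm)]

lemma majorana_apply (k : Maj n) (s t : Fock n) :
    majorana n k s t = if s = flip k.2 t then jwSign k.2 t * pauliPhase k.1 (t k.2) else 0 := rfl

lemma majorana_apply_row (k : Maj n) (s t : Fock n) :
    majorana n k s t =
      if t = flip k.2 s then jwSign k.2 s * pauliPhase k.1 (1 - s k.2) else 0 := by
  rw [majorana_apply]
  by_cases h : t = flip k.2 s
  · rw [if_pos h, if_pos (eq_flip_iff.1 h), h, jwSign_flip_of_not_lt (lt_irrefl _),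
      flip_apply_self]
  · rw [if_neg h, if_neg (fun h' => h (eq_flip_iff.1 h'))]

lemma parity_eq : parity n = Matrix.diagonal paritySign := rfl

lemma majorana_mul_apply (k : Maj n) (M : Matrix (Fock n) (Fock n) ℂ) (s t : Fock n) :
    (majorana n k * M) s t =
      jwSign k.2 s * pauliPhase k.1 (1 - s k.2) * M (flip k.2 s) t := by
  rw [Matrix.mul_apply, Finset.sum_eq_single (flip k.2 s)]
  · rw [majorana_apply_row, if_pos rfl]
  · intro u _ hu
    rw [majorana_apply_row, if_neg hu, zero_mul]
  · simp

lemma majorana_mul_majorana_apply (k l : Maj n) (s t : Fock n) :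
    (majorana n k * majorana n l) s t =
      if t = flip l.2 (flip k.2 s) then
        jwSign k.2 s * pauliPhase k.1 (1 - s k.2) *
          (jwSign l.2 (flip k.2 s) * pauliPhase l.1 (1 - flip k.2 s l.2)) else 0 := by
  rw [majorana_mul_apply, majorana_apply_row, mul_ite, mul_zero]

lemma majorana_anticomm (k l : Maj n) :
    majorana n k * majorana n l + majorana n l * majorana n k = if k = l then 2 else 0 := by
  obtain ⟨a, i⟩ := k
  obtain ⟨b, j⟩ := l
  ext s t
  rw [Matrix.add_apply, majorana_mul_majorana_apply, majorana_mul_majorana_apply]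
  dsimp only
  rcases lt_trichotomy i j with h | h | h
  · have hk : ((a, i) : Maj n) ≠ (b, j) := by simp [h.ne]
    rw [flip_comm h.ne, jwSign_flip_of_lt h, jwSign_flip_of_not_lt h.le.not_gt,
      flip_apply_of_ne h.ne, flip_apply_of_ne h.ne', if_neg hk]
    split_ifs
    · simp only [Matrix.zero_apply]; ring
    · simp
  · subst h
    rw [flip_flip, jwSign_flip_of_not_lt (lt_irrefl _), flip_apply_self]
    by_cases hst : t = s
    · subst hst
      have h1 := jwSign_mul_self i t
      rw [if_pos rfl, if_pos rfl]
      have h2 : jwSign i t * pauliPhase a (1 - t i) * (jwSign i t * pauliPhase b (1 - (1 - t i))) +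
          jwSign i t * pauliPhase b (1 - t i) * (jwSign i t * pauliPhase a (1 - (1 - t i))) =
          (jwSign i t * jwSign i t) * (pauliPhase a (1 - t i) * pauliPhase b (1 - (1 - t i)) +
            pauliPhase b (1 - t i) * pauliPhase a (1 - (1 - t i))) := by ring
      rw [h2, h1, one_mul]
      have h2' : ((2 : Matrix (Fock n) (Fock n) ℂ)) t t = 2 := by
        rw [← Matrix.diagonal_ofNat]; simp
      generalize t i = x
      have h3 : ((if (a, i) = (b, i) then 2 else 0 : Matrix (Fock n) (Fock n) ℂ)) t t =
          if a = b then 2 else 0 := by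
        by_cases hab : a = b
        · simp [hab, h2']
        · simp [hab]
      rw [h3]
      fin_cases a <;> fin_cases b <;> fin_cases x <;> simp [pauliPhase] <;> norm_num
    · rw [if_neg hst, if_neg hst, add_zero]
      have : ((2 : Matrix (Fock n) (Fock n) ℂ)) s t = 0 := by
        rw [← Matrix.diagonal_ofNat, Matrix.diagonal_apply_ne _ (Ne.symm hst)]
      split_ifs <;> simp [this]
  · have hk : ((a, i) : Maj n) ≠ (b, j) := by simp [h.ne']
    rw [flip_comm h.ne, jwSign_flip_of_lt h, jwSign_flip_of_not_lt h.le.not_gt,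
      flip_apply_of_ne h.ne, flip_apply_of_ne h.ne', if_neg hk]
    split_ifs
    · simp only [Matrix.zero_apply]; ring
    · simp

lemma majorana_conjTranspose (k : Maj n) : (majorana n k)ᴴ = majorana n k := by
  ext s t
  rw [Matrix.conjTranspose_apply, majorana_apply, majorana_apply_row]
  split_ifs
  · rw [star_mul', star_jwSign, star_pauliPhase]
  · simp

lemma parity_mul_self : parity n * parity n = 1 := by
  rw [parity_eq, Matrix.diagonal_mul_diagonal]
  simp [paritySign_mul_self]

lemma parity_conjTranspose : (parity n)ᴴ = parity n := by
  rw [parity_eq, Matrix.diagonal_conjTranspose]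
  congr 1
  ext s
  exact star_paritySign s

lemma parity_mul_majorana (k : Maj n) : parity n * majorana n k = -(majorana n k * parity n) := by
  ext s t
  rw [parity_eq, Matrix.diagonal_mul, Matrix.neg_apply, Matrix.mul_diagonal, majorana_apply]
  split_ifs with h
  · rw [h, paritySign_flip]; ring
  · simp

end Flip

/-! ### The Majorana operators generate the matrix algebra -/

section Generate

variable {n : ℕ}

lemma majorana_zero_mul_one (j : Fin n) :
    majorana n (0, j) * majorana n (1, j) =
      Complex.I • Matrix.diagonal fun s : Fock n => (-1 : ℂ) ^ (s j : ℕ) := by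
  ext s t
  rw [majorana_mul_majorana_apply, Matrix.smul_apply, Matrix.diagonal_apply]
  dsimp only
  rw [flip_flip, jwSign_flip_of_not_lt (lt_irrefl _), flip_apply_self, one_sub_one_sub]
  by_cases h : s = t
  · subst h
    have h1 := jwSign_mul_self j s
    rw [if_pos rfl, if_pos rfl]
    generalize s j = x at *
    have : jwSign j s * pauliPhase 0 (1 - x) * (jwSign j s * pauliPhase 1 x) =
      (jwSign j s * jwSign j s) * (pauliPhase 0 (1 - x) * pauliPhase 1 x) := by ring
    rw [this, h1]
    fin_cases x <;> simp [pauliPhase]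
  · rw [if_neg (Ne.symm h), if_neg h]; simp

lemma diagonal_mem_adjoin_majorana (d : Fock n → ℂ) :
    Matrix.diagonal d ∈ Algebra.adjoin ℂ (Set.range (majorana n)) := by
  set S := (Algebra.adjoin ℂ (Set.range (majorana n))).comap
    (Matrix.diagonalAlgHom ℂ : (Fock n → ℂ) →ₐ[ℂ] Matrix (Fock n) (Fock n) ℂ) with hS
  suffices h : d ∈ S from h
  have hz : ∀ j, (fun s : Fock n => (-1 : ℂ) ^ (s j : ℕ)) ∈ S := by
    intro j
    change Matrix.diagonal _ ∈ Algebra.adjoin ℂ (Set.range (majorana n))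
    have h1 := Subalgebra.smul_mem _ (mul_mem
      (Algebra.subset_adjoin (R := ℂ) (Set.mem_range_self (f := majorana n) (0, j)))
      (Algebra.subset_adjoin (R := ℂ) (Set.mem_range_self (f := majorana n) (1, j)))) (-Complex.I)
    rw [majorana_zero_mul_one, smul_smul] at h1
    simpa using h1
  have hs : ∀ t : Fock n, (Pi.single t 1 : Fock n → ℂ) ∈ S := by
    intro t
    -- The projector on one configuration is the product over the modes of the spectral projectors
    -- (1 ± Z_j)/2.
    have : (Pi.single t 1 : Fock n → ℂ) = ∏ j, ((1 / 2 : ℂ) • (1 + ((-1 : ℂ) ^ (t j : ℕ)) •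
        (fun s : Fock n => (-1 : ℂ) ^ (s j : ℕ)))) := by
      ext s
      rw [Finset.prod_apply]
      by_cases h : s = t
      · subst h
        rw [Pi.single_eq_same]
        symm
        refine Finset.prod_eq_one fun j _ => ?_
        simp only [Pi.smul_apply, Pi.add_apply, Pi.one_apply, smul_eq_mul, neg_one_pow_mul_self]
        norm_num
      · rw [Pi.single_eq_of_ne h]
        obtain ⟨j, hj⟩ := Function.ne_iff.1 h
        symm
        refine Finset.prod_eq_zero (Finset.mem_univ j) ?_
        simp only [Pi.smul_apply, Pi.add_apply, Pi.one_apply, smul_eq_mul]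
        generalize s j = x at *
        generalize t j = y at *
        fin_cases x <;> fin_cases y <;> simp at hj ⊢
    rw [this]
    exact Subalgebra.prod_mem _ fun j _ => Subalgebra.smul_mem _ (add_mem (one_mem _)
      (Subalgebra.smul_mem _ (hz j) _)) _
  have : d = ∑ t, d t • (Pi.single t 1 : Fock n → ℂ) := by
    ext s
    simp [Finset.sum_apply, Pi.single_apply]
  rw [this]
  exact Subalgebra.sum_mem _ fun t _ => Subalgebra.smul_mem _ (hs t) _

lemma majorana_mul_single (j : Fin n) (s t : Fock n) :
    majorana n (0, j) * Matrix.single s t 1 = jwSign j s • Matrix.single (flip j s) t 1 := by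
  ext u v
  rw [majorana_mul_apply, Matrix.smul_apply, Matrix.single_apply, Matrix.single_apply]
  dsimp only
  by_cases h : flip j s = u ∧ t = v
  · obtain ⟨rfl, rfl⟩ := h
    simp [flip_flip, jwSign_flip_of_not_lt (lt_irrefl _), pauliPhase]
  · rw [if_neg h, if_neg, mul_zero, smul_zero]
    rintro ⟨h1, h2⟩
    exact h ⟨by rw [h1, flip_flip], h2⟩

/-- Starting from the diagonal unit at t, left multiplication by the Majorana operators of type X
moves the row index to s, one mode at a time. -/
lemma single_mem_adjoin_majorana (s t : Fock n) :
    Matrix.single s t (1 : ℂ) ∈ Algebra.adjoin ℂ (Set.range (majorana n)) := by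
  suffices h : ∀ F : Finset (Fin n), Matrix.single (F.piecewise s t) t (1 : ℂ) ∈
      Algebra.adjoin ℂ (Set.range (majorana n)) by
    simpa using h Finset.univ
  intro F
  induction F using Finset.induction_on with
  | empty =>
    rw [Finset.piecewise_empty, ← Matrix.diagonal_single]
    exact diagonal_mem_adjoin_majorana _
  | insert j F _ ih =>
    rw [Finset.piecewise_insert]
    generalize F.piecewise s t = u at *
    by_cases h : s j = u j
    · rwa [h, Function.update_eq_self]
    · have h1 : s j = 1 - u j := by
        revert h
        generalize s j = x
        generalize u j = y
        fin_cases x <;> fin_cases y <;> simp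
      have h2 := Subalgebra.smul_mem _ (mul_mem
        (Algebra.subset_adjoin (R := ℂ) (Set.mem_range_self (f := majorana n) (0, j))) ih)
        (jwSign j u)
      rw [majorana_mul_single, smul_smul, jwSign_mul_self, one_smul] at h2
      rw [h1]
      exact h2

lemma adjoin_majorana : Algebra.adjoin ℂ (Set.range (majorana n)) = ⊤ := by
  refine eq_top_iff.2 fun M _ => ?_
  rw [Matrix.matrix_eq_sum_single M]
  refine Subalgebra.sum_mem _ fun s _ => Subalgebra.sum_mem _ fun t _ => ?_
  have := Subalgebra.smul_mem _ (single_mem_adjoin_majorana s t) (M s t)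
  rwa [Matrix.smul_single, smul_eq_mul, mul_one] at this

end Generate

/-! ### Clifford systems -/

/-- A family of matrices satisfying the Majorana relations and generating the full matrix algebra,
together with its parity operator. -/
structure IsCliffordSystem {ι h : Type*} [DecidableEq ι] [Fintype h] [DecidableEq h]
    (c : ι → Matrix h h ℂ) (Θ : Matrix h h ℂ) : Prop where
  anticomm : ∀ k l, c k * c l + c l * c k = if k = l then 2 else 0
  herm : ∀ k, (c k)ᴴ = c k
  sq : Θ * Θ = 1
  parity_herm : Θᴴ = Θ
  parity_mul : ∀ k, Θ * c k = -(c k * Θ)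
  adjoin : Algebra.adjoin ℂ (Set.range c) = ⊤

lemma isCliffordSystem_majorana (n : ℕ) : IsCliffordSystem (majorana n) (parity n) where
  anticomm := majorana_anticomm
  herm := majorana_conjTranspose
  sq := parity_mul_self
  parity_herm := parity_conjTranspose
  parity_mul := parity_mul_majorana
  adjoin := adjoin_majorana

lemma two_kronecker_one (m n : Type*) [DecidableEq m] [DecidableEq n] :
    (2 : Matrix m m ℂ) ⊗ₖ (1 : Matrix n n ℂ) = 2 := by
  rw [show (2 : Matrix m m ℂ) = 1 + 1 from one_add_one_eq_two.symm, Matrix.add_kronecker,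
    Matrix.one_kronecker_one, one_add_one_eq_two]

lemma one_kronecker_two (m n : Type*) [DecidableEq m] [DecidableEq n] :
    (1 : Matrix m m ℂ) ⊗ₖ (2 : Matrix n n ℂ) = 2 := by
  rw [show (2 : Matrix n n ℂ) = 1 + 1 from one_add_one_eq_two.symm, Matrix.kronecker_add,
    Matrix.one_kronecker_one, one_add_one_eq_two]

lemma isCliffordSystem_jointMajorana (r n : ℕ) :
    IsCliffordSystem (jointMajorana r n) (parity r ⊗ₖ parity n) where
  anticomm := by
    rintro (k | k) (l | l) <;> simp only [jointMajorana, Sum.elim_inl, Sum.elim_inr,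
      ← Matrix.mul_kronecker_mul, mul_one, one_mul, parity_mul_self, Sum.inl.injEq, Sum.inr.injEq,
      reduceCtorEq, if_false]
    · rw [← Matrix.add_kronecker, majorana_anticomm]
      split_ifs
      · exact two_kronecker_one _ _
      · simp
    · rw [parity_mul_majorana, ← Matrix.add_kronecker, add_neg_cancel, Matrix.zero_kronecker]
    · rw [parity_mul_majorana, ← Matrix.add_kronecker, neg_add_cancel, Matrix.zero_kronecker]
    · rw [← Matrix.kronecker_add, majorana_anticomm]
      split_ifs
      · exact one_kronecker_two _ _
      · simp
  herm := by
    rintro (k | k) <;> simp only [jointMajorana, Sum.elim_inl, Sum.elim_inr,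
      Matrix.conjTranspose_kronecker, majorana_conjTranspose, parity_conjTranspose,
      Matrix.conjTranspose_one]
  sq := by rw [← Matrix.mul_kronecker_mul, parity_mul_self, parity_mul_self,
    Matrix.one_kronecker_one]
  parity_herm := by
    rw [Matrix.conjTranspose_kronecker, parity_conjTranspose, parity_conjTranspose]
  parity_mul := by
    rintro (k | k) <;> simp only [jointMajorana, Sum.elim_inl, Sum.elim_inr,
      ← Matrix.mul_kronecker_mul, mul_one, one_mul, parity_mul_majorana]
    · ext; simp [Matrix.kroneckerMap_apply]
    · ext; simp [Matrix.kroneckerMap_apply]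
  adjoin := by
    set S := Algebra.adjoin ℂ (Set.range (jointMajorana r n)) with hS
    have hl : ∀ X : Matrix (Fock r) (Fock r) ℂ, X ⊗ₖ (1 : Matrix (Fock n) (Fock n) ℂ) ∈ S := by
      intro X
      have hX : X ∈ Algebra.adjoin ℂ (Set.range (majorana r)) := by
        rw [adjoin_majorana]; trivial
      induction hX using Algebra.adjoin_induction with
      | mem x hx =>
        obtain ⟨k, rfl⟩ := hx
        exact Algebra.subset_adjoin ⟨Sum.inl k, rfl⟩
      | algebraMap a =>
        rw [Algebra.algebraMap_eq_smul_one, Matrix.smul_kronecker, Matrix.one_kronecker_one]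
        exact S.smul_mem (one_mem _) _
      | add x y _ _ hx hy => rw [Matrix.add_kronecker]; exact add_mem hx hy
      | mul x y _ _ hx hy =>
        rw [← mul_one (1 : Matrix (Fock n) (Fock n) ℂ), Matrix.mul_kronecker_mul]
        exact mul_mem hx hy
    have hr : ∀ Y : Matrix (Fock n) (Fock n) ℂ, (1 : Matrix (Fock r) (Fock r) ℂ) ⊗ₖ Y ∈ S := by
      intro X
      have hX : X ∈ Algebra.adjoin ℂ (Set.range (majorana n)) := by
        rw [adjoin_majorana]; trivial
      induction hX using Algebra.adjoin_induction with
      | mem x hx =>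
        obtain ⟨k, rfl⟩ := hx
        have h1 : jointMajorana r n (Sum.inr k) ∈ S := Algebra.subset_adjoin ⟨Sum.inr k, rfl⟩
        have h2 := mul_mem (hl (parity r)) h1
        rwa [jointMajorana, Sum.elim_inr, ← Matrix.mul_kronecker_mul, parity_mul_self, one_mul]
          at h2
      | algebraMap a =>
        rw [Algebra.algebraMap_eq_smul_one, Matrix.kronecker_smul, Matrix.one_kronecker_one]
        exact S.smul_mem (one_mem _) _
      | add x y _ _ hx hy => rw [Matrix.kronecker_add]; exact add_mem hx hy
      | mul x y _ _ hx hy =>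
        rw [← mul_one (1 : Matrix (Fock r) (Fock r) ℂ), Matrix.mul_kronecker_mul]
        exact mul_mem hx hy
    refine eq_top_iff.2 fun M _ => ?_
    rw [Matrix.matrix_eq_sum_single M]
    refine Subalgebra.sum_mem _ fun s _ => Subalgebra.sum_mem _ fun t _ => ?_
    have h1 : Matrix.single s t (M s t) = M s t • ((Matrix.single s.1 t.1 (1 : ℂ) ⊗ₖ
        (1 : Matrix (Fock n) (Fock n) ℂ)) *
          ((1 : Matrix (Fock r) (Fock r) ℂ) ⊗ₖ Matrix.single s.2 t.2 (1 : ℂ))) := by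
      rw [← Matrix.mul_kronecker_mul, mul_one, one_mul, Matrix.single_kronecker_single,
        Matrix.smul_single]
      simp
    rw [h1]
    exact S.smul_mem (mul_mem (hl _) (hr _)) _

/-! ### Wedge and contraction -/

section Contract

variable {h : Type*} [Fintype h] [DecidableEq h]

/-- The product `(a X - Θ X Θ a) / 2`; for `a` a Majorana operator it is
the contraction of `X` by `a`. -/
noncomputable def contract (Θ : Matrix h h ℂ) : Matrix h h ℂ →ₗ[ℂ] Matrix h h ℂ →ₗ[ℂ] Matrix h h ℂ :=
  LinearMap.mk₂ ℂ (fun a X => (1 / 2 : ℂ) • (a * X - Θ * X * Θ * a))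
    (fun a b X => by rw [add_mul, mul_add, ← smul_add]; congr 1; abel)
    (fun z a X => by rw [smul_mul_assoc, mul_smul_comm, ← smul_sub, smul_comm])
    (fun a X Y => by
      simp only [mul_add, add_mul, ← smul_add]; congr 1; abel)
    (fun z a X => by
      rw [mul_smul_comm, mul_smul_comm, smul_mul_assoc, smul_mul_assoc, ← smul_sub, smul_comm])

/-- The product `(a X + Θ X Θ a) / 2`; for `a` a Majorana operator it is the exterior product
of `a` and `X`. -/
noncomputable def wedge (Θ : Matrix h h ℂ) : Matrix h h ℂ →ₗ[ℂ] Matrix h h ℂ →ₗ[ℂ] Matrix h h ℂ :=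
  LinearMap.mk₂ ℂ (fun a X => (1 / 2 : ℂ) • (a * X + Θ * X * Θ * a))
    (fun a b X => by rw [add_mul, mul_add, ← smul_add]; congr 1; abel)
    (fun z a X => by rw [smul_mul_assoc, mul_smul_comm, ← smul_add, smul_comm])
    (fun a X Y => by
      simp only [mul_add, add_mul, ← smul_add]; congr 1; abel)
    (fun z a X => by
      rw [mul_smul_comm, mul_smul_comm, smul_mul_assoc, smul_mul_assoc, ← smul_add, smul_comm])

lemma contract_apply (Θ a X : Matrix h h ℂ) :
    contract Θ a X = (1 / 2 : ℂ) • (a * X - Θ * X * Θ * a) := rfl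

lemma wedge_apply (Θ a X : Matrix h h ℂ) :
    wedge Θ a X = (1 / 2 : ℂ) • (a * X + Θ * X * Θ * a) := rfl

lemma wedge_add_contract (Θ a X : Matrix h h ℂ) : wedge Θ a X + contract Θ a X = a * X := by
  rw [wedge_apply, contract_apply, ← smul_add, add_add_sub_cancel, ← two_smul ℂ (a * X), smul_smul]
  norm_num

lemma wedge_sub_contract (Θ a X : Matrix h h ℂ) :
    wedge Θ a X - contract Θ a X = Θ * X * Θ * a := by
  rw [wedge_apply, contract_apply, ← smul_sub, add_sub_sub_cancel, ← two_smul ℂ (Θ * X * Θ * a),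
    smul_smul]
  norm_num

end Contract

/-! ### Contractions and the operator form of Wick's theorem -/

namespace IsCliffordSystem

variable {ι h : Type*} [DecidableEq ι] [Fintype h] [DecidableEq h]
  {c : ι → Matrix h h ℂ} {Θ : Matrix h h ℂ}

/-- Since the Majorana operators generate the matrix algebra, their monomials span it; linear
identities need checking on monomials only. -/
lemma induction (hc : IsCliffordSystem c Θ) {p : Matrix h h ℂ → Prop}
    (prod : ∀ l : List ι, p (l.map c).prod) (add : ∀ X Y, p X → p Y → p (X + Y))
    (smul : ∀ (z : ℂ) X, p X → p (z • X)) (X : Matrix h h ℂ) : p X := by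
  have hX : X ∈ Submodule.span ℂ (Submonoid.closure (Set.range c) : Set (Matrix h h ℂ)) := by
    rw [← Algebra.adjoin_eq_span, hc.adjoin]; trivial
  induction hX using Submodule.span_induction with
  | mem x hx =>
    obtain ⟨l, hl, rfl⟩ := Submonoid.exists_list_of_mem_closure hx
    have hl' : l ∈ Set.range (List.map c) := by rw [Set.range_list_map]; exact hl
    obtain ⟨l, rfl⟩ := hl'
    exact prod _
  | zero => simpa using smul 0 _ (prod [])
  | add x y _ _ hx hy => exact add x y hx hy
  | smul a x _ hx => exact smul a x hx

lemma parity_conj (hc : IsCliffordSystem c Θ) (k : ι) : Θ * c k * Θ = -c k := by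
  rw [hc.parity_mul, neg_mul, mul_assoc, hc.sq, mul_one]

lemma parity_conj_mul (hc : IsCliffordSystem c Θ) (X Y : Matrix h h ℂ) :
    Θ * (X * Y) * Θ = (Θ * X * Θ) * (Θ * Y * Θ) := by
  have : (Θ * X * Θ) * (Θ * Y * Θ) = Θ * X * (Θ * Θ) * Y * Θ := by noncomm_ring
  rw [this, hc.sq]; noncomm_ring

lemma parity_conj_parity_conj (hc : IsCliffordSystem c Θ) (X : Matrix h h ℂ) :
    Θ * (Θ * X * Θ) * Θ = X := by
  have : Θ * (Θ * X * Θ) * Θ = (Θ * Θ) * X * (Θ * Θ) := by noncomm_ring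
  rw [this, hc.sq]; noncomm_ring

lemma parity_conj_prod (hc : IsCliffordSystem c Θ) (l : List ι) :
    Θ * (l.map c).prod * Θ = (-1 : ℂ) ^ l.length • (l.map c).prod := by
  induction l with
  | nil => simp [hc.sq]
  | cons a t ih =>
    rw [List.map_cons, List.prod_cons, hc.parity_conj_mul, hc.parity_conj, ih, List.length_cons,
      pow_succ]
    simp

lemma contract_one (hc : IsCliffordSystem c Θ) (a : Matrix h h ℂ) : contract Θ a 1 = 0 := by
  rw [contract_apply, mul_one, mul_one, hc.sq, one_mul, sub_self, smul_zero]

/-- Contraction is an antiderivation: moving c m past c k costs 2δ, and the parity conjugation of c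
k supplies the sign. -/
lemma contract_mul (hc : IsCliffordSystem c Θ) (m k : ι) (X : Matrix h h ℂ) :
    contract Θ (c m) (c k * X) =
      (if m = k then (1 : ℂ) else 0) • X - c k * contract Θ (c m) X := by
  rw [contract_apply, contract_apply, hc.parity_conj_mul, hc.parity_conj, mul_smul_comm, mul_sub]
  have h1 := hc.anticomm m k
  have h2 : c m * (c k * X) = (if m = k then (2 : ℂ) else 0) • X - c k * (c m * X) := by
    rw [eq_sub_iff_add_eq, ← mul_assoc, ← mul_assoc, ← add_mul, h1]
    split_ifs
    · rw [two_mul, two_smul]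
    · simp
  rw [h2]
  have h3 : (if m = k then (1 : ℂ) else 0) = (1 / 2) * (if m = k then 2 else 0) := by
    split_ifs <;> norm_num
  rw [h3, mul_smul, ← smul_sub]
  congr 1
  noncomm_ring

lemma contract_prod (hc : IsCliffordSystem c Θ) (m : ι) (l : List ι) :
    contract Θ (c m) (l.map c).prod =
      ∑ j : Fin l.length, ((-1 : ℂ) ^ (j : ℕ) * if m = l.get j then 1 else 0) •
        ((l.eraseIdx j).map c).prod := by
  induction l with
  | nil => simp [hc.contract_one]
  | cons a t ih =>
    rw [List.map_cons, List.prod_cons, hc.contract_mul, ih]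
    change _ = ∑ j : Fin (t.length + 1), _
    rw [Fin.sum_univ_succ, Finset.mul_sum, sub_eq_add_neg, ← Finset.sum_neg_distrib]
    congr 1
    · change (if m = a then (1 : ℂ) else 0) • (t.map c).prod =
        ((-1 : ℂ) ^ 0 * if m = a then 1 else 0) • (t.map c).prod
      rw [pow_zero, one_mul]
    · refine Finset.sum_congr rfl fun j _ => ?_
      rw [mul_smul_comm, ← neg_smul]
      congr 1
      simp [pow_succ]
      split_ifs <;> simp

/-- The alternating sum over partners in a list is a sum of contractions, so Wick's theorem becomes
linear in X and holds for arbitrary operators instead of monomials. -/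
lemma wick_iff [Fintype ι] (hc : IsCliffordSystem c Θ) {ρ : Matrix h h ℂ} :
    IsGaussianState c ρ ↔ IsState ρ ∧ ∀ k X, (ρ * (c k * X)).trace =
      ∑ m, (ρ * (c k * c m)).trace * (ρ * contract Θ (c m) X).trace := by
  have key : ∀ k (l : List ι),
      ∑ j : Fin l.length, (-1 : ℂ) ^ (j : ℕ) * (ρ * (c k * c (l.get j))).trace *
        (ρ * ((l.eraseIdx j).map c).prod).trace =
      ∑ m, (ρ * (c k * c m)).trace * (ρ * contract Θ (c m) (l.map c).prod).trace := by
    intro k l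
    simp_rw [hc.contract_prod, Finset.mul_sum, Matrix.trace_sum, Finset.mul_sum]
    rw [Finset.sum_comm]
    refine Finset.sum_congr rfl fun j _ => ?_
    rw [Finset.sum_eq_single (l.get j)]
    · rw [mul_smul_comm, Matrix.trace_smul]
      simp; ring
    · intro b _ hb
      rw [if_neg hb]; simp
    · simp
  refine and_congr_right fun _ => ⟨fun H k X => ?_, fun H k l => ?_⟩
  · refine hc.induction (p := fun X => (ρ * (c k * X)).trace =
      ∑ m, (ρ * (c k * c m)).trace * (ρ * contract Θ (c m) X).trace) ?_ ?_ ?_ X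
    · intro l
      rw [H, key]
    · intro X Y hX hY
      simp only [mul_add, Matrix.trace_add, map_add, Finset.sum_add_distrib, hX, hY]
    · intro z X hX
      simp only [mul_smul_comm, Matrix.trace_smul, map_smul, smul_eq_mul, hX, Finset.mul_sum]
      exact Finset.sum_congr rfl fun _ _ => by ring
  · rw [H, key]

lemma trace_mul_mul (hc : IsCliffordSystem c Θ) {ρ : Matrix h h ℂ} (hρ : ρ.trace = 1) (k l : ι) :
    (ρ * (c k * c l)).trace =
      (if k = l then 1 else 0) - Complex.I * covariance c ρ k l := by
  have h1 : c k * c l - c l * c k = (2 : ℂ) • (c k * c l) - (if k = l then (2 : ℂ) else 0) • 1 := by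
    have := hc.anticomm k l
    have h2 : c l * c k = (if k = l then (2 : ℂ) else 0) • 1 - c k * c l := by
      rw [eq_sub_iff_add_eq', this]
      split_ifs
      · rw [ofNat_smul_eq_nsmul]; simp
      · simp
    rw [h2, two_smul]; abel
  rw [covariance, Matrix.of_apply, h1, mul_sub, mul_smul_comm, mul_smul_comm, Matrix.trace_sub,
    Matrix.trace_smul, Matrix.trace_smul, mul_one, hρ]
  have hI : Complex.I * Complex.I = -1 := Complex.I_mul_I
  split_ifs <;> simp only [smul_eq_mul]
  · linear_combination ((ρ * (c k * c l)).trace - 1) * hI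
  · linear_combination (ρ * (c k * c l)).trace * hI

/-- Gaussian states are even: the Wick recursion removes two operators at a time, so an odd moment
reduces to that of a single operator, which is an empty sum. -/
lemma trace_parity_conj (hc : IsCliffordSystem c Θ) {ρ : Matrix h h ℂ} (hρ : IsGaussianState c ρ)
    (X : Matrix h h ℂ) : (ρ * (Θ * X * Θ)).trace = (ρ * X).trace := by
  have odd : ∀ (N : ℕ) (l : List ι), l.length = N → Odd N → (ρ * (l.map c).prod).trace = 0 := by
    intro N
    induction N using Nat.strong_induction_on with
    | _ N ih =>
      intro l hl hN
      cases l with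
      | nil => subst hl; simp at hN
      | cons k t =>
        rw [List.map_cons, List.prod_cons, hρ.2]
        refine Finset.sum_eq_zero fun j _ => ?_
        have hj := j.2
        have h1 : (t.eraseIdx j).length = t.length - 1 := by
          rw [List.length_eraseIdx]; simp
        rw [List.length_cons] at hl
        rw [ih (t.length - 1) (by omega) _ h1, mul_zero]
        obtain ⟨q, hq⟩ := hN
        exact ⟨q - 1, by omega⟩
  refine hc.induction (p := fun X => (ρ * (Θ * X * Θ)).trace = (ρ * X).trace) ?_ ?_ ?_ X
  · intro l
    rw [hc.parity_conj_prod]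
    rcases Nat.even_or_odd l.length with h1 | h1
    · rw [h1.neg_one_pow, one_smul]
    · rw [mul_smul_comm, Matrix.trace_smul, odd _ l rfl h1, smul_zero]
  · intro X Y hX hY
    rw [mul_add, add_mul, mul_add, mul_add, Matrix.trace_add, Matrix.trace_add, hX, hY]
  · intro z X hX
    rw [mul_smul_comm, smul_mul_assoc, mul_smul_comm, mul_smul_comm, Matrix.trace_smul,
      Matrix.trace_smul, hX]

end IsCliffordSystem

/-! ### Pure Gaussian states from linear annihilators -/

namespace IsCliffordSystem

variable {ι h : Type*} [DecidableEq ι] [Fintype h] [DecidableEq h]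
  {c : ι → Matrix h h ℂ} {Θ : Matrix h h ℂ}

lemma contract_self (hc : IsCliffordSystem c Θ) (m k : ι) :
    contract Θ (c m) (c k) = (if m = k then (1 : ℂ) else 0) • 1 := by
  have := hc.contract_mul m k 1
  rwa [mul_one, hc.contract_one, mul_zero, sub_zero] at this

variable [Fintype ι]

/-- Each c k - i Σ Γ k m c m annihilates ρ from the left. As Γ is real, the adjoint gives ρ c k = -i
Σ Γ k m ρ c m. Averaging the relation for c k X with that for (ΘXΘ) c k turns the exterior product
by c k into contractions, which is Wick's theorem with covariance Γ. -/
lemma trace_mul_of_annihilators (hc : IsCliffordSystem c Θ) {ρ : Matrix h h ℂ} (hρ : ρᴴ = ρ)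
    {Γ : Matrix ι ι ℝ} (H : ∀ k, c k * ρ = ∑ m, (Complex.I * Γ k m) • (c m * ρ)) (k : ι)
    (X : Matrix h h ℂ) :
    (ρ * (c k * X)).trace = (ρ * contract Θ (c k) X).trace -
      Complex.I * ∑ m, (Γ k m : ℂ) * (ρ * contract Θ (c m) X).trace := by
  have H' : ∀ k, ρ * c k = ∑ m, (-(Complex.I * Γ k m)) • (ρ * c m) := by
    intro k
    have := congrArg Matrix.conjTranspose (H k)
    rw [Matrix.conjTranspose_mul, hc.herm, hρ, Matrix.conjTranspose_sum] at this
    rw [this]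
    refine Finset.sum_congr rfl fun m _ => ?_
    rw [Matrix.conjTranspose_smul, Matrix.conjTranspose_mul, hc.herm, hρ]
    simp
  have h1 : (ρ * (c k * X)).trace = -(Complex.I * ∑ m, (Γ k m : ℂ) * (ρ * (c m * X)).trace) := by
    rw [← mul_assoc, H', Finset.sum_mul, Matrix.trace_sum, Finset.mul_sum, ← Finset.sum_neg_distrib]
    refine Finset.sum_congr rfl fun m _ => ?_
    rw [smul_mul_assoc, Matrix.trace_smul, mul_assoc, smul_eq_mul]
    ring
  have h2 : (ρ * (Θ * X * Θ * c k)).trace =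
      Complex.I * ∑ m, (Γ k m : ℂ) * (ρ * (Θ * X * Θ * c m)).trace := by
    -- Cyclicity brings the rightmost Majorana operator to the left of ρ, where `H` applies.
    have cyc : ∀ j, (ρ * (Θ * X * Θ * c j)).trace = (c j * ρ * (Θ * X * Θ)).trace := by
      intro j
      rw [← mul_assoc, Matrix.trace_mul_comm, ← mul_assoc]
    simp_rw [cyc]
    rw [H k, Finset.sum_mul, Matrix.trace_sum, Finset.mul_sum]
    refine Finset.sum_congr rfl fun m _ => ?_
    rw [smul_mul_assoc, Matrix.trace_smul, smul_eq_mul]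
    ring
  have h3 : ∀ m, (ρ * contract Θ (c m) X).trace =
      (1 / 2 : ℂ) * ((ρ * (c m * X)).trace - (ρ * (Θ * X * Θ * c m)).trace) := by
    intro m
    rw [contract_apply, mul_smul_comm, Matrix.trace_smul, mul_sub, Matrix.trace_sub, smul_eq_mul]
  simp_rw [h3]
  have h4 : ∑ m, (Γ k m : ℂ) *
      ((1 / 2 : ℂ) * ((ρ * (c m * X)).trace - (ρ * (Θ * X * Θ * c m)).trace)) =
      (1 / 2 : ℂ) * (∑ m, (Γ k m : ℂ) * (ρ * (c m * X)).trace -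
        ∑ m, (Γ k m : ℂ) * (ρ * (Θ * X * Θ * c m)).trace) := by
    rw [← Finset.sum_sub_distrib, Finset.mul_sum]
    exact Finset.sum_congr rfl fun m _ => by ring
  rw [h4]
  linear_combination (1 / 2 : ℂ) * h1 + (1 / 2 : ℂ) * h2

lemma isGaussianState_of_annihilators (hc : IsCliffordSystem c Θ) {ρ : Matrix h h ℂ}
    (hρ : IsState ρ) {Γ : Matrix ι ι ℝ}
    (H : ∀ k, c k * ρ = ∑ m, (Complex.I * Γ k m) • (c m * ρ)) :
    IsGaussianState c ρ ∧ covariance c ρ = Γ.map Complex.ofReal := by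
  have key := hc.trace_mul_of_annihilators hρ.1.1 H
  have h2 : ∀ k m, (ρ * (c k * c m)).trace =
      (if k = m then 1 else 0) - Complex.I * (Γ k m : ℂ) := by
    intro k m
    rw [key]
    simp_rw [hc.contract_self, mul_smul_comm, mul_one, Matrix.trace_smul, hρ.2]
    simp
  refine ⟨hc.wick_iff.2 ⟨hρ, fun k X => ?_⟩, ?_⟩
  · rw [key]
    simp_rw [h2, sub_mul, Finset.sum_sub_distrib, Finset.mul_sum, mul_assoc]
    simp
  · ext k m
    have h3 := hc.trace_mul_mul hρ.2 k m
    rw [h2] at h3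
    rw [Matrix.map_apply]
    have h4 := mul_left_cancel₀ Complex.I_ne_zero (sub_right_injective h3)
    exact h4.symm

end IsCliffordSystem

/-! ### A maximally entangled Gaussian state -/

section MaxEntangled

variable (n : ℕ)

/-- A maximally entangled vector of `n + n` fermionic modes. -/
noncomputable def maxEntVec : Fock n × Fock n → ℂ := fun x =>
  if x.1 = x.2 then (((√(2 * Fintype.card (Fock n)))⁻¹ : ℝ) : ℂ) * (1 - Complex.I * paritySign x.1)
  else 0

/-- The projector on `maxEntVec`. -/
noncomputable def maxEnt : Matrix (Fock n × Fock n) (Fock n × Fock n) ℂ :=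
  Matrix.vecMulVec (maxEntVec n) (star (maxEntVec n))

/-- The sign relating the transpose of a Majorana operator to itself. -/
def transposeSign (k : Maj n) : ℝ := if k.1 = 0 then 1 else -1

/-- The covariance matrix of `maxEnt`. -/
def maxEntCov : Matrix (Maj n ⊕ Maj n) (Maj n ⊕ Maj n) ℝ :=
  Matrix.fromBlocks 0 (Matrix.diagonal (transposeSign n)) (-Matrix.diagonal (transposeSign n)) 0

variable {n}

lemma one_sub_mul_star (s : Fock n) :
    (1 - Complex.I * paritySign s) * star (1 - Complex.I * paritySign s) = 2 := by
  have h1 := paritySign_mul_self s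
  have h2 : star Complex.I = -Complex.I := Complex.conj_I
  rw [star_sub, star_mul', star_paritySign, h2, star_one]
  linear_combination (-Complex.I * Complex.I) * h1 - Complex.I_mul_I

lemma one_sub_ne_zero (s : Fock n) : 1 - Complex.I * paritySign s ≠ 0 := by
  intro h
  have := one_sub_mul_star s
  rw [h, zero_mul] at this
  exact two_ne_zero this.symm

lemma isState_maxEnt : IsState (maxEnt n) := by
  refine ⟨Matrix.posSemidef_vecMulVec_self_star _, ?_⟩
  rw [maxEnt, Matrix.trace_vecMulVec, dotProduct, Fintype.sum_prod_type]
  have h0 : (0 : ℝ) < 2 * Fintype.card (Fock n) := by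
    have : 0 < Fintype.card (Fock n) := Fintype.card_pos
    positivity
  have h1 : ∀ s : Fock n, ∑ t, maxEntVec n (s, t) * star (maxEntVec n) (s, t) =
      ((Fintype.card (Fock n) : ℝ)⁻¹ : ℝ) := by
    intro s
    rw [Finset.sum_eq_single s]
    · have h2 := one_sub_mul_star s
      simp only [maxEntVec, Pi.star_apply, if_true, star_mul']
      have h3 : star (((√(2 * Fintype.card (Fock n)))⁻¹ : ℝ) : ℂ) =
        (((√(2 * Fintype.card (Fock n)))⁻¹ : ℝ) : ℂ) := Complex.conj_ofReal _
      rw [h3, mul_mul_mul_comm, h2, ← Complex.ofReal_mul, ← mul_inv, Real.mul_self_sqrt h0.le]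
      push_cast
      rw [mul_inv]
      field_simp
    · intro t _ ht
      simp [maxEntVec, Ne.symm ht]
    · simp
  simp_rw [h1]
  rw [Finset.sum_const, Finset.card_univ, nsmul_eq_mul]
  push_cast
  exact mul_inv_cancel₀ (by exact_mod_cast Fintype.card_ne_zero)

lemma majorana_swap (k : Maj n) (s t : Fock n) :
    majorana n k s t = transposeSign n k * majorana n k t s := by
  rw [majorana_apply, majorana_apply_row]
  split_ifs
  · generalize t k.2 = x
    obtain ⟨a, j⟩ := k
    fin_cases a <;> fin_cases x <;> simp [transposeSign, pauliPhase]
  · simp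

lemma transposeSign_mul_self (k : Maj n) : transposeSign n k * transposeSign n k = 1 := by
  unfold transposeSign; split_ifs <;> simp

/-- The phase 1 - i p(s), with p the parity sign, is built into the vector for this relation: a flip
changes p to -p, and 1 + ip = ip(1 - ip). The factor p cancels the parity string of the second half,
and the factor i is the one required of linear annihilators. -/
lemma jointMajorana_mulVec_maxEntVec (k : Maj n) :
    jointMajorana n n (Sum.inl k) *ᵥ maxEntVec n =
      (Complex.I * transposeSign n k) • (jointMajorana n n (Sum.inr k) *ᵥ maxEntVec n) := by
  ext ⟨s, t⟩
  have h1 : (jointMajorana n n (Sum.inl k) *ᵥ maxEntVec n) (s, t) =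
      majorana n k s t * maxEntVec n (t, t) := by
    rw [Matrix.mulVec, dotProduct, Finset.sum_eq_single (t, t)]
    · simp [jointMajorana, Matrix.kroneckerMap_apply]
    · rintro ⟨u, v⟩ _ huv
      simp only [jointMajorana, Sum.elim_inl, Matrix.kroneckerMap_apply, maxEntVec]
      by_cases h : u = v
      · subst h
        have : t ≠ u := by rintro rfl; exact huv rfl
        simp [this]
      · simp [h]
    · simp
  have h2 : (jointMajorana n n (Sum.inr k) *ᵥ maxEntVec n) (s, t) =
      paritySign s * majorana n k t s * maxEntVec n (s, s) := by
    rw [Matrix.mulVec, dotProduct, Finset.sum_eq_single (s, s)]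
    · simp [jointMajorana, Matrix.kroneckerMap_apply, parity_eq]
    · rintro ⟨u, v⟩ _ huv
      simp only [jointMajorana, Sum.elim_inr, Matrix.kroneckerMap_apply, maxEntVec]
      by_cases h : u = v
      · subst h
        have : s ≠ u := by rintro rfl; exact huv rfl
        simp [parity_eq, this]
      · simp [h]
    · simp
  rw [Pi.smul_apply, h1, h2, smul_eq_mul, majorana_swap k s t]
  rw [majorana_apply]
  split_ifs with h
  · have h3 := paritySign_flip k.2 s
    rw [← h] at h3
    simp only [maxEntVec, if_true, h3]
    have h4 := paritySign_mul_self s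
    set a : ℂ := (((√(2 * Fintype.card (Fock n)))⁻¹ : ℝ) : ℂ)
    set b := jwSign k.2 s * pauliPhase k.1 (s k.2)
    linear_combination (transposeSign n k * b * a * Complex.I * Complex.I) * h4 +
      (transposeSign n k * b * a) * Complex.I_mul_I
  · simp

lemma jointMajorana_mul_maxEnt (k : Maj n ⊕ Maj n) :
    jointMajorana n n k * maxEnt n =
      ∑ m, (Complex.I * maxEntCov n k m) • (jointMajorana n n m * maxEnt n) := by
  rw [Fintype.sum_sum_type]
  have hI := Complex.I_mul_I
  simp only [maxEnt, Matrix.mul_vecMulVec]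
  rcases k with k | k
  · simp only [maxEntCov, Matrix.fromBlocks_apply₁₁, Matrix.fromBlocks_apply₁₂, Matrix.zero_apply,
      Complex.ofReal_zero, mul_zero, zero_smul, Finset.sum_const_zero, zero_add]
    rw [Finset.sum_eq_single k]
    · rw [Matrix.diagonal_apply_eq, jointMajorana_mulVec_maxEntVec, Matrix.smul_vecMulVec]
    · intro b _ hb
      rw [Matrix.diagonal_apply_ne _ (Ne.symm hb)]; simp
    · simp
  · simp only [maxEntCov, Matrix.fromBlocks_apply₂₁, Matrix.fromBlocks_apply₂₂, Matrix.zero_apply,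
      Complex.ofReal_zero, mul_zero, zero_smul, Finset.sum_const_zero, add_zero]
    rw [Finset.sum_eq_single k]
    · rw [Matrix.neg_apply, Matrix.diagonal_apply_eq, jointMajorana_mulVec_maxEntVec,
        Matrix.smul_vecMulVec, smul_smul]
      have h1 : (transposeSign n k : ℂ) * transposeSign n k = 1 := by
        exact_mod_cast transposeSign_mul_self k
      have : Complex.I * ((-transposeSign n k : ℝ) : ℂ) * (Complex.I * transposeSign n k) = 1 := by
        push_cast
        linear_combination (-(Complex.I * Complex.I)) * h1 - hI
      rw [this, one_smul]
    · intro b _ hb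
      rw [Matrix.neg_apply, Matrix.diagonal_apply_ne _ (Ne.symm hb)]; simp
    · simp

lemma isGaussianState_maxEnt : IsGaussianState (jointMajorana n n) (maxEnt n) :=
  ((isCliffordSystem_jointMajorana n n).isGaussianState_of_annihilators isState_maxEnt
    jointMajorana_mul_maxEnt).1

lemma covariance_maxEnt :
    covariance (jointMajorana n n) (maxEnt n) = (maxEntCov n).map Complex.ofReal :=
  ((isCliffordSystem_jointMajorana n n).isGaussianState_of_annihilators isState_maxEnt
    jointMajorana_mul_maxEnt).2

/-- All Schmidt coefficients of the vector are nonzero, so matrix units in the first factor read off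
every entry of the second. The parity in front of x is what contraction by a second-half Majorana
operator leaves behind. -/
lemma eq_of_trace_maxEnt {z z' : Matrix (Fock n) (Fock n) ℂ}
    (H : ∀ x, (maxEnt n * ((parity n * x) ⊗ₖ z)).trace = (maxEnt n * ((parity n * x) ⊗ₖ z')).trace) :
    z = z' := by
  ext s t
  have key : ∀ w : Matrix (Fock n) (Fock n) ℂ, (maxEnt n * (Matrix.single s t (1 : ℂ) ⊗ₖ w)).trace =
      maxEntVec n (t, t) * star (maxEntVec n (s, s)) * w s t := by
    intro w
    rw [Matrix.trace, Finset.sum_eq_single (t, t)]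
    · rw [Matrix.diag_apply, Matrix.mul_apply, Finset.sum_eq_single (s, s)]
      · simp [maxEnt, Matrix.vecMulVec_apply, Matrix.kroneckerMap_apply]
      · rintro ⟨u, v⟩ _ huv
        by_cases h : u = v
        · subst h
          have : s ≠ u := by rintro rfl; exact huv rfl
          simp [Matrix.kroneckerMap_apply, this]
        · simp [maxEnt, Matrix.vecMulVec_apply, maxEntVec, h]
      · simp
    · rintro ⟨u, v⟩ _ huv
      rw [Matrix.diag_apply, Matrix.mul_apply]
      refine Finset.sum_eq_zero fun w' _ => ?_
      by_cases h : u = v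
      · subst h
        have : t ≠ u := by rintro rfl; exact huv rfl
        simp [Matrix.kroneckerMap_apply, this]
      · simp [maxEnt, Matrix.vecMulVec_apply, maxEntVec, h]
    · simp
  have h0 : ∀ u : Fock n, maxEntVec n (u, u) ≠ 0 := by
    intro u
    simp only [maxEntVec, if_true]
    refine mul_ne_zero ?_ (one_sub_ne_zero u)
    have : (0 : ℝ) < 2 * Fintype.card (Fock n) := by
      have : 0 < Fintype.card (Fock n) := Fintype.card_pos
      positivity
    exact_mod_cast (inv_pos.2 (Real.sqrt_pos.2 this)).ne'
  have h1 := H (parity n * Matrix.single s t 1)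
  rw [← mul_assoc, parity_mul_self, one_mul, key, key] at h1
  exact mul_left_cancel₀ (mul_ne_zero (h0 t) (star_ne_zero.2 (h0 s))) h1

end MaxEntangled

/-! ### The Heisenberg picture -/

section Heisenberg

variable {h h' : Type*} [Fintype h] [DecidableEq h] [Fintype h'] [DecidableEq h']

/-- The trace dual of a map on matrices. -/
noncomputable def heisenberg (T : Matrix h h ℂ →ₗ[ℂ] Matrix h' h' ℂ) :
    Matrix h' h' ℂ →ₗ[ℂ] Matrix h h ℂ where
  toFun Y := Matrix.of fun i j => (T (Matrix.single j i 1) * Y).trace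
  map_add' Y Z := by ext; simp [mul_add]
  map_smul' z Y := by ext; simp

lemma trace_heisenberg (T : Matrix h h ℂ →ₗ[ℂ] Matrix h' h' ℂ) (ρ : Matrix h h ℂ)
    (Y : Matrix h' h' ℂ) : (T ρ * Y).trace = (ρ * heisenberg T Y).trace := by
  have h1 : T ρ = ∑ i, ∑ j, ρ i j • T (Matrix.single i j 1) := by
    conv_lhs => rw [Matrix.matrix_eq_sum_single ρ]
    simp_rw [map_sum, ← map_smul, Matrix.smul_single, smul_eq_mul, mul_one]
  rw [h1]
  simp_rw [Finset.sum_mul, smul_mul_assoc, Matrix.trace_sum, Matrix.trace_smul]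
  rw [Matrix.trace]
  simp_rw [Matrix.diag_apply, Matrix.mul_apply]
  rfl

lemma heisenberg_eq_iff {T : Matrix h h ℂ →ₗ[ℂ] Matrix h' h' ℂ} {Y : Matrix h' h' ℂ}
    {Z : Matrix h h ℂ} : heisenberg T Y = Z ↔ ∀ ρ, (T ρ * Y).trace = (ρ * Z).trace := by
  refine ⟨fun H ρ => by rw [trace_heisenberg, H], fun H => ?_⟩
  refine Matrix.ext_iff_trace_mul_left.2 fun ρ => ?_
  rw [← trace_heisenberg, H]

lemma trace_mul_kronecker {r g : Type*} [Fintype r] [Fintype g]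
    (Z : Matrix (r × g) (r × g) ℂ) (x : Matrix r r ℂ) (w : Matrix g g ℂ) :
    (Z * (x ⊗ₖ w)).trace =
      ∑ a, ∑ b, x b a * ((Matrix.of fun i j => Z (a, i) (b, j)) * w).trace := by
  simp only [Matrix.trace, Matrix.diag_apply, Matrix.mul_apply, Fintype.sum_prod_type,
    Matrix.kroneckerMap_apply, Matrix.of_apply, Finset.mul_sum]
  refine Finset.sum_congr rfl fun a _ => ?_
  rw [Finset.sum_comm]
  refine Finset.sum_congr rfl fun b _ => Finset.sum_congr rfl fun i _ =>
    Finset.sum_congr rfl fun j _ => by ring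

/-- Expectations in the Choi state of T thereby become expectations in `maxEnt` of the dual map. -/
lemma trace_ampliation {r : Type*} [Fintype r]
    (T : Matrix h h ℂ →ₗ[ℂ] Matrix h' h' ℂ)
    (X : Matrix (r × h) (r × h) ℂ) (x : Matrix r r ℂ) (y : Matrix h' h' ℂ) :
    (ampliation r T X * (x ⊗ₖ y)).trace = (X * (x ⊗ₖ heisenberg T y)).trace := by
  rw [trace_mul_kronecker, trace_mul_kronecker]
  refine Finset.sum_congr rfl fun a _ => Finset.sum_congr rfl fun b _ => ?_
  rw [← trace_heisenberg]
  rfl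

end Heisenberg

/-! ### Gaussian channels in the Heisenberg picture -/

section GaussianChannel

variable {n : ℕ}

lemma parity_conj_kronecker {r n : ℕ} (x : Matrix (Fock r) (Fock r) ℂ)
    (y : Matrix (Fock n) (Fock n) ℂ) :
    (parity r ⊗ₖ parity n) * (x ⊗ₖ y) * (parity r ⊗ₖ parity n) =
      (parity r * x * parity r) ⊗ₖ (parity n * y * parity n) := by
  rw [← Matrix.mul_kronecker_mul, ← Matrix.mul_kronecker_mul]

lemma contract_inr_kronecker {r n : ℕ} (k : Maj n) (x : Matrix (Fock r) (Fock r) ℂ)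
    (y : Matrix (Fock n) (Fock n) ℂ) :
    contract (parity r ⊗ₖ parity n) (jointMajorana r n (Sum.inr k)) (x ⊗ₖ y) =
      (parity r * x) ⊗ₖ contract (parity n) (majorana n k) y := by
  rw [contract_apply, contract_apply, parity_conj_kronecker, jointMajorana, Sum.elim_inr,
    ← Matrix.mul_kronecker_mul, ← Matrix.mul_kronecker_mul, mul_assoc _ (parity r) (parity r),
    parity_mul_self, mul_one, Matrix.kronecker_smul, sub_eq_add_neg, sub_eq_add_neg,
    Matrix.kronecker_add]
  congr 2
  ext; simp [Matrix.kroneckerMap_apply]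

lemma wedge_inr_kronecker {r n : ℕ} (k : Maj n) (x : Matrix (Fock r) (Fock r) ℂ)
    (y : Matrix (Fock n) (Fock n) ℂ) :
    wedge (parity r ⊗ₖ parity n) (jointMajorana r n (Sum.inr k)) (x ⊗ₖ y) =
      (parity r * x) ⊗ₖ wedge (parity n) (majorana n k) y := by
  rw [wedge_apply, wedge_apply, parity_conj_kronecker, jointMajorana, Sum.elim_inr,
    ← Matrix.mul_kronecker_mul, ← Matrix.mul_kronecker_mul, mul_assoc _ (parity r) (parity r),
    parity_mul_self, mul_one, Matrix.kronecker_smul, Matrix.kronecker_add]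

/-- Only the off-diagonal blocks of `maxEntCov` are nonzero, so Wick's theorem trades an exterior
product in one half for a contraction in the other. The next lemma is the trade in the opposite
direction. -/
lemma trace_maxEnt_wedge_inl (a : Maj n) (x z : Matrix (Fock n) (Fock n) ℂ) :
    (maxEnt n * wedge (parity n ⊗ₖ parity n) (jointMajorana n n (Sum.inl a)) (x ⊗ₖ z)).trace =
      -(Complex.I * (transposeSign n a *
        (maxEnt n * ((parity n * x) ⊗ₖ contract (parity n) (majorana n a) z)).trace)) := by
  have h := (isCliffordSystem_jointMajorana n n).trace_mul_of_annihilators isState_maxEnt.1.1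
    jointMajorana_mul_maxEnt (Sum.inl a) (x ⊗ₖ z)
  rw [← wedge_add_contract (parity n ⊗ₖ parity n) (jointMajorana n n _), mul_add, Matrix.trace_add,
    Fintype.sum_sum_type] at h
  simp only [maxEntCov, Matrix.fromBlocks_apply₁₁, Matrix.fromBlocks_apply₁₂, Matrix.zero_apply,
    Complex.ofReal_zero, zero_mul, Finset.sum_const_zero, zero_add, contract_inr_kronecker] at h
  rw [Finset.sum_eq_single a] at h
  · rw [Matrix.diagonal_apply_eq] at h
    linear_combination h
  · intro b _ hb
    rw [Matrix.diagonal_apply_ne _ (Ne.symm hb)]; simp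
  · simp

lemma trace_maxEnt_wedge_inr (a : Maj n) (x z : Matrix (Fock n) (Fock n) ℂ) :
    (maxEnt n * ((parity n * x) ⊗ₖ wedge (parity n) (majorana n a) z)).trace =
      Complex.I * (transposeSign n a * (maxEnt n *
        contract (parity n ⊗ₖ parity n) (jointMajorana n n (Sum.inl a)) (x ⊗ₖ z)).trace) := by
  have h := (isCliffordSystem_jointMajorana n n).trace_mul_of_annihilators isState_maxEnt.1.1
    jointMajorana_mul_maxEnt (Sum.inr a) (x ⊗ₖ z)
  rw [← wedge_add_contract (parity n ⊗ₖ parity n) (jointMajorana n n _), mul_add, Matrix.trace_add,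
    Fintype.sum_sum_type, wedge_inr_kronecker] at h
  simp only [maxEntCov, Matrix.fromBlocks_apply₂₁, Matrix.fromBlocks_apply₂₂, Matrix.zero_apply,
    Complex.ofReal_zero, zero_mul, Finset.sum_const_zero, add_zero] at h
  rw [Finset.sum_eq_single a] at h
  · rw [Matrix.neg_apply, Matrix.diagonal_apply_eq] at h
    push_cast at h
    linear_combination h
  · intro b _ hb
    rw [Matrix.neg_apply, Matrix.diagonal_apply_ne _ (Ne.symm hb)]; simp
  · simp

variable {T : Matrix (Fock n) (Fock n) ℂ →ₗ[ℂ] Matrix (Fock n) (Fock n) ℂ}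
  {A B : Matrix (Maj n) (Maj n) ℝ}

namespace IsGaussianChannelWith

lemma heisenberg_one (hT : IsGaussianChannelWith T A B) : heisenberg T 1 = 1 :=
  heisenberg_eq_iff.2 fun ρ => by rw [mul_one, mul_one, hT.1.2]

lemma isGaussianState_ampliation (hT : IsGaussianChannelWith T A B) :
    IsGaussianState (jointMajorana n n) (ampliation (Fock n) T (maxEnt n)) :=
  (hT.2.2 n _ isGaussianState_maxEnt).1

lemma covariance_ampliation (hT : IsGaussianChannelWith T A B) :
    covariance (jointMajorana n n) (ampliation (Fock n) T (maxEnt n)) =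
      (Matrix.fromBlocks 0 (Matrix.diagonal (transposeSign n) * Aᵀ)
        (-(A * Matrix.diagonal (transposeSign n))) B).map Complex.ofReal := by
  have h1 : padOne n A = (Matrix.fromBlocks 1 0 0 A).map Complex.ofReal := by
    rw [padOne, Matrix.fromBlocks_map]
    simp
  have h2 : padZero n B = (Matrix.fromBlocks 0 0 0 B).map Complex.ofReal := by
    rw [padZero, Matrix.fromBlocks_map]
    simp
  have h3 : ∀ X Y : Matrix (Maj n ⊕ Maj n) (Maj n ⊕ Maj n) ℝ,
      X.map Complex.ofReal * Y.map Complex.ofReal = (X * Y).map Complex.ofReal :=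
    fun X Y => (Matrix.map_mul (f := Complex.ofRealHom)).symm
  have h4 : ∀ X Y : Matrix (Maj n ⊕ Maj n) (Maj n ⊕ Maj n) ℝ,
      X.map Complex.ofReal + Y.map Complex.ofReal = (X + Y).map Complex.ofReal :=
    fun X Y => (Matrix.map_add _ Complex.ofReal_add _ _).symm
  rw [(hT.2.2 n _ isGaussianState_maxEnt).2, covariance_maxEnt, h1, h2, ← Matrix.transpose_map, h3, h3,
    h4, maxEntCov, Matrix.fromBlocks_transpose, Matrix.fromBlocks_multiply,
    Matrix.fromBlocks_multiply, Matrix.fromBlocks_add]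
  simp only [mul_neg, mul_zero, zero_mul, one_mul, mul_one, add_zero, zero_add, neg_zero,
    Matrix.transpose_one, Matrix.transpose_zero]

/-- The two-point function is δ - iγ; its δ part is the contraction by c k itself, and removing it
leaves the exterior product. -/
lemma wick_ampliation (hT : IsGaussianChannelWith T A B) (k : Maj n ⊕ Maj n)
    (X : Matrix (Fock n × Fock n) (Fock n × Fock n) ℂ) :
    (ampliation (Fock n) T (maxEnt n) *
      wedge (parity n ⊗ₖ parity n) (jointMajorana n n k) X).trace =
    -(Complex.I * ∑ m, covariance (jointMajorana n n) (ampliation (Fock n) T (maxEnt n)) k m *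
      (ampliation (Fock n) T (maxEnt n) *
        contract (parity n ⊗ₖ parity n) (jointMajorana n n m) X).trace) := by
  have hc := isCliffordSystem_jointMajorana n n
  have hσ := hT.isGaussianState_ampliation
  have h := (hc.wick_iff.1 hσ).2 k X
  simp_rw [hc.trace_mul_mul hσ.1.2] at h
  simp_rw [sub_mul, Finset.sum_sub_distrib] at h
  rw [← wedge_add_contract (parity n ⊗ₖ parity n) (jointMajorana n n _), mul_add, Matrix.trace_add] at h
  simp only [ite_mul, one_mul, zero_mul, Finset.sum_ite_eq, Finset.mem_univ, if_true] at h
  simp_rw [mul_assoc Complex.I] at h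
  rw [← Finset.mul_sum] at h
  linear_combination h

/-- Both the Choi state and `maxEnt` are Gaussian, hence even; as `maxEnt` separates operators, the
dual map commutes with parity. -/
lemma heisenberg_parity_conj (hT : IsGaussianChannelWith T A B) (y : Matrix (Fock n) (Fock n) ℂ) :
    heisenberg T (parity n * y * parity n) = parity n * heisenberg T y * parity n := by
  refine eq_of_trace_maxEnt fun x => ?_
  have hc := isCliffordSystem_jointMajorana n n
  have h1 := (isCliffordSystem_majorana n).parity_conj_parity_conj (parity n * x)
  rw [← trace_ampliation, ← h1, ← parity_conj_kronecker, ← parity_conj_kronecker,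
    hc.trace_parity_conj hT.isGaussianState_ampliation, hc.trace_parity_conj isGaussianState_maxEnt,
    trace_ampliation]

lemma trace_wedge_inl (hT : IsGaussianChannelWith T A B) (a : Maj n)
    (x y : Matrix (Fock n) (Fock n) ℂ) :
    (ampliation (Fock n) T (maxEnt n) *
      wedge (parity n ⊗ₖ parity n) (jointMajorana n n (Sum.inl a)) (x ⊗ₖ y)).trace =
    (maxEnt n * wedge (parity n ⊗ₖ parity n) (jointMajorana n n (Sum.inl a))
      (x ⊗ₖ heisenberg T y)).trace := by
  simp only [wedge_apply, jointMajorana, Sum.elim_inl,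
    ← Matrix.mul_kronecker_mul, mul_smul_comm, Matrix.trace_smul, mul_add, Matrix.trace_add,
    trace_ampliation, one_mul, mul_one, hT.heisenberg_parity_conj]

lemma trace_contract_inl (hT : IsGaussianChannelWith T A B) (a : Maj n)
    (x y : Matrix (Fock n) (Fock n) ℂ) :
    (ampliation (Fock n) T (maxEnt n) *
      contract (parity n ⊗ₖ parity n) (jointMajorana n n (Sum.inl a)) (x ⊗ₖ y)).trace =
    (maxEnt n * contract (parity n ⊗ₖ parity n) (jointMajorana n n (Sum.inl a))
      (x ⊗ₖ heisenberg T y)).trace := by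
  simp only [contract_apply, jointMajorana, Sum.elim_inl,
    ← Matrix.mul_kronecker_mul, mul_smul_comm, Matrix.trace_smul, mul_sub, Matrix.trace_sub,
    trace_ampliation, one_mul, mul_one, hT.heisenberg_parity_conj]

lemma kronecker_sum {ι r h : Type*} (s : Finset ι) (x : Matrix r r ℂ)
    (f : ι → Matrix h h ℂ) : x ⊗ₖ (∑ i ∈ s, f i) = ∑ i ∈ s, x ⊗ₖ f i := by
  ext
  simp [Matrix.sum_apply, Finset.mul_sum]

/-- Contractions are transported by a Gaussian channel. -/
lemma contract_heisenberg (hT : IsGaussianChannelWith T A B) (a : Maj n)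
    (y : Matrix (Fock n) (Fock n) ℂ) :
    contract (parity n) (majorana n a) (heisenberg T y) =
      ∑ k, (A k a : ℂ) • heisenberg T (contract (parity n) (majorana n k) y) := by
  refine eq_of_trace_maxEnt fun x => ?_
  -- In a reference row the covariance of the Choi state has only the entries of the block
  -- containing Aᵀ. The left side, evaluated in `maxEnt`, is a contraction of T*(y).
  have h1 := hT.wick_ampliation (Sum.inl a) (x ⊗ₖ y)
  rw [hT.trace_wedge_inl, trace_maxEnt_wedge_inl, hT.covariance_ampliation,
    Fintype.sum_sum_type] at h1
  simp only [Matrix.map_apply, Matrix.fromBlocks_apply₁₁, Matrix.fromBlocks_apply₁₂,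
    Matrix.zero_apply, Complex.ofReal_zero, zero_mul, Finset.sum_const_zero, zero_add,
    contract_inr_kronecker, trace_ampliation, Matrix.diagonal_mul, Matrix.transpose_apply,
    Complex.ofReal_mul] at h1
  have h2 := mul_left_cancel₀ Complex.I_ne_zero (neg_injective h1)
  simp_rw [mul_assoc] at h2
  rw [← Finset.mul_sum] at h2
  have h0 : (transposeSign n a : ℂ) ≠ 0 := by
    intro h
    have := transposeSign_mul_self a
    rw [Complex.ofReal_eq_zero.1 h] at this
    simp at this
  rw [mul_left_cancel₀ h0 h2, kronecker_sum, Finset.mul_sum, Matrix.trace_sum]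
  refine Finset.sum_congr rfl fun k _ => ?_
  rw [Matrix.kronecker_smul, mul_smul_comm, Matrix.trace_smul, smul_eq_mul]

/-- The Wick expansion of the dual of a Gaussian channel. -/
lemma heisenberg_wedge (hT : IsGaussianChannelWith T A B) (k : Maj n)
    (y : Matrix (Fock n) (Fock n) ℂ) :
    heisenberg T (wedge (parity n) (majorana n k) y) =
      ∑ a, (A k a : ℂ) • wedge (parity n) (majorana n a) (heisenberg T y) -
        Complex.I • ∑ m, (B k m : ℂ) • heisenberg T (contract (parity n) (majorana n m) y) := by
  refine eq_of_trace_maxEnt fun x => ?_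
  -- In an output row the A block produces reference contractions, which `maxEnt` turns into
  -- exterior products of T*(y), and the B block produces contractions of y.
  have h1 := hT.wick_ampliation (Sum.inr k) (x ⊗ₖ y)
  rw [hT.covariance_ampliation, wedge_inr_kronecker, Fintype.sum_sum_type] at h1
  simp only [Matrix.map_apply, Matrix.fromBlocks_apply₂₁, Matrix.fromBlocks_apply₂₂,
    hT.trace_contract_inl, contract_inr_kronecker, trace_ampliation, Matrix.neg_apply,
    Matrix.mul_diagonal, Complex.ofReal_mul, Complex.ofReal_neg] at h1
  rw [h1, sub_eq_add_neg, Matrix.kronecker_add, ← neg_smul,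
    Matrix.kronecker_smul, kronecker_sum, kronecker_sum, mul_add (maxEnt n), Matrix.trace_add,
    mul_smul_comm, Matrix.trace_smul,
    Finset.mul_sum, Finset.mul_sum, Matrix.trace_sum, Matrix.trace_sum, mul_add Complex.I, neg_add,
    smul_eq_mul, neg_mul]
  congr 1
  · rw [Finset.mul_sum, ← Finset.sum_neg_distrib]
    refine Finset.sum_congr rfl fun a _ => ?_
    rw [Matrix.kronecker_smul, mul_smul_comm, Matrix.trace_smul, trace_maxEnt_wedge_inr,
      smul_eq_mul]
    ring
  · congr 2
    refine Finset.sum_congr rfl fun a _ => ?_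
    rw [Matrix.kronecker_smul, mul_smul_comm, Matrix.trace_smul, smul_eq_mul]

end IsGaussianChannelWith

end GaussianChannel

/-! ### Linear combinations of Majorana operators -/

section Cliff

variable {n : ℕ}

/-- The linear combination of the Majorana operators with coefficients `v`. -/
noncomputable def cliff (n : ℕ) : (Maj n → ℂ) →ₗ[ℂ] Matrix (Fock n) (Fock n) ℂ :=
  Fintype.linearCombination ℂ (majorana n)

lemma cliff_apply (v : Maj n → ℂ) : cliff n v = ∑ k, v k • majorana n k := rfl

lemma cliff_mulVec (M : Matrix (Maj n) (Maj n) ℂ) (v : Maj n → ℂ) :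
    cliff n (M *ᵥ v) = ∑ a, v a • ∑ k, M k a • majorana n k := by
  rw [cliff_apply]
  simp_rw [Matrix.mulVec, dotProduct, Finset.sum_smul, Finset.smul_sum, smul_smul]
  rw [Finset.sum_comm]
  refine Finset.sum_congr rfl fun a _ => Finset.sum_congr rfl fun k _ => by rw [mul_comm]

lemma cliff_conjTranspose (v : Maj n → ℂ) : (cliff n v)ᴴ = cliff n (star v) := by
  rw [cliff_apply, cliff_apply, Matrix.conjTranspose_sum]
  refine Finset.sum_congr rfl fun k _ => ?_
  rw [Matrix.conjTranspose_smul, majorana_conjTranspose, Pi.star_apply]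

lemma parity_mul_cliff (v : Maj n → ℂ) : parity n * cliff n v = -(cliff n v * parity n) := by
  rw [cliff_apply, Finset.mul_sum, Finset.sum_mul, ← Finset.sum_neg_distrib]
  refine Finset.sum_congr rfl fun k _ => ?_
  rw [mul_smul_comm, smul_mul_assoc, parity_mul_majorana, smul_neg]

lemma parity_conj_cliff (v : Maj n → ℂ) : parity n * cliff n v * parity n = -cliff n v := by
  rw [parity_mul_cliff, neg_mul, mul_assoc, parity_mul_self, mul_one]

lemma contract_cliff_cliff (v w : Maj n → ℂ) :
    contract (parity n) (cliff n v) (cliff n w) = (v ⬝ᵥ w) • 1 := by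
  rw [cliff_apply, cliff_apply, dotProduct]
  simp only [map_sum, map_smul, LinearMap.sum_apply, LinearMap.smul_apply,
    (isCliffordSystem_majorana n).contract_self, smul_smul]
  simp [Finset.sum_smul, smul_smul, mul_comm]

lemma cliff_mul_add (v w : Maj n → ℂ) :
    cliff n v * cliff n w + cliff n w * cliff n v = (2 * (v ⬝ᵥ w)) • 1 := by
  have h := contract_cliff_cliff v w
  rw [contract_apply, parity_conj_cliff, neg_mul, sub_neg_eq_add] at h
  rw [mul_smul, ← h, smul_smul]
  norm_num

/-- The noise matrix `1 - A Aᵀ + i B` of the channel `γ ↦ A γ Aᵀ + B`. -/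
noncomputable def noise (A B : Matrix (Maj n) (Maj n) ℝ) : Matrix (Maj n) (Maj n) ℂ :=
  1 - (A * Aᵀ).map Complex.ofReal + Complex.I • B.map Complex.ofReal

end Cliff

/-! ### The dual channel on linear combinations of Majorana operators -/

namespace IsGaussianChannelWith

variable {n : ℕ} {T : Matrix (Fock n) (Fock n) ℂ →ₗ[ℂ] Matrix (Fock n) (Fock n) ℂ}
  {A B : Matrix (Maj n) (Maj n) ℝ}

lemma contract_cliff_heisenberg (hT : IsGaussianChannelWith T A B) (v : Maj n → ℂ)
    (y : Matrix (Fock n) (Fock n) ℂ) :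
    contract (parity n) (cliff n v) (heisenberg T y) =
      heisenberg T (contract (parity n) (cliff n (A.map Complex.ofReal *ᵥ v)) y) := by
  rw [cliff_mulVec, cliff_apply]
  simp only [map_sum, map_smul, LinearMap.sum_apply, LinearMap.smul_apply, hT.contract_heisenberg,
    Matrix.map_apply]

lemma heisenberg_wedge_cliff (hT : IsGaussianChannelWith T A B) (v : Maj n → ℂ)
    (y : Matrix (Fock n) (Fock n) ℂ) :
    heisenberg T (wedge (parity n) (cliff n v) y) =
      wedge (parity n) (cliff n ((A.map Complex.ofReal)ᵀ *ᵥ v)) (heisenberg T y) -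
        Complex.I • heisenberg T
          (contract (parity n) (cliff n ((B.map Complex.ofReal)ᵀ *ᵥ v)) y) := by
  rw [cliff_mulVec, cliff_mulVec, cliff_apply]
  simp only [map_sum, map_smul, LinearMap.sum_apply, LinearMap.smul_apply, hT.heisenberg_wedge,
    Matrix.map_apply, Matrix.transpose_apply, smul_sub, Finset.sum_sub_distrib, Finset.smul_sum]
  congr 1
  refine Finset.sum_congr rfl fun a _ => Finset.sum_congr rfl fun k _ => ?_
  rw [smul_comm]

lemma heisenberg_cliff (hT : IsGaussianChannelWith T A B) (v : Maj n → ℂ) :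
    heisenberg T (cliff n v) = cliff n ((A.map Complex.ofReal)ᵀ *ᵥ v) := by
  have h := hT.heisenberg_wedge_cliff v 1
  have hc := isCliffordSystem_majorana n
  have hw : ∀ a, wedge (parity n) a 1 = a := by
    intro a
    have := wedge_add_contract (parity n) a 1
    rwa [hc.contract_one, add_zero, mul_one] at this
  rw [hT.heisenberg_one, hw, hw, hc.contract_one, map_zero, smul_zero, sub_zero] at h
  exact h

/-- T* is multiplicative on linear operators up to a scalar: v·w comes from the contraction before
T*, Aᵀv·Aᵀw is absorbed by the product after it, and -i v·Bw comes from the B term of the Wick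
expansion. -/
lemma heisenberg_cliff_mul_cliff (hT : IsGaussianChannelWith T A B) (v w : Maj n → ℂ) :
    heisenberg T (cliff n v * cliff n w) =
      cliff n ((A.map Complex.ofReal)ᵀ *ᵥ v) * cliff n ((A.map Complex.ofReal)ᵀ *ᵥ w) +
        (v ⬝ᵥ (noise A (-B) *ᵥ w)) • 1 := by
  have h1 : (A * Aᵀ).map Complex.ofReal = A.map Complex.ofReal * (A.map Complex.ofReal)ᵀ :=
    (Matrix.map_mul (f := Complex.ofRealHom))
  have h2 : (-B).map Complex.ofReal = -B.map Complex.ofReal := by ext; simp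
  rw [← wedge_add_contract (parity n) (cliff n v), map_add, hT.heisenberg_wedge_cliff,
    contract_cliff_cliff, contract_cliff_cliff, map_smul, map_smul, hT.heisenberg_one,
    hT.heisenberg_cliff,
    ← wedge_add_contract (parity n) (cliff n ((A.map Complex.ofReal)ᵀ *ᵥ v)), contract_cliff_cliff,
    smul_smul, sub_eq_add_neg, ← neg_smul, add_assoc, add_assoc, ← add_smul, ← add_smul]
  congr 2
  rw [noise, h1, h2, smul_neg, Matrix.add_mulVec, Matrix.sub_mulVec, Matrix.one_mulVec,
    Matrix.neg_mulVec, Matrix.smul_mulVec, dotProduct_add, dotProduct_sub, dotProduct_neg,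
    dotProduct_smul, ← Matrix.mulVec_mulVec, Matrix.dotProduct_mulVec v (A.map Complex.ofReal),
    Matrix.dotProduct_mulVec v (B.map Complex.ofReal), Matrix.mulVec_transpose,
    Matrix.mulVec_transpose, smul_eq_mul]
  ring

/-- The intertwining relation of a Gaussian channel with linear combinations of Majorana
operators. -/
lemma heisenberg_intertwine (hT : IsGaussianChannelWith T A B) {x y d : Maj n → ℂ}
    (hd : (2 : ℂ) • (x + A.map Complex.ofReal *ᵥ y) = noise A B *ᵥ d)
    (X : Matrix (Fock n) (Fock n) ℂ) :
    heisenberg T (parity n * X * parity n * cliff n x) +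
        parity n * heisenberg T X * parity n * cliff n y =
      heisenberg T (cliff n (x - d) * X) +
        cliff n (y + (A.map Complex.ofReal)ᵀ *ᵥ d) * heisenberg T X := by
  have h1 : (A * Aᵀ).map Complex.ofReal = A.map Complex.ofReal * (A.map Complex.ofReal)ᵀ :=
    (Matrix.map_mul (f := Complex.ofRealHom))
  have h2 : (B.map Complex.ofReal)ᵀ = -B.map Complex.ofReal := by
    rw [← Matrix.transpose_map, hT.2.1]; ext; simp
  rw [noise, h1, Matrix.add_mulVec, Matrix.sub_mulVec, Matrix.one_mulVec, Matrix.smul_mulVec,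
    ← Matrix.mulVec_mulVec] at hd
  rw [← wedge_sub_contract, ← wedge_sub_contract, ← wedge_add_contract (parity n),
    ← wedge_add_contract (parity n), map_sub, map_add, hT.heisenberg_wedge_cliff,
    hT.heisenberg_wedge_cliff, hT.contract_cliff_heisenberg, hT.contract_cliff_heisenberg, h2]
  set a := A.map Complex.ofReal
  set b := B.map Complex.ofReal
  -- After expansion the exterior products cancel. The contractions combine to T* of the contraction
  -- by 2(x + Ay) - Nd, which `hd` makes zero; it is used by eliminating x.
  have e0 : x = (1 / 2 : ℂ) • (d - a *ᵥ aᵀ *ᵥ d + Complex.I • b *ᵥ d) - a *ᵥ y := by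
    rw [← hd, smul_smul]; norm_num
  simp only [Matrix.mulVec_add, Matrix.mulVec_sub, Matrix.neg_mulVec, map_add, map_sub, map_neg,
    LinearMap.add_apply, LinearMap.sub_apply, LinearMap.neg_apply, smul_sub, smul_neg]
  have e1 : heisenberg T (contract (parity n) (cliff n x) X) =
      (1 / 2 : ℂ) • (heisenberg T (contract (parity n) (cliff n d) X) -
        heisenberg T (contract (parity n) (cliff n (a *ᵥ aᵀ *ᵥ d)) X) +
        Complex.I • heisenberg T (contract (parity n) (cliff n (b *ᵥ d)) X)) -
        heisenberg T (contract (parity n) (cliff n (a *ᵥ y)) X) := by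
    conv_lhs => rw [e0]
    simp only [map_add, map_sub, map_smul, LinearMap.add_apply, LinearMap.sub_apply,
      LinearMap.smul_apply]
  rw [e1]
  module

end IsGaussianChannelWith

/-! ### Dilations -/

section RangeFactor

variable {α β κ p : Type*} [Fintype α] [Fintype β] [Fintype κ] [Fintype p]

/-- ψψ† and ψ have the same rank, so the evident inclusion of column spaces is an equality. -/
lemma exists_mulVec_mul_conjTranspose (ψ : Matrix p κ ℂ) (w : κ → ℂ) :
    ∃ a : p → ℂ, (ψ * ψᴴ) *ᵥ a = ψ *ᵥ w := by
  have hle : LinearMap.range (ψ * ψᴴ).mulVecLin ≤ LinearMap.range ψ.mulVecLin := by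
    rintro _ ⟨a, rfl⟩
    exact ⟨ψᴴ *ᵥ a, by simp [Matrix.mulVec_mulVec]⟩
  have heq := Submodule.eq_of_le_of_finrank_eq hle (Matrix.rank_self_mul_conjTranspose ψ)
  have : ψ *ᵥ w ∈ LinearMap.range (ψ * ψᴴ).mulVecLin := by
    rw [heq]; exact ⟨w, rfl⟩
  exact this

lemma exists_mul_eq_of_mul_conjTranspose [DecidableEq κ] {ψ : Matrix p κ ℂ} {Z : Matrix p p ℂ}
    {Z' : Matrix κ p ℂ} (h : Z * ψ * ψᴴ = ψ * Z') : ∃ Y : Matrix κ κ ℂ, Z * ψ = ψ * Y := by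
  have h1 : ∀ e : κ, ∃ v : κ → ℂ, (Z * ψ).col e = ψ *ᵥ v := by
    intro e
    obtain ⟨a, ha⟩ := exists_mulVec_mul_conjTranspose ψ (Pi.single e 1)
    refine ⟨Z' *ᵥ a, ?_⟩
    rw [Matrix.mulVec_mulVec, ← h, Matrix.mul_assoc, ← Matrix.mulVec_mulVec, ha,
      Matrix.mulVec_mulVec, Matrix.mulVec_single_one]
  choose y hy using h1
  refine ⟨Matrix.of fun i e => y e i, ?_⟩
  ext i e
  exact congrFun (hy e) i

/-- Reshape V into ψ, with the environment as column index. Then an environment operator on V is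
right multiplication on ψ, while G corresponds to Zψ. Testing `hF` on matrix units gives Zψψ† = ψZ',
so Z preserves the column space of ψ and Zψ = ψY. -/
lemma exists_one_kronecker_mul_eq [DecidableEq β] [DecidableEq κ] {V G : Matrix (β × κ) α ℂ} {F : Matrix α (β × κ) ℂ}
    {Z : Matrix (β × α) (β × α) ℂ}
    (hG : (Matrix.of fun (x : β × α) e => G (x.1, e) x.2) =
      Z * Matrix.of fun (x : β × α) e => V (x.1, e) x.2)
    (hF : ∀ X : Matrix β β ℂ, Vᴴ * (X ⊗ₖ (1 : Matrix κ κ ℂ)) * G = F * (X ⊗ₖ (1 : Matrix κ κ ℂ)) * V) :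
    ∃ Y : Matrix κ κ ℂ, ((1 : Matrix β β ℂ) ⊗ₖ Y) * V = G := by
  have entry : ∀ (L : Matrix α (β × κ) ℂ) (R : Matrix (β × κ) α ℂ) (b b' : β) (i i' : α),
      (L * (Matrix.single b' b (1 : ℂ) ⊗ₖ (1 : Matrix κ κ ℂ)) * R) i' i =
        ∑ e, L i' (b', e) * R (b, e) i := by
    intro L R b b' i i'
    have hR : ∀ u v, ((Matrix.single b' b (1 : ℂ) ⊗ₖ (1 : Matrix κ κ ℂ)) * R) (u, v) i =
        if b' = u then R (b, v) i else 0 := by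
      intro u v
      rw [Matrix.mul_apply, Finset.sum_eq_single (b, v)]
      · simp [Matrix.kroneckerMap_apply, Matrix.single_apply]
      · rintro ⟨u', v'⟩ _ huv
        by_cases h1 : v = v'
        · subst h1
          have : b ≠ u' := by rintro rfl; exact huv rfl
          simp [Matrix.kroneckerMap_apply, this]
        · simp [Matrix.kroneckerMap_apply, h1]
      · simp
    rw [Matrix.mul_assoc, Matrix.mul_apply, Fintype.sum_prod_type, Finset.sum_eq_single b']
    · simp [hR]
    · intro u _ hu
      simp [hR, Ne.symm hu]
    · simp
  have key : Z * (Matrix.of fun (x : β × α) e => V (x.1, e) x.2) *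
      (Matrix.of fun (x : β × α) e => V (x.1, e) x.2)ᴴ =
      (Matrix.of fun (x : β × α) e => V (x.1, e) x.2) *
        Matrix.of fun e (x : β × α) => F x.2 (x.1, e) := by
    rw [← hG]
    ext ⟨b, i⟩ ⟨b', i'⟩
    have := congrFun (congrFun (hF (Matrix.single b' b 1)) i') i
    rw [entry, entry] at this
    rw [Matrix.mul_apply, Matrix.mul_apply]
    calc _ = ∑ e, Vᴴ i' (b', e) * G (b, e) i := Finset.sum_congr rfl fun e _ => by
          simp [Matrix.conjTranspose_apply, mul_comm]
      _ = _ := this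
      _ = _ := Finset.sum_congr rfl fun e _ => by simp [mul_comm]
  obtain ⟨Y, hY⟩ := exists_mul_eq_of_mul_conjTranspose key
  refine ⟨Yᵀ, ?_⟩
  ext ⟨b, e⟩ i
  have h1 := congrFun (congrFun (hG.trans hY) (b, i)) e
  rw [Matrix.mul_apply] at h1
  simp only [Matrix.of_apply] at h1
  rw [h1, Matrix.mul_apply, Fintype.sum_prod_type, Finset.sum_eq_single b]
  · exact Finset.sum_congr rfl fun e' _ => by simp [Matrix.kroneckerMap_apply, mul_comm]
  · intro u _ hu
    simp [Matrix.kroneckerMap_apply, Ne.symm hu]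
  · simp

end RangeFactor

/-- `V` is a parity-definite isometric dilation of `T`, and `Tc` is the resulting (fermionic)
complementary channel. -/
structure IsDilation {n k : ℕ} (T : Matrix (Fock n) (Fock n) ℂ →ₗ[ℂ] Matrix (Fock n) (Fock n) ℂ)
    (Tc : Matrix (Fock n) (Fock n) ℂ →ₗ[ℂ] Matrix (Fock k) (Fock k) ℂ)
    (V : Matrix (Fock n × Fock k) (Fock n) ℂ) : Prop where
  isometry : Vᴴ * V = 1
  parity_comm : ∃ η : ℂ, η * η = 1 ∧ (parity n ⊗ₖ parity k) * V = η • (V * parity n)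
  system : ∀ Y, heisenberg T Y = Vᴴ * (Y ⊗ₖ (1 : Matrix (Fock k) (Fock k) ℂ)) * V
  even : ∀ Y, parity k * Y * parity k = Y →
    heisenberg Tc Y = Vᴴ * ((1 : Matrix (Fock n) (Fock n) ℂ) ⊗ₖ Y) * V
  odd : ∀ Y, parity k * Y * parity k = -Y →
    heisenberg Tc Y = Vᴴ * (parity n ⊗ₖ Y) * V

/-! ### From the unitary coupling to an isometric dilation -/

section Dilation

variable {n k : ℕ}

/-- Commuting with the rank-one projector forces the parity to fix the line of φ. -/
lemma isPureState_eigenvector {ρE : Matrix (Fock k) (Fock k) ℂ} (h : IsPureState ρE) :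
    ∃ (φ : Fock k → ℂ) (η : ℂ), ρE = Matrix.vecMulVec φ (star φ) ∧ star φ ⬝ᵥ φ = 1 ∧
      parity k *ᵥ φ = η • φ ∧ η * η = 1 := by
  obtain ⟨⟨_, htr⟩, ⟨φ, rfl⟩, hcomm⟩ := h
  have h1 : star φ ⬝ᵥ φ = 1 := by
    rw [Matrix.trace_vecMulVec] at htr
    rw [dotProduct_comm]; exact htr
  have h2 : parity k *ᵥ φ = (star φ ⬝ᵥ (parity k *ᵥ φ)) • φ := by
    have := congrArg (fun M => M *ᵥ φ) hcomm.eq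
    simp only [Matrix.vecMulVec_mul, Matrix.mul_vecMulVec, Matrix.vecMulVec_mulVec] at this
    rw [h1, ← Matrix.dotProduct_mulVec] at this
    simpa using this.symm
  refine ⟨φ, _, rfl, h1, h2, ?_⟩
  set η := star φ ⬝ᵥ (parity k *ᵥ φ)
  have h3 : parity k *ᵥ (parity k *ᵥ φ) = (η * η) • φ := by
    rw [h2, Matrix.mulVec_smul, h2, smul_smul]
  rw [Matrix.mulVec_mulVec, parity_mul_self, Matrix.one_mulVec] at h3
  have h4 := congrArg (fun v => star φ ⬝ᵥ v) h3
  simp only [dotProduct_smul, h1, smul_eq_mul, mul_one] at h4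
  exact h4.symm

lemma prod_inl (l : List (Maj n)) :
    (l.map fun i => jointMajorana n k (Sum.inl i)).prod =
      (l.map (majorana n)).prod ⊗ₖ (1 : Matrix (Fock k) (Fock k) ℂ) := by
  induction l with
  | nil => simp
  | cons a t ih =>
    rw [List.map_cons, List.prod_cons, ih, List.map_cons, List.prod_cons, jointMajorana,
      Sum.elim_inl, ← Matrix.mul_kronecker_mul, mul_one]

/-- The embedding of the operators of the second factor, with Jordan-Wigner strings on the odd
ones. -/
noncomputable def embedSnd (n : ℕ) {k : ℕ} (Y : Matrix (Fock k) (Fock k) ℂ) :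
    Matrix (Fock n × Fock k) (Fock n × Fock k) ℂ :=
  (1 : Matrix (Fock n) (Fock n) ℂ) ⊗ₖ ((1 / 2 : ℂ) • (Y + parity k * Y * parity k)) +
    parity n ⊗ₖ ((1 / 2 : ℂ) • (Y - parity k * Y * parity k))

/-- A Majorana factor exchanges the even and odd parts, and its string P exchanges the prefactors 1
and P because P² = 1. -/
lemma inr_mul_embedSnd (a : Maj k) (Y : Matrix (Fock k) (Fock k) ℂ) :
    jointMajorana n k (Sum.inr a) * embedSnd n Y = embedSnd n (majorana k a * Y) := by
  rw [embedSnd, embedSnd, (isCliffordSystem_majorana k).parity_conj_mul, jointMajorana,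
    Sum.elim_inr, (isCliffordSystem_majorana k).parity_conj, mul_add, ← Matrix.mul_kronecker_mul,
    ← Matrix.mul_kronecker_mul, mul_one, parity_mul_self, mul_smul_comm, mul_smul_comm, mul_add,
    mul_sub, neg_mul, sub_neg_eq_add, ← sub_eq_add_neg, add_comm]

lemma prod_inr (l : List (Maj k)) :
    (l.map fun i => jointMajorana n k (Sum.inr i)).prod = embedSnd n (l.map (majorana k)).prod := by
  induction l with
  | nil =>
    rw [List.map_nil, List.map_nil, List.prod_nil, List.prod_nil, embedSnd, mul_one,
      parity_mul_self, sub_self, smul_zero, Matrix.kronecker_zero, add_zero, ← two_smul ℂ, smul_smul]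
    norm_num
  | cons a t ih =>
    rw [List.map_cons, List.prod_cons, ih, List.map_cons, List.prod_cons, inr_mul_embedSnd]

lemma embedSnd_add (Y Z : Matrix (Fock k) (Fock k) ℂ) :
    embedSnd n (Y + Z) = embedSnd n Y + embedSnd n Z := by
  simp only [embedSnd, mul_add, add_mul, smul_add, Matrix.kronecker_add, sub_eq_add_neg,
    neg_add]
  abel

lemma embedSnd_smul (z : ℂ) (Y : Matrix (Fock k) (Fock k) ℂ) :
    embedSnd n (z • Y) = z • embedSnd n Y := by
  simp only [embedSnd, mul_smul_comm, smul_mul_assoc, ← smul_add, ← smul_sub]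
  rw [smul_comm _ z, smul_comm _ z, Matrix.kronecker_smul, Matrix.kronecker_smul z,
    ← smul_add z]

lemma embedSnd_of_even {Y : Matrix (Fock k) (Fock k) ℂ} (h : parity k * Y * parity k = Y) :
    embedSnd n Y = (1 : Matrix (Fock n) (Fock n) ℂ) ⊗ₖ Y := by
  rw [embedSnd, h, sub_self, smul_zero, Matrix.kronecker_zero, add_zero, ← two_smul ℂ, smul_smul]
  norm_num

lemma embedSnd_of_odd {Y : Matrix (Fock k) (Fock k) ℂ} (h : parity k * Y * parity k = -Y) :
    embedSnd n Y = parity n ⊗ₖ Y := by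
  rw [embedSnd, h, sub_neg_eq_add, add_neg_cancel, smul_zero, Matrix.kronecker_zero, zero_add,
    ← two_smul ℂ, smul_smul]
  norm_num

lemma IsMarginalFst.trace_eq {X : Matrix (Fock n × Fock k) (Fock n × Fock k) ℂ}
    {σ : Matrix (Fock n) (Fock n) ℂ} (h : IsMarginalFst X σ) (Y : Matrix (Fock n) (Fock n) ℂ) :
    (σ * Y).trace = (X * (Y ⊗ₖ (1 : Matrix (Fock k) (Fock k) ℂ))).trace := by
  refine (isCliffordSystem_majorana n).induction (p := fun Y =>
    (σ * Y).trace = (X * (Y ⊗ₖ (1 : Matrix (Fock k) (Fock k) ℂ))).trace) ?_ ?_ ?_ Y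
  · intro l
    rw [h l, prod_inl]
  · intro Y Z hY hZ
    rw [mul_add, Matrix.trace_add, hY, hZ, Matrix.add_kronecker, mul_add, Matrix.trace_add]
  · intro z Y hY
    rw [mul_smul_comm, Matrix.trace_smul, hY, Matrix.smul_kronecker, mul_smul_comm,
      Matrix.trace_smul]

lemma IsMarginalSnd.trace_eq {X : Matrix (Fock n × Fock k) (Fock n × Fock k) ℂ}
    {σ : Matrix (Fock k) (Fock k) ℂ} (h : IsMarginalSnd X σ) (Y : Matrix (Fock k) (Fock k) ℂ) :
    (σ * Y).trace = (X * embedSnd n Y).trace := by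
  refine (isCliffordSystem_majorana k).induction (p := fun Y =>
    (σ * Y).trace = (X * embedSnd n Y).trace) ?_ ?_ ?_ Y
  · intro l
    rw [h l, prod_inr]
  · intro Y Z hY hZ
    rw [mul_add, Matrix.trace_add, hY, hZ, embedSnd_add, mul_add, Matrix.trace_add]
  · intro z Y hY
    rw [mul_smul_comm, Matrix.trace_smul, hY, embedSnd_smul, mul_smul_comm, Matrix.trace_smul]

/-- The isometry `ψ ↦ ψ ⊗ φ`. -/
noncomputable def attach (n : ℕ) {k : ℕ} (φ : Fock k → ℂ) : Matrix (Fock n × Fock k) (Fock n) ℂ :=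
  Matrix.of fun x j => if x.1 = j then φ x.2 else 0

lemma kronecker_mul_attach (X : Matrix (Fock n) (Fock n) ℂ) (Y : Matrix (Fock k) (Fock k) ℂ)
    (φ : Fock k → ℂ) : (X ⊗ₖ Y) * attach n φ = attach n (Y *ᵥ φ) * X := by
  ext ⟨b, e⟩ i
  rw [Matrix.mul_apply, Matrix.mul_apply, Fintype.sum_prod_type, Finset.sum_eq_single i,
    Finset.sum_eq_single b]
  · simp [attach, Matrix.mulVec, dotProduct, Matrix.kroneckerMap_apply, Finset.mul_sum,
      mul_comm, mul_left_comm]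
  · intro u _ hu; simp [attach, Ne.symm hu]
  · simp
  · intro u _ hu; simp [attach, hu]
  · simp

lemma attach_conjTranspose_mul_attach {φ : Fock k → ℂ} (h : star φ ⬝ᵥ φ = 1) :
    (attach n φ)ᴴ * attach n φ = 1 := by
  ext i j
  rw [Matrix.mul_apply, Fintype.sum_prod_type, Finset.sum_eq_single j]
  · by_cases hij : i = j
    · subst hij
      simpa [attach, dotProduct] using h
    · simp [attach, hij, Ne.symm hij]
  · intro u _ hu; simp [attach, hu]
  · simp

lemma attach_mul_mul_conjTranspose (φ : Fock k → ℂ) (ρ : Matrix (Fock n) (Fock n) ℂ) :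
    attach n φ * ρ * (attach n φ)ᴴ = ρ ⊗ₖ Matrix.vecMulVec φ (star φ) := by
  ext ⟨b, e⟩ ⟨b', e'⟩
  rw [Matrix.mul_apply, Finset.sum_eq_single b', Matrix.mul_apply, Finset.sum_eq_single b]
  · simp [attach, Matrix.kroneckerMap_apply, Matrix.vecMulVec_apply]; ring
  · intro u _ hu; simp [attach, Ne.symm hu]
  · simp
  · intro u _ hu; simp [attach, Ne.symm hu]
  · simp

lemma attach_smul (z : ℂ) (φ : Fock k → ℂ) : attach n (z • φ) = z • attach n φ := by
  ext; simp [attach]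

/-- The isometry is ψ ↦ U(ψ ⊗ φ), with φ the environment vector; the parity η of φ is the sign by
which it intertwines the parities. -/
lemma IsComplementary.exists_isDilation
    {T : Matrix (Fock n) (Fock n) ℂ →ₗ[ℂ] Matrix (Fock n) (Fock n) ℂ}
    {Tc : Matrix (Fock n) (Fock n) ℂ →ₗ[ℂ] Matrix (Fock k) (Fock k) ℂ}
    (h : IsComplementary T Tc) : ∃ V, IsDilation T Tc V := by
  obtain ⟨ρE, U, hρE, hU, hcomm, hmarg⟩ := h
  obtain ⟨φ, η, rfl, hφ, hPφ, hη⟩ := isPureState_eigenvector hρE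
  have hUU : Uᴴ * U = 1 := Matrix.mem_unitaryGroup_iff'.1 hU
  have htr : ∀ ρ M, (U * (ρ ⊗ₖ Matrix.vecMulVec φ (star φ)) * Uᴴ * M).trace =
      (ρ * ((U * attach n φ)ᴴ * M * (U * attach n φ))).trace := by
    intro ρ M
    rw [← attach_mul_mul_conjTranspose, Matrix.conjTranspose_mul]
    have e1 : U * (attach n φ * ρ * (attach n φ)ᴴ) * Uᴴ * M =
        (U * attach n φ) * (ρ * ((attach n φ)ᴴ * Uᴴ * M)) := by simp only [Matrix.mul_assoc]
    rw [e1, Matrix.trace_mul_comm]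
    simp only [Matrix.mul_assoc]
  have hc : ∀ Y, heisenberg Tc Y = (U * attach n φ)ᴴ * embedSnd n Y * (U * attach n φ) := by
    intro Y
    refine heisenberg_eq_iff.2 fun ρ => ?_
    rw [(hmarg ρ).2.trace_eq, htr]
  refine ⟨U * attach n φ, ?_, ⟨η, hη, ?_⟩, fun Y => ?_, fun Y hY => ?_, fun Y hY => ?_⟩
  · rw [Matrix.conjTranspose_mul, Matrix.mul_assoc, ← Matrix.mul_assoc Uᴴ, hUU, Matrix.one_mul,
      attach_conjTranspose_mul_attach hφ]
  · rw [← Matrix.mul_assoc, ← hcomm.eq, Matrix.mul_assoc, kronecker_mul_attach, hPφ, attach_smul,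
      Matrix.smul_mul, Matrix.mul_smul, Matrix.mul_assoc]
  · refine heisenberg_eq_iff.2 fun ρ => ?_
    rw [(hmarg ρ).1.trace_eq, htr]
  · rw [hc, embedSnd_of_even hY]
  · rw [hc, embedSnd_of_odd hY]

end Dilation

/-! ### Environment operators of a Gaussian channel -/

section Environment

variable {n k : ℕ} {T : Matrix (Fock n) (Fock n) ℂ →ₗ[ℂ] Matrix (Fock n) (Fock n) ℂ}
  {Tc : Matrix (Fock n) (Fock n) ℂ →ₗ[ℂ] Matrix (Fock k) (Fock k) ℂ}
  {V : Matrix (Fock n × Fock k) (Fock n) ℂ} {A B : Matrix (Maj n) (Maj n) ℝ}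

lemma kronecker_one_mul_apply {α β κ : Type*} [Fintype β] [Fintype κ] [DecidableEq κ]
    (M : Matrix β β ℂ) (V : Matrix (β × κ) α ℂ) (b : β) (e : κ) (i : α) :
    ((M ⊗ₖ (1 : Matrix κ κ ℂ)) * V) (b, e) i = ∑ b', M b b' * V (b', e) i := by
  rw [Matrix.mul_apply, Fintype.sum_prod_type]
  refine Finset.sum_congr rfl fun b' _ => ?_
  rw [Finset.sum_eq_single e]
  · simp [Matrix.kroneckerMap_apply]
  · intro e' _ he
    simp [Matrix.kroneckerMap_apply, Ne.symm he]
  · simp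

/-- Operators acting on the system output or on the input leave the environment index alone, so
after reshaping they are left multiplications. -/
lemma reshape_eq {α β κ : Type*} [Fintype α] [Fintype β] [Fintype κ] [DecidableEq α] [DecidableEq κ]
    (M P : Matrix β β ℂ) (C : Matrix α α ℂ) (V : Matrix (β × κ) α ℂ) :
    (Matrix.of fun (x : β × α) e =>
      ((M ⊗ₖ (1 : Matrix κ κ ℂ)) * V + (P ⊗ₖ (1 : Matrix κ κ ℂ)) * V * C) (x.1, e) x.2) =
    (M ⊗ₖ (1 : Matrix α α ℂ) + P ⊗ₖ Cᵀ) * Matrix.of fun (x : β × α) e => V (x.1, e) x.2 := by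
  ext ⟨b, i⟩ e
  rw [Matrix.of_apply, Matrix.add_apply, kronecker_one_mul_apply, Matrix.mul_apply, Matrix.add_mul,
    Matrix.add_apply, kronecker_one_mul_apply]
  congr 1
  rw [Matrix.mul_apply, Fintype.sum_prod_type]
  simp_rw [kronecker_one_mul_apply, Finset.sum_mul]
  rw [Finset.sum_comm]
  refine Finset.sum_congr rfl fun b' _ => Finset.sum_congr rfl fun i' _ => ?_
  simp [Matrix.kroneckerMap_apply]
  ring

/-- The intertwining relation of T*, written through V, is the hypothesis under which a combination
of system and input operators can be realised on the environment. -/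
lemma IsDilation.exists_odd (hV : IsDilation T Tc V) (hT : IsGaussianChannelWith T A B)
    {x y d : Maj n → ℂ} (hd : (2 : ℂ) • (x + A.map Complex.ofReal *ᵥ y) = noise A B *ᵥ d) :
    ∃ Y, parity k * Y * parity k = -Y ∧ (parity n ⊗ₖ Y) * V =
      (cliff n x ⊗ₖ (1 : Matrix (Fock k) (Fock k) ℂ)) * V + V * cliff n y := by
  have kmul : ∀ X Y : Matrix (Fock n) (Fock n) ℂ, (X * Y) ⊗ₖ (1 : Matrix (Fock k) (Fock k) ℂ) =
      (X ⊗ₖ (1 : Matrix (Fock k) (Fock k) ℂ)) * (Y ⊗ₖ (1 : Matrix (Fock k) (Fock k) ℂ)) := by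
    intro X Y
    rw [← Matrix.mul_kronecker_mul, mul_one]
  -- The intertwining relation is used at P X, and the combination is multiplied by P, so that the
  -- environment operator appears as 1 ⊗ Y without a string.
  have hF : ∀ X : Matrix (Fock n) (Fock n) ℂ,
      Vᴴ * (X ⊗ₖ (1 : Matrix (Fock k) (Fock k) ℂ)) *
        (((parity n * cliff n x) ⊗ₖ (1 : Matrix (Fock k) (Fock k) ℂ)) * V +
          (parity n ⊗ₖ (1 : Matrix (Fock k) (Fock k) ℂ)) * V * cliff n y) =
      ((Vᴴ * (cliff n (x - d) ⊗ₖ (1 : Matrix (Fock k) (Fock k) ℂ)) +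
        cliff n (y + (A.map Complex.ofReal)ᵀ *ᵥ d) * Vᴴ) *
          (parity n ⊗ₖ (1 : Matrix (Fock k) (Fock k) ℂ))) *
          (X ⊗ₖ (1 : Matrix (Fock k) (Fock k) ℂ)) * V := by
    intro X
    have h1 := hT.heisenberg_intertwine hd (parity n * X)
    have h2 : parity n * (parity n * X) * parity n = X * parity n := by
      rw [← mul_assoc, parity_mul_self, one_mul]
    rw [← hT.heisenberg_parity_conj, h2, hV.system, hV.system, hV.system, hV.system, kmul, kmul,
      kmul, kmul] at h1
    rw [kmul]
    simp only [Matrix.mul_add, Matrix.add_mul, Matrix.mul_assoc] at h1 ⊢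
    exact h1
  obtain ⟨Y, hY⟩ := exists_one_kronecker_mul_eq (reshape_eq _ _ _ V) hF
  set R := (cliff n x ⊗ₖ (1 : Matrix (Fock k) (Fock k) ℂ)) * V + V * cliff n y with hR
  have hPY : (parity n ⊗ₖ Y) * V = R := by
    have h1 : parity n ⊗ₖ Y = (parity n ⊗ₖ (1 : Matrix (Fock k) (Fock k) ℂ)) *
        ((1 : Matrix (Fock n) (Fock n) ℂ) ⊗ₖ Y) := by
      rw [← Matrix.mul_kronecker_mul, mul_one, one_mul]
    have h2 : (parity n ⊗ₖ (1 : Matrix (Fock k) (Fock k) ℂ)) *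
        (parity n ⊗ₖ (1 : Matrix (Fock k) (Fock k) ℂ)) = 1 := by
      rw [← kmul, parity_mul_self, Matrix.one_kronecker_one]
    rw [h1, Matrix.mul_assoc, hY, Matrix.mul_add, kmul, Matrix.mul_assoc (parity n ⊗ₖ 1),
      ← Matrix.mul_assoc _ _ (_ * V), h2, Matrix.one_mul, Matrix.mul_assoc (parity n ⊗ₖ 1) V,
      ← Matrix.mul_assoc _ _ (V * _), h2, Matrix.one_mul]
  obtain ⟨η, hη, hPV⟩ := hV.parity_comm
  -- V intertwines the parities up to η, whereas c(x) and c(y) are odd; η enters twice and squares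
  -- to 1.
  have hPYP : (parity n ⊗ₖ (parity k * Y * parity k)) * V = -R := by
    have h1 : parity n ⊗ₖ (parity k * Y * parity k) =
        (parity n ⊗ₖ parity k) * ((parity n ⊗ₖ Y) * (parity n ⊗ₖ parity k)) := by
      rw [← Matrix.mul_kronecker_mul, ← Matrix.mul_kronecker_mul, parity_mul_self, mul_one,
        mul_assoc]
    have h2 : (parity n ⊗ₖ parity k) * (cliff n x ⊗ₖ (1 : Matrix (Fock k) (Fock k) ℂ)) =
        -((cliff n x ⊗ₖ (1 : Matrix (Fock k) (Fock k) ℂ)) * (parity n ⊗ₖ parity k)) := by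
      rw [← Matrix.mul_kronecker_mul, ← Matrix.mul_kronecker_mul, mul_one, one_mul,
        parity_mul_cliff]
      ext; simp [Matrix.kroneckerMap_apply]
    have h3 : (parity n ⊗ₖ parity k) * R = -(η • (R * parity n)) := by
      rw [hR, Matrix.mul_add, ← Matrix.mul_assoc, ← Matrix.mul_assoc, h2, hPV, Matrix.neg_mul,
        Matrix.mul_assoc _ (parity n ⊗ₖ parity k), hPV, Matrix.mul_smul, Matrix.smul_mul,
        Matrix.mul_assoc V, parity_mul_cliff, Matrix.mul_neg, ← Matrix.mul_assoc V,
        ← Matrix.mul_assoc, Matrix.add_mul, smul_add, smul_neg, neg_add]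
    rw [h1, Matrix.mul_assoc, Matrix.mul_assoc, hPV, Matrix.mul_smul, ← Matrix.mul_assoc _ V, hPY,
      Matrix.mul_smul, ← Matrix.mul_assoc, h3, Matrix.neg_mul, Matrix.smul_mul, smul_neg, smul_smul,
      hη, one_smul, Matrix.mul_assoc, parity_mul_self, Matrix.mul_one]
  -- Y and -PYP act alike on the range of V, so the odd part of Y does the same.
  refine ⟨(1 / 2 : ℂ) • (Y - parity k * Y * parity k), ?_, ?_⟩
  · rw [mul_smul_comm, smul_mul_assoc, mul_sub, sub_mul,
      (isCliffordSystem_majorana k).parity_conj_parity_conj, ← smul_neg, neg_sub]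
  · have h1 : parity n ⊗ₖ ((1 / 2 : ℂ) • (Y - parity k * Y * parity k)) =
        (1 / 2 : ℂ) • (parity n ⊗ₖ Y - parity n ⊗ₖ (parity k * Y * parity k)) := by
      rw [Matrix.kronecker_smul]
      congr 1
      ext; simp [Matrix.kroneckerMap_apply, mul_sub]
    rw [h1, Matrix.smul_mul, Matrix.sub_mul, hPY, hPYP, sub_neg_eq_add, ← two_smul ℂ R, smul_smul]
    norm_num

lemma IsDilation.heisenberg_odd (hV : IsDilation T Tc V) {Y : Matrix (Fock k) (Fock k) ℂ}
    {R : Matrix (Fock n × Fock k) (Fock n) ℂ}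
    (hY : parity k * Y * parity k = -Y) (hR : (parity n ⊗ₖ Y) * V = R) :
    heisenberg Tc Y = Vᴴ * R := by
  rw [hV.odd Y hY, Matrix.mul_assoc, hR]

/-- A product of two odd environment operators is even and needs no string; the two strings P
cancel. -/
lemma IsDilation.heisenberg_conjTranspose_mul (hV : IsDilation T Tc V)
    {Y Y' : Matrix (Fock k) (Fock k) ℂ} {R R' : Matrix (Fock n × Fock k) (Fock n) ℂ}
    (hY : parity k * Y * parity k = -Y) (hR : (parity n ⊗ₖ Y) * V = R)
    (hY' : parity k * Y' * parity k = -Y') (hR' : (parity n ⊗ₖ Y') * V = R') :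
    heisenberg Tc (Yᴴ * Y') = Rᴴ * R' := by
  have h0 : parity k * Yᴴ * parity k = -Yᴴ := by
    have := congrArg Matrix.conjTranspose hY
    rwa [Matrix.conjTranspose_mul, Matrix.conjTranspose_mul, parity_conjTranspose, ← mul_assoc,
      Matrix.conjTranspose_neg] at this
  rw [hV.even]
  · have h1 : (1 : Matrix (Fock n) (Fock n) ℂ) ⊗ₖ (Yᴴ * Y') =
        (parity n ⊗ₖ Yᴴ) * (parity n ⊗ₖ Y') := by
      rw [← Matrix.mul_kronecker_mul, parity_mul_self]
    rw [← hR, ← hR', Matrix.conjTranspose_mul, Matrix.conjTranspose_kronecker, parity_conjTranspose,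
      h1]
    simp only [Matrix.mul_assoc]
  · rw [(isCliffordSystem_majorana k).parity_conj_mul, h0, hY', neg_mul_neg]

end Environment

/-! ### Kraus operators and the multiplicative domain -/

section Kraus

variable {h h' : Type*} [Fintype h] [DecidableEq h] [Fintype h'] [DecidableEq h']
  {W : Matrix h h ℂ →ₗ[ℂ] Matrix h' h' ℂ}

lemma IsChannel.heisenberg_one (hW : IsChannel W) : heisenberg W 1 = 1 :=
  heisenberg_eq_iff.2 fun ρ => by rw [mul_one, mul_one, hW.2]

open scoped MatrixOrder in
lemma posSemidef_exists_conjTranspose_mul_self {C : Matrix h h ℂ} (hC : C.PosSemidef) :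
    ∃ M : Matrix h h ℂ, C = Mᴴ * M :=
  CStarAlgebra.nonneg_iff_eq_star_mul_self.1 hC.nonneg

/-- Complete positivity is used once, on the unnormalised maximally entangled projector. The
resulting Choi matrix factors as M†M, and the conjugated rows of M are the Kraus operators. -/
lemma IsChannel.exists_kraus (hW : IsChannel W) :
    ∃ L : Fin (Fintype.card h) × h' → Matrix h' h ℂ,
      ∀ Y, heisenberg W Y = ∑ m, (L m)ᴴ * Y * L m := by
  set e := (Fintype.equivFin h).symm
  set v : Fin (Fintype.card h) × h → ℂ := fun x => if e x.1 = x.2 then 1 else 0 with hv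
  have h1 := hW.1 _ _ (Matrix.posSemidef_vecMulVec_self_star v)
  obtain ⟨M, hM⟩ := posSemidef_exists_conjTranspose_mul_self h1
  have h2 : ∀ i j p q, W (Matrix.single i j 1) p q =
      ∑ m, star (M m (e.symm i, p)) * M m (e.symm j, q) := by
    intro i j p q
    have h3 := congrFun (congrFun hM (e.symm i, p)) (e.symm j, q)
    rw [Matrix.mul_apply] at h3
    simp only [Matrix.conjTranspose_apply] at h3
    rw [← h3, ampliation, Matrix.of_apply]
    refine congrFun (congrFun (congrArg W ?_) p) q
    ext a b
    simp only [Matrix.of_apply, Matrix.vecMulVec_apply, hv, Equiv.apply_symm_apply, Pi.star_apply,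
      Matrix.single_apply]
    split_ifs <;> simp_all
  refine ⟨fun m => Matrix.of fun p j => star (M m (e.symm j, p)), fun Y => ?_⟩
  ext i j
  simp only [heisenberg, LinearMap.coe_mk, AddHom.coe_mk, Matrix.of_apply, Matrix.trace,
    Matrix.diag_apply, Matrix.mul_apply, h2, Matrix.sum_apply, Matrix.conjTranspose_apply,
    star_star, Finset.sum_mul]
  simp_rw [Finset.sum_comm (s := (Finset.univ : Finset h'))
    (t := (Finset.univ : Finset (Fin (Fintype.card h) × h')))]
  refine Finset.sum_congr rfl fun m _ => Finset.sum_congr rfl fun p _ =>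
    Finset.sum_congr rfl fun q _ => by ring

lemma IsChannel.heisenberg_conjTranspose (hW : IsChannel W) (Y : Matrix h' h' ℂ) :
    heisenberg W Yᴴ = (heisenberg W Y)ᴴ := by
  obtain ⟨L, hL⟩ := hW.exists_kraus
  rw [hL, hL, Matrix.conjTranspose_sum]
  refine Finset.sum_congr rfl fun m _ => ?_
  simp [Matrix.mul_assoc]

/-- The Kadison-Schwarz defect as an explicit sum of squares: complete the square in the Kraus form,
using unitality Σ L†L = 1. -/
lemma IsChannel.exists_heisenberg_sub (hW : IsChannel W) (Y : Matrix h' h' ℂ) :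
    ∃ L M : Fin (Fintype.card h) × h' → Matrix h' h ℂ,
      (∀ X, heisenberg W X = ∑ m, (L m)ᴴ * X * L m) ∧
      (∀ m, M m = Y * L m - L m * heisenberg W Y) ∧
      heisenberg W (Yᴴ * Y) - (heisenberg W Y)ᴴ * heisenberg W Y = ∑ m, (M m)ᴴ * M m := by
  obtain ⟨L, hL⟩ := hW.exists_kraus
  refine ⟨L, _, hL, fun m => rfl, ?_⟩
  set Z := heisenberg W Y with hZ
  have h1 : ∀ m, (Y * L m - L m * Z)ᴴ * (Y * L m - L m * Z) =
      (L m)ᴴ * (Yᴴ * Y) * L m - ((L m)ᴴ * Yᴴ * L m) * Z - Zᴴ * ((L m)ᴴ * Y * L m) +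
        Zᴴ * ((L m)ᴴ * (1 : Matrix h' h' ℂ) * L m) * Z := by
    intro m
    simp only [Matrix.conjTranspose_sub, Matrix.conjTranspose_mul, Matrix.sub_mul, Matrix.mul_sub,
      Matrix.mul_assoc, Matrix.one_mul]
    abel
  simp_rw [h1, Finset.sum_add_distrib, Finset.sum_sub_distrib, ← Finset.mul_sum, ← Finset.sum_mul,
    ← Finset.mul_sum, ← hL, hW.heisenberg_conjTranspose, hW.heisenberg_one, ← hZ]
  rw [Matrix.mul_one]
  abel

/-- Equality in Kadison-Schwarz makes every square vanish, so Y L = L W*(Y) for each Kraus operator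
L: Y is in the multiplicative domain. -/
lemma IsChannel.heisenberg_mul_of_eq (hW : IsChannel W) {Y : Matrix h' h' ℂ}
    (hY : heisenberg W (Yᴴ * Y) = (heisenberg W Y)ᴴ * heisenberg W Y) (X : Matrix h' h' ℂ) :
    heisenberg W (X * Y) = heisenberg W X * heisenberg W Y := by
  obtain ⟨L, M, hL, hM, h⟩ := hW.exists_heisenberg_sub Y
  rw [hY, sub_self] at h
  have h0 : ∀ m, M m = 0 := by
    have h1 := congrArg Matrix.trace h.symm
    rw [Matrix.trace_sum, Matrix.trace_zero] at h1
    intro m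
    have h2 := (Finset.sum_eq_zero_iff_of_nonneg
      (fun i _ => (Matrix.posSemidef_conjTranspose_mul_self (M i)).trace_nonneg)).1 h1 m
      (Finset.mem_univ m)
    exact Matrix.trace_conjTranspose_mul_self_eq_zero_iff.1 h2
  rw [hL, hL X, Finset.sum_mul]
  refine Finset.sum_congr rfl fun m _ => ?_
  have h3 := (hM m).symm.trans (h0 m)
  rw [Matrix.mul_assoc _ (X * Y), Matrix.mul_assoc X, sub_eq_zero.1 h3]
  simp only [Matrix.mul_assoc]

end Kraus

/-! ### Consequences of degradability for the matrices of a Gaussian channel -/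

section RealVectors

variable {n : ℕ}

/-- A real vector, regarded as a complex one. -/
def toComplex (v : Maj n → ℝ) : Maj n → ℂ := fun k => v k

lemma map_mulVec_toComplex (A : Matrix (Maj n) (Maj n) ℝ) (v : Maj n → ℝ) :
    A.map Complex.ofReal *ᵥ toComplex v = toComplex (A *ᵥ v) :=
  funext fun i => (RingHom.map_mulVec Complex.ofRealHom A v i).symm

lemma toComplex_dotProduct (v w : Maj n → ℝ) :
    toComplex v ⬝ᵥ toComplex w = ((v ⬝ᵥ w : ℝ) : ℂ) :=
  (RingHom.map_dotProduct Complex.ofRealHom v w).symm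

lemma star_toComplex (v : Maj n → ℝ) : star (toComplex v) = toComplex v :=
  funext fun _ => Complex.conj_ofReal _

lemma cliff_toComplex_conjTranspose (v : Maj n → ℝ) :
    (cliff n (toComplex v))ᴴ = cliff n (toComplex v) := by
  rw [cliff_conjTranspose, star_toComplex]

lemma cliff_toComplex_mul_self (v : Maj n → ℝ) :
    cliff n (toComplex v) * cliff n (toComplex v) = ((v ⬝ᵥ v : ℝ) : ℂ) • 1 := by
  have h := cliff_mul_add (toComplex v) (toComplex v)
  rw [← two_smul ℂ, mul_smul, toComplex_dotProduct] at h
  exact smul_right_injective _ (two_ne_zero (α := ℂ)) h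

end RealVectors

/-! ### Injectivity of the dual channel when A is invertible -/

section Injective

variable {n : ℕ} {T : Matrix (Fock n) (Fock n) ℂ →ₗ[ℂ] Matrix (Fock n) (Fock n) ℂ}
  {A B : Matrix (Maj n) (Maj n) ℝ}

/-- Simplicity of the matrix algebra: a nonzero entry of X yields a multiple of the identity in the
ideal generated by X, and S does not kill the identity. -/
lemma eq_zero_of_ideal_le_ker {h : Type*} [Fintype h] [DecidableEq h] [Nonempty h]
    {S : Matrix h h ℂ →ₗ[ℂ] Matrix h h ℂ} (hS : S 1 = 1) {X : Matrix h h ℂ}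
    (H : ∀ M N, S (M * X * N) = 0) : X = 0 := by
  ext s t
  by_contra hX
  have h1 : ∑ i, Matrix.single i s (1 : ℂ) * X * Matrix.single t i 1 = X s t • 1 := by
    ext a b
    rw [Matrix.sum_apply]
    simp only [Matrix.single_mul_mul_single, Matrix.single_apply, one_mul, mul_one,
      Matrix.smul_apply, Matrix.one_apply, smul_eq_mul]
    by_cases hab : a = b
    · subst hab; simp
    · rw [if_neg hab, mul_zero]
      refine Finset.sum_eq_zero fun i _ => if_neg ?_
      rintro ⟨rfl, rfl⟩; exact hab rfl
  have h2 := congrArg S h1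
  rw [map_sum, map_smul, hS, Finset.sum_eq_zero fun i _ => H _ _] at h2
  exact hX ((smul_eq_zero.1 h2.symm).resolve_right one_ne_zero)

/-- For invertible A every contraction has the form ι_{Av}, so the kernel of T* is stable under
contractions, hence under exterior products and multiplication by Majorana operators on both sides:
it is an ideal. -/
lemma IsGaussianChannelWith.heisenberg_injective (hT : IsGaussianChannelWith T A B)
    (hA : IsUnit A) : Function.Injective (heisenberg T) := by
  refine (injective_iff_map_eq_zero _).2 fun X hX => ?_
  have hsurj : ∀ w : Maj n → ℂ, ∃ v, A.map Complex.ofReal *ᵥ v = w := by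
    intro w
    obtain ⟨A', hA'⟩ := hA.exists_right_inv
    refine ⟨A'.map Complex.ofReal *ᵥ w, ?_⟩
    have : A.map Complex.ofReal * A'.map Complex.ofReal = 1 := by
      rw [show A.map Complex.ofReal * A'.map Complex.ofReal = (A * A').map Complex.ofReal from
        (Matrix.map_mul (f := Complex.ofRealHom)).symm, hA']
      simp
    rw [Matrix.mulVec_mulVec, this, Matrix.one_mulVec]
  have hcontract : ∀ X, heisenberg T X = 0 → ∀ w,
      heisenberg T (contract (parity n) (cliff n w) X) = 0 := by
    intro X hX w
    obtain ⟨v, rfl⟩ := hsurj w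
    rw [← hT.contract_cliff_heisenberg, hX, map_zero]
  have hparity : ∀ X, heisenberg T X = 0 → heisenberg T (parity n * X * parity n) = 0 := by
    intro X hX
    rw [hT.heisenberg_parity_conj, hX, mul_zero, zero_mul]
  have hwedge : ∀ X, heisenberg T X = 0 → ∀ w,
      heisenberg T (wedge (parity n) (cliff n w) X) = 0 := by
    intro X hX w
    rw [hT.heisenberg_wedge_cliff, hX, map_zero, hcontract X hX, smul_zero, sub_zero]
  have hcl : ∀ k, cliff n (Pi.single k 1) = majorana n k := by
    intro k
    rw [cliff_apply, Finset.sum_eq_single k]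
    · simp
    · intro b _ hb; simp [hb]
    · simp
  have hleft : ∀ (M X : Matrix (Fock n) (Fock n) ℂ), heisenberg T X = 0 →
      heisenberg T (M * X) = 0 := by
    intro M
    have hM : M ∈ Algebra.adjoin ℂ (Set.range (majorana n)) := by rw [adjoin_majorana]; trivial
    induction hM using Algebra.adjoin_induction with
    | mem x hx =>
      obtain ⟨k, rfl⟩ := hx
      intro X hX
      rw [← wedge_add_contract (parity n), ← hcl, map_add, hwedge X hX, hcontract X hX, add_zero]
    | algebraMap a =>
      intro X hX
      rw [Algebra.algebraMap_eq_smul_one, smul_mul_assoc, one_mul, map_smul, hX, smul_zero]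
    | add x y _ _ hx hy => intro X hX; rw [add_mul, map_add, hx X hX, hy X hX, add_zero]
    | mul x y _ _ hx hy => intro X hX; rw [mul_assoc, hx _ (hy X hX)]
  have hright : ∀ (M X : Matrix (Fock n) (Fock n) ℂ), heisenberg T X = 0 →
      heisenberg T (X * M) = 0 := by
    intro M
    have hM : M ∈ Algebra.adjoin ℂ (Set.range (majorana n)) := by rw [adjoin_majorana]; trivial
    induction hM using Algebra.adjoin_induction with
    | mem x hx =>
      obtain ⟨k, rfl⟩ := hx
      intro X hX
      -- Right multiplication by c k is exterior product minus contraction, applied to the parity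
      -- conjugate of X.
      have h1 := wedge_sub_contract (parity n) (majorana n k) (parity n * X * parity n)
      rw [(isCliffordSystem_majorana n).parity_conj_parity_conj] at h1
      rw [← h1, ← hcl, map_sub, hwedge _ (hparity X hX), hcontract _ (hparity X hX), sub_zero]
    | algebraMap a =>
      intro X hX
      rw [Algebra.algebraMap_eq_smul_one, mul_smul_comm, mul_one, map_smul, hX, smul_zero]
    | add x y _ _ hx hy => intro X hX; rw [mul_add, map_add, hx X hX, hy X hX, add_zero]
    | mul x y _ _ hx hy => intro X hX; rw [← mul_assoc, hy _ (hx X hX)]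
  exact eq_zero_of_ideal_le_ker hT.heisenberg_one fun M N => hright N _ (hleft M X hX)

end Injective

/-! ### Evaluating the degrading map on environment operators -/

section Degradable

variable {n : ℕ} {T : Matrix (Fock n) (Fock n) ℂ →ₗ[ℂ] Matrix (Fock n) (Fock n) ℂ}
  {A B : Matrix (Maj n) (Maj n) ℝ}

lemma heisenberg_comp {h h' h'' : Type*} [Fintype h] [DecidableEq h] [Fintype h'] [DecidableEq h']
    [Fintype h''] [DecidableEq h''] (W : Matrix h' h' ℂ →ₗ[ℂ] Matrix h'' h'' ℂ)
    (T : Matrix h h ℂ →ₗ[ℂ] Matrix h' h' ℂ) (Y : Matrix h'' h'' ℂ) :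
    heisenberg (W ∘ₗ T) Y = heisenberg T (heisenberg W Y) :=
  heisenberg_eq_iff.2 fun ρ => by
    rw [LinearMap.comp_apply, trace_heisenberg, trace_heisenberg]

/-- The transmission matrix of a degradable Gaussian channel is invertible. -/
lemma IsDegradable.isUnit (hdeg : IsDegradable T) (hT : IsGaussianChannelWith T A B) :
    IsUnit A := by
  obtain ⟨k, Tc, hcomp, W, hW, rfl⟩ := hdeg
  obtain ⟨V, hV⟩ := hcomp.exists_isDilation
  rw [← Matrix.mulVec_injective_iff_isUnit]
  refine (injective_iff_map_eq_zero A.mulVecLin).2 fun v hv => ?_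
  have hv' : A.map Complex.ofReal *ᵥ toComplex v = 0 := by
    rw [map_mulVec_toComplex]
    rw [Matrix.mulVecLin_apply] at hv
    rw [hv]; ext; simp [toComplex]
  -- For Av = 0 the environment receives c(v) exactly, so degradability puts c(v) in the range of
  -- T*. Contraction by v kills that range but sends c(v) to v·v.
  obtain ⟨Y, hY, hR⟩ := hV.exists_odd hT (x := 0) (y := toComplex v) (d := 0) (by
    rw [hv', add_zero, smul_zero, Matrix.mulVec_zero])
  have h1 := hV.heisenberg_odd hY hR
  rw [heisenberg_comp, map_zero, Matrix.zero_kronecker, Matrix.zero_mul, zero_add,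
    ← Matrix.mul_assoc, hV.isometry, Matrix.one_mul] at h1
  have h2 := hT.contract_cliff_heisenberg (toComplex v) (heisenberg W Y)
  rw [h1, contract_cliff_cliff, hv', map_zero, map_zero, LinearMap.zero_apply, map_zero,
    toComplex_dotProduct] at h2
  have h3 := (smul_eq_zero.1 h2).resolve_right one_ne_zero
  exact dotProduct_self_eq_zero.1 (Complex.ofReal_eq_zero.1 h3)

/-- The noise of a degradable Gaussian channel: it is minimal, and at most one half. -/
lemma IsDegradable.noise (hdeg : IsDegradable T) (hT : IsGaussianChannelWith T A B) :
    noise A (-B) * noise A B = 0 ∧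
      ∀ w : Maj n → ℝ, ((1 - A * Aᵀ) *ᵥ w) ⬝ᵥ ((1 - A * Aᵀ) *ᵥ w) ≤
        (Aᵀ *ᵥ w) ⬝ᵥ (Aᵀ *ᵥ w) - (A *ᵥ Aᵀ *ᵥ w) ⬝ᵥ (A *ᵥ Aᵀ *ᵥ w) := by
  have hinj := hT.heisenberg_injective (hdeg.isUnit hT)
  obtain ⟨k, Tc, hcomp, W, hW, rfl⟩ := hdeg
  obtain ⟨V, hV⟩ := hcomp.exists_isDilation
  have hQ : ∀ w : Maj n → ℝ, (1 - A * Aᵀ) *ᵥ w = w - A *ᵥ Aᵀ *ᵥ w := by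
    intro w
    rw [Matrix.sub_mulVec, Matrix.one_mulVec, Matrix.mulVec_mulVec]
  have htrans : (A.map Complex.ofReal)ᵀ = Aᵀ.map Complex.ofReal := Matrix.transpose_map.symm
  have htC : ∀ v w : Maj n → ℝ, toComplex (v - w) = toComplex v - toComplex w := by
    intro v w; ext; simp [toComplex]
  -- operators of the environment that see the transmitted signal
  have first : ∀ w : Maj n → ℝ, ∃ Y, parity k * Y * parity k = -Y ∧
      (parity n ⊗ₖ Y) * V = V * cliff n (toComplex (Aᵀ *ᵥ w)) -
        (cliff n (toComplex (A *ᵥ Aᵀ *ᵥ w)) ⊗ₖ (1 : Matrix (Fock k) (Fock k) ℂ)) * V ∧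
      heisenberg W Y = cliff n (toComplex ((1 - A * Aᵀ) *ᵥ w)) := by
    intro w
    -- The choice makes x + Ay = 0. It yields T*(W*(Y)) = c(Aᵀw) - T*(c(AAᵀw)) = T*(c((1 - AAᵀ)w)),
    -- and injectivity removes T*.
    obtain ⟨Y, hY, hR⟩ := hV.exists_odd hT (x := -toComplex (A *ᵥ Aᵀ *ᵥ w))
      (y := toComplex (Aᵀ *ᵥ w)) (d := 0) (by
        rw [map_mulVec_toComplex, neg_add_cancel, smul_zero, Matrix.mulVec_zero])
    have hneg : (-cliff n (toComplex (A *ᵥ Aᵀ *ᵥ w))) ⊗ₖ (1 : Matrix (Fock k) (Fock k) ℂ) =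
        -(cliff n (toComplex (A *ᵥ Aᵀ *ᵥ w)) ⊗ₖ (1 : Matrix (Fock k) (Fock k) ℂ)) := by
      ext; simp [Matrix.kroneckerMap_apply]
    rw [map_neg, hneg, Matrix.neg_mul, neg_add_eq_sub] at hR
    refine ⟨Y, hY, hR, hinj ?_⟩
    have h1 := hV.heisenberg_odd hY hR
    rw [heisenberg_comp] at h1
    rw [h1, Matrix.mul_sub, ← Matrix.mul_assoc, hV.isometry, Matrix.one_mul, ← Matrix.mul_assoc,
      ← hV.system, hT.heisenberg_cliff, hT.heisenberg_cliff, htrans, map_mulVec_toComplex,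
      map_mulVec_toComplex, hQ, Matrix.mulVec_sub, htC, map_sub]
  -- operators of the environment that see the noise
  have second : ∀ b : Maj n → ℂ, ∃ Y, parity k * Y * parity k = -Y ∧
      (parity n ⊗ₖ Y) * V =
        (cliff n (FermionicGaussian.noise A B *ᵥ b) ⊗ₖ (1 : Matrix (Fock k) (Fock k) ℂ)) * V ∧
      heisenberg W Y = cliff n (FermionicGaussian.noise A B *ᵥ b) ∧
      ∀ X, heisenberg W (X * Y) =
        heisenberg W X * cliff n (FermionicGaussian.noise A B *ᵥ b) := by
    intro b
    -- With y = 0 the condition 2x = Nd is met by d = 2b. On the range of V, Y acts like the system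
    -- operator c(Nb), so both Y and Y†Y have multiplicative images under W*.
    obtain ⟨Y, hY, hR⟩ := hV.exists_odd hT (x := FermionicGaussian.noise A B *ᵥ b)
      (y := 0) (d := (2 : ℂ) • b) (by rw [Matrix.mulVec_zero, add_zero, Matrix.mulVec_smul])
    rw [map_zero, Matrix.mul_zero, add_zero] at hR
    have h1 := hV.heisenberg_odd hY hR
    rw [heisenberg_comp, ← Matrix.mul_assoc, ← hV.system] at h1
    have h2 := hinj h1
    have h3 := hV.heisenberg_conjTranspose_mul hY hR hY hR
    rw [heisenberg_comp, Matrix.conjTranspose_mul, Matrix.conjTranspose_kronecker,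
      Matrix.conjTranspose_one, Matrix.mul_assoc, ← Matrix.mul_assoc _ _ V,
      ← Matrix.mul_kronecker_mul, Matrix.one_mul, ← Matrix.mul_assoc, ← hV.system] at h3
    refine ⟨Y, hY, hR, h2, fun X => ?_⟩
    rw [hW.heisenberg_mul_of_eq (by rw [hinj h3, h2]), h2]
  refine ⟨?_, fun w => ?_⟩
  -- Evaluating the complementary dual on the product of a signal and a noise operator in two ways
  -- gives T*(c(w)c(Nb)) = c(Aᵀw) T*(c(Nb)); the scalar correction in the product formula must
  -- vanish.
  · have key : ∀ (w : Maj n → ℝ) (b : Maj n → ℂ), toComplex w ⬝ᵥ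
        (FermionicGaussian.noise A (-B) *ᵥ FermionicGaussian.noise A B *ᵥ b) = 0 := by
      intro w b
      obtain ⟨Y, hY, hR, hWY⟩ := first w
      obtain ⟨Y', hY', hR', hWY', hmul⟩ := second b
      have h1 := hV.heisenberg_conjTranspose_mul hY hR hY' hR'
      rw [heisenberg_comp, hmul, hW.heisenberg_conjTranspose, hWY, cliff_toComplex_conjTranspose,
        Matrix.conjTranspose_sub, Matrix.conjTranspose_mul, Matrix.conjTranspose_mul,
        Matrix.conjTranspose_kronecker, cliff_toComplex_conjTranspose,
        cliff_toComplex_conjTranspose, Matrix.conjTranspose_one, Matrix.sub_mul, Matrix.mul_assoc,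
        ← Matrix.mul_assoc Vᴴ, ← hV.system, Matrix.mul_assoc Vᴴ (_ ⊗ₖ _),
        ← Matrix.mul_assoc _ _ V, ← Matrix.mul_kronecker_mul, Matrix.one_mul, ← Matrix.mul_assoc Vᴴ,
        ← hV.system, eq_sub_iff_add_eq, ← map_add, ← add_mul, ← map_add, hQ, htC, sub_add_cancel,
        hT.heisenberg_cliff_mul_cliff, hT.heisenberg_cliff, htrans, map_mulVec_toComplex] at h1
      have h2 := add_eq_left.1 h1
      exact (smul_eq_zero.1 h2).resolve_right one_ne_zero
    ext i j
    have h1 := key (Pi.single i 1) (Pi.single j 1)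
    have h2 : toComplex (Pi.single i 1 : Maj n → ℝ) = Pi.single i 1 := by
      ext l
      simp only [toComplex, Pi.single_apply]
      split_ifs <;> simp
    rw [h2, Matrix.mulVec_mulVec, single_one_dotProduct, Matrix.mulVec_single_one] at h1
    exact h1
  · obtain ⟨Y, hY, hR, hWY⟩ := first w
    have h1 := hV.heisenberg_conjTranspose_mul hY hR hY hR
    -- The Schwarz defect of the signal operator is mapped by T* to the scalar |Aᵀw|² - |AAᵀw|² -
    -- |(1 - AAᵀ)w|².
    obtain ⟨L, M, hL, hM, hLM⟩ := hW.exists_heisenberg_sub Y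
    have h2 := congrArg (heisenberg T) hLM
    set u := Aᵀ *ᵥ w with hu
    set x := A *ᵥ u with hx
    have hSx : heisenberg T (cliff n (toComplex x)) = cliff n (toComplex (Aᵀ *ᵥ x)) := by
      rw [hT.heisenberg_cliff, htrans, map_mulVec_toComplex]
    have hdot : u ⬝ᵥ (Aᵀ *ᵥ x) = x ⬝ᵥ x := by
      rw [Matrix.mulVec_transpose, dotProduct_comm, ← Matrix.dotProduct_mulVec]
    have h3 : heisenberg T (heisenberg W (Yᴴ * Y)) = ((u ⬝ᵥ u - x ⬝ᵥ x : ℝ) : ℂ) • 1 := by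
      rw [heisenberg_comp] at h1
      have h4 := cliff_mul_add (toComplex u) (toComplex (Aᵀ *ᵥ x))
      have e1 : (V * cliff n (toComplex u) -
          (cliff n (toComplex x) ⊗ₖ (1 : Matrix (Fock k) (Fock k) ℂ)) * V)ᴴ *
          (V * cliff n (toComplex u) -
          (cliff n (toComplex x) ⊗ₖ (1 : Matrix (Fock k) (Fock k) ℂ)) * V) =
          cliff n (toComplex u) * (Vᴴ * V) * cliff n (toComplex u) -
          (cliff n (toComplex u) *
            (Vᴴ * (cliff n (toComplex x) ⊗ₖ (1 : Matrix (Fock k) (Fock k) ℂ)) * V) +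
          (Vᴴ * (cliff n (toComplex x) ⊗ₖ (1 : Matrix (Fock k) (Fock k) ℂ)) * V) *
            cliff n (toComplex u)) +
          Vᴴ * ((cliff n (toComplex x) ⊗ₖ (1 : Matrix (Fock k) (Fock k) ℂ)) *
            (cliff n (toComplex x) ⊗ₖ (1 : Matrix (Fock k) (Fock k) ℂ))) * V := by
        rw [Matrix.conjTranspose_sub, Matrix.conjTranspose_mul, Matrix.conjTranspose_mul,
          Matrix.conjTranspose_kronecker, cliff_toComplex_conjTranspose,
          cliff_toComplex_conjTranspose, Matrix.conjTranspose_one]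
        simp only [Matrix.sub_mul, Matrix.mul_sub, Matrix.mul_assoc]
        abel
      rw [h1, e1, hV.isometry, Matrix.mul_one, ← Matrix.mul_kronecker_mul, Matrix.mul_one,
        ← hV.system, ← hV.system, hSx, h4, cliff_toComplex_mul_self, cliff_toComplex_mul_self,
        map_smul, hT.heisenberg_one, toComplex_dotProduct, hdot, ← sub_smul, ← add_smul]
      congr 1
      push_cast
      ring
    rw [map_sub, h3, hWY, cliff_toComplex_conjTranspose, cliff_toComplex_mul_self, map_smul,
      hT.heisenberg_one, ← sub_smul, map_sum] at h2
    -- The dilation exhibits T* as positive.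
    have hpos : (∑ m, heisenberg T ((M m)ᴴ * M m)).PosSemidef := by
      refine Matrix.posSemidef_sum _ fun m _ => ?_
      have : heisenberg T ((M m)ᴴ * M m) =
          ((M m ⊗ₖ (1 : Matrix (Fock k) (Fock k) ℂ)) * V)ᴴ *
            ((M m ⊗ₖ (1 : Matrix (Fock k) (Fock k) ℂ)) * V) := by
        have e : ((M m)ᴴ * M m) ⊗ₖ (1 : Matrix (Fock k) (Fock k) ℂ) =
            (M m ⊗ₖ (1 : Matrix (Fock k) (Fock k) ℂ))ᴴ *
              (M m ⊗ₖ (1 : Matrix (Fock k) (Fock k) ℂ)) := by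
          rw [Matrix.conjTranspose_kronecker, Matrix.conjTranspose_one, ← Matrix.mul_kronecker_mul,
            Matrix.mul_one]
        rw [hV.system, e, Matrix.conjTranspose_mul]
        simp only [Matrix.mul_assoc]
      rw [this]
      exact Matrix.posSemidef_conjTranspose_mul_self _
    rw [← h2] at hpos
    have h5 := hpos.diag_nonneg (i := (fun _ => 0 : Fock n))
    rw [Matrix.smul_apply, Matrix.one_apply_eq, smul_eq_mul, mul_one, ← Complex.ofReal_sub,
      Complex.zero_le_real] at h5
    linarith

end Degradable

/-! ### The normal form of real skew-symmetric matrices -/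

section SkewNormalForm

/-- -B² is symmetric, positive and nonzero. A unit eigenvector v with eigenvalue μ = |Bv|² > 0,
together with Bv/√μ, spans an invariant plane. -/
lemma exists_unit_pair_of_skew {E : Type*} [NormedAddCommGroup E] [InnerProductSpace ℝ E]
    [FiniteDimensional ℝ E] {B : E →ₗ[ℝ] E} (hB : ∀ x y, inner ℝ (B x) y = -inner ℝ x (B y))
    (h0 : B ≠ 0) : ∃ (v f : E) (b : ℝ), 0 < b ∧ inner ℝ v v = (1 : ℝ) ∧ inner ℝ f f = (1 : ℝ) ∧
      inner ℝ v f = (0 : ℝ) ∧ B v = b • f ∧ B f = -(b • v) := by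
  set S : E →ₗ[ℝ] E := -(B ∘ₗ B) with hS
  have hsym : S.IsSymmetric := by
    intro x y
    simp only [hS, LinearMap.neg_apply, LinearMap.comp_apply, inner_neg_left, inner_neg_right, hB,
      neg_neg]
  have hSB : ∀ x, inner ℝ (S x) x = inner ℝ (B x) (B x) := by
    intro x
    simp only [hS, LinearMap.neg_apply, LinearMap.comp_apply, inner_neg_left]
    rw [hB (B x) x, neg_neg]
  have hS0 : S ≠ 0 := by
    intro h
    refine h0 (LinearMap.ext fun x => ?_)
    have h1 := hSB x
    rw [h, LinearMap.zero_apply, inner_zero_left] at h1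
    exact inner_self_eq_zero.1 h1.symm
  obtain ⟨i, hi⟩ : ∃ i, hsym.eigenvalues rfl i ≠ 0 := by
    by_contra! hall
    refine hS0 ((hsym.eigenvectorBasis rfl).toBasis.ext fun i => ?_)
    rw [OrthonormalBasis.coe_toBasis, hsym.apply_eigenvectorBasis, hall i]
    simp
  set v := hsym.eigenvectorBasis rfl i with hv
  set μ := hsym.eigenvalues rfl i with hμ
  have hSv : S v = μ • v := hsym.apply_eigenvectorBasis rfl i
  have hvv : inner ℝ v v = (1 : ℝ) := by
    rw [real_inner_self_eq_norm_sq, (hsym.eigenvectorBasis rfl).orthonormal.1 i, one_pow]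
  have hμB : μ = inner ℝ (B v) (B v) := by
    rw [← hSB, hSv, inner_smul_left, hvv]; simp
  have hμ0 : 0 < μ := lt_of_le_of_ne (by rw [hμB]; exact real_inner_self_nonneg) (Ne.symm hi)
  have hb : 0 < √μ := Real.sqrt_pos.2 hμ0
  have hbb : √μ * √μ = μ := Real.mul_self_sqrt hμ0.le
  have hBB : B (B v) = -(μ • v) := by
    rw [← hSv, hS, LinearMap.neg_apply, neg_neg]; rfl
  refine ⟨v, (√μ)⁻¹ • B v, √μ, hb, hvv, ?_, ?_, ?_, ?_⟩
  · rw [inner_smul_left, inner_smul_right, ← hμB]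
    simp only [conj_trivial]
    field_simp
    nlinarith
  · rw [inner_smul_right]
    have h1 := hB v v
    rw [real_inner_comm] at h1
    have : inner ℝ v (B v) = (0 : ℝ) := by linarith
    rw [this, mul_zero]
  · rw [smul_smul, mul_inv_cancel₀ hb.ne', one_smul]
  · rw [map_smul, hBB, smul_neg, smul_smul]
    congr 2
    field_simp
    nlinarith

/-- An invariant plane is split off; skewness makes its orthogonal complement invariant, and the
dimension drops by two. If B = 0, any orthonormal basis serves. -/
theorem exists_orthonormal_of_skew (n : ℕ) : ∀ (E : Type) [NormedAddCommGroup E]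
    [InnerProductSpace ℝ E] [FiniteDimensional ℝ E] (_ : Module.finrank ℝ E = 2 * n)
    (B : E →ₗ[ℝ] E) (_ : ∀ x y, inner ℝ (B x) y = -inner ℝ x (B y)),
    ∃ (e : Fin 2 × Fin n → E) (b : Fin n → ℝ), Orthonormal ℝ e ∧ (∀ j, 0 ≤ b j) ∧
      ∀ j, B (e (0, j)) = b j • e (1, j) ∧ B (e (1, j)) = -(b j • e (0, j)) := by
  induction n with
  | zero =>
    intro E _ _ _ _ B _
    exact ⟨fun x => x.2.elim0, fun j => j.elim0, ⟨fun x => x.2.elim0, fun x => x.2.elim0⟩,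
      fun j => j.elim0, fun j => j.elim0⟩
  | succ n ih =>
    intro E _ _ _ hE B hB
    by_cases h0 : B = 0
    · subst h0
      set u := (stdOrthonormalBasis ℝ E).reindex
        ((finCongr hE).trans (finProdFinEquiv (m := 2) (n := n + 1)).symm)
      exact ⟨u, fun _ => 0, u.orthonormal, fun _ => le_rfl, fun j => by simp⟩
    obtain ⟨v, f, b, hb, hvv, hff, hvf, hBv, hBf⟩ := exists_unit_pair_of_skew hB h0
    have hfv : inner ℝ f v = (0 : ℝ) := by rw [real_inner_comm, hvf]
    have hv1 : ‖v‖ = 1 := by rw [norm_eq_sqrt_real_inner, hvv, Real.sqrt_one]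
    have hf1 : ‖f‖ = 1 := by rw [norm_eq_sqrt_real_inner, hff, Real.sqrt_one]
    have hon : Orthonormal ℝ ![v, f] := by
      rw [orthonormal_iff_ite]
      intro i j
      fin_cases i <;> fin_cases j <;> simp [hv1, hf1, hvf, hfv]
    set K : Submodule ℝ E := (Submodule.span ℝ (Set.range ![v, f]))ᗮ with hK
    have hmem : ∀ x, x ∈ K ↔ inner ℝ v x = (0 : ℝ) ∧ inner ℝ f x = (0 : ℝ) := by
      intro x
      rw [hK, Submodule.mem_orthogonal]
      refine ⟨fun H => ⟨H _ (Submodule.subset_span ⟨0, rfl⟩),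
        H _ (Submodule.subset_span ⟨1, rfl⟩)⟩, fun H u hu => ?_⟩
      induction hu using Submodule.span_induction with
      | mem u hu =>
        obtain ⟨i, rfl⟩ := hu
        fin_cases i
        · exact H.1
        · exact H.2
      | zero => exact inner_zero_left _
      | add y z _ _ hy hz => rw [inner_add_left, hy, hz, add_zero]
      | smul a y _ hy => rw [inner_smul_left, hy, mul_zero]
    have hdim : Module.finrank ℝ K = 2 * n := by
      have h1 := Submodule.finrank_add_finrank_orthogonal (Submodule.span ℝ (Set.range ![v, f]))
      rw [finrank_span_eq_card hon.linearIndependent, Fintype.card_fin, hE] at h1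
      change 2 + Module.finrank ℝ K = _ at h1
      omega
    have hBK : ∀ x ∈ K, B x ∈ K := by
      intro x hx
      rw [hmem] at hx ⊢
      have h1 := hB v x
      have h2 := hB f x
      rw [hBv, inner_smul_left, hx.2] at h1
      rw [hBf, inner_neg_left, inner_smul_left, hx.1] at h2
      simp only [mul_zero, neg_zero] at h1 h2
      constructor <;> linarith
    obtain ⟨e, β, he, hβ, heB⟩ := ih K hdim (B.restrict hBK) (fun x y => by
      simp only [Submodule.coe_inner, LinearMap.coe_restrict_apply]
      exact hB x y)
    refine ⟨fun x => Fin.cases (![v, f] x.1) (fun j => (e (x.1, j) : E)) x.2,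
      Fin.cases b β, ?_, ?_, ?_⟩
    · rw [orthonormal_iff_ite] at he ⊢
      rintro ⟨i, j⟩ ⟨i', j'⟩
      have hperp : ∀ a c l, inner ℝ (![v, f] a) (e (c, l) : E) = (0 : ℝ) := by
        intro a c l
        have := (hmem _).1 (e (c, l)).2
        fin_cases a
        · exact this.1
        · exact this.2
      refine Fin.cases ?_ (fun j => ?_) j <;> refine Fin.cases ?_ (fun j' => ?_) j'
      · simp only [Fin.cases_zero, Prod.mk.injEq, and_true]
        exact orthonormal_iff_ite.1 hon i i'
      · simp only [Fin.cases_zero, Fin.cases_succ, Prod.mk.injEq]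
        rw [hperp, if_neg (fun h => Fin.succ_ne_zero _ h.2.symm)]
      · simp only [Fin.cases_zero, Fin.cases_succ, Prod.mk.injEq]
        rw [real_inner_comm, hperp, if_neg (fun h => Fin.succ_ne_zero _ h.2)]
      · simp only [Fin.cases_succ, Prod.mk.injEq, Fin.succ_inj]
        have := he (i, j) (i', j')
        rw [Submodule.coe_inner] at this
        simpa using this
    · exact Fin.cases hb.le hβ
    · refine Fin.cases ⟨?_, ?_⟩ fun j => ⟨?_, ?_⟩
      · simpa using hBv
      · simpa using hBf
      · have := congrArg Subtype.val (heB j).1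
        simpa using this
      · have := congrArg Subtype.val (heB j).2
        simpa using this

theorem exists_orthogonal_of_skew {n : ℕ} {B : Matrix (Maj n) (Maj n) ℝ} (hB : Bᵀ = -B) :
    ∃ O ∈ Matrix.orthogonalGroup (Maj n) ℝ, ∃ b : Fin n → ℝ, (∀ j, 0 ≤ b j) ∧
      B * O = O * Matrix.blockDiagonal fun j => b j • J := by
  have hskew : ∀ x y : EuclideanSpace ℝ (Maj n), inner ℝ (Matrix.toLpLin 2 2 B x) y =
      -inner ℝ x (Matrix.toLpLin 2 2 B y) := by
    intro x y
    simp only [EuclideanSpace.inner_eq_star_dotProduct, Matrix.ofLp_toLpLin, Matrix.toLin'_apply,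
      star_trivial]
    rw [Matrix.dotProduct_mulVec, ← Matrix.mulVec_transpose, hB, Matrix.neg_mulVec,
      neg_dotProduct]
  obtain ⟨e, b, he, hb, heB⟩ := exists_orthonormal_of_skew n (EuclideanSpace ℝ (Maj n))
    (by simp) (Matrix.toLpLin 2 2 B) hskew
  refine ⟨Matrix.of fun i x => e x i, ?_, b, hb, ?_⟩
  · rw [Matrix.mem_orthogonalGroup_iff']
    ext x y
    have := orthonormal_iff_ite.1 he x y
    rw [EuclideanSpace.inner_eq_star_dotProduct] at this
    rw [Matrix.mul_apply, Matrix.one_apply, ← this]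
    simp [dotProduct, mul_comm]
  · ext i ⟨a, j⟩
    have h1 : (B * Matrix.of fun i x => e x i) i (a, j) =
        Matrix.toLpLin 2 2 B (e (a, j)) i := by
      rw [Matrix.ofLp_toLpLin, Matrix.toLin'_apply]
      rfl
    rw [h1, Matrix.mul_apply, Fintype.sum_prod_type]
    simp only [Matrix.blockDiagonal_apply, mul_ite, mul_zero, Finset.sum_ite_eq', Finset.mem_univ,
      if_true, Matrix.of_apply, Fin.sum_univ_two, Matrix.smul_apply, J]
    fin_cases a
    · simp [(heB j).1, mul_comm]
    · simp [(heB j).2, mul_comm]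

end SkewNormalForm

/-! ### Normal form of the pair (A, B) -/

section NormalForm

variable {n : ℕ}

lemma blockDiagonal_smul_one (x : Fin n → ℝ) :
    (Matrix.blockDiagonal fun j => x j • (1 : Matrix (Fin 2) (Fin 2) ℝ)) =
      Matrix.diagonal fun k : Maj n => x k.2 := by
  simp_rw [Matrix.smul_one_eq_diagonal]
  rw [Matrix.blockDiagonal_diagonal]

open scoped MatrixOrder in
lemma eq_diagonal_of_mul_self {ι : Type*} [Fintype ι] [DecidableEq ι] {R : Matrix ι ι ℝ}
    {d : ι → ℝ} (hR : R.PosSemidef) (hd : ∀ i, 0 ≤ d i)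
    (h : R * R = Matrix.diagonal d * Matrix.diagonal d) : R = Matrix.diagonal d := by
  have hd' : (Matrix.diagonal d).PosSemidef := Matrix.PosSemidef.diagonal hd
  rw [← CFC.sqrt_unique h hR.nonneg, CFC.sqrt_unique rfl hd'.nonneg]

/-- This is the real part of (Q - iB)(Q + iB) = 0 for Q = 1 - AAᵀ. -/
lemma mul_self_eq_of_noise {A B : Matrix (Maj n) (Maj n) ℝ}
    (h : noise A (-B) * noise A B = 0) : (1 - A * Aᵀ) * (1 - A * Aᵀ) = -(B * B) := by
  have e : ∀ C : Matrix (Maj n) (Maj n) ℝ, noise A C =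
      (1 - A * Aᵀ).map Complex.ofReal + Complex.I • C.map Complex.ofReal := by
    intro C
    rw [noise, Matrix.map_sub _ Complex.ofReal_sub, Matrix.map_one _ Complex.ofReal_zero
      Complex.ofReal_one]
  rw [e, e] at h
  ext i j
  have h1 := congrArg Complex.re (congrFun (congrFun h i) j)
  simp only [Matrix.mul_apply, Matrix.add_apply, Matrix.map_apply, Matrix.smul_apply, smul_eq_mul,
    Matrix.zero_apply, Complex.re_sum, Complex.zero_re, Matrix.neg_apply, Complex.ofReal_neg] at h1 ⊢
  rw [eq_neg_iff_add_eq_zero, ← h1, ← Finset.sum_add_distrib]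
  refine Finset.sum_congr rfl fun k _ => ?_
  simp

theorem exists_normal_form {A B : Matrix (Maj n) (Maj n) ℝ} (hB : Bᵀ = -B)
    (hN : noise A (-B) * noise A B = 0)
    (hw : ∀ w : Maj n → ℝ, ((1 - A * Aᵀ) *ᵥ w) ⬝ᵥ ((1 - A * Aᵀ) *ᵥ w) ≤
      (Aᵀ *ᵥ w) ⬝ᵥ (Aᵀ *ᵥ w) - (A *ᵥ Aᵀ *ᵥ w) ⬝ᵥ (A *ᵥ Aᵀ *ᵥ w)) :
    ∃ O₁ ∈ Matrix.orthogonalGroup (Maj n) ℝ, ∃ O₂ ∈ Matrix.orthogonalGroup (Maj n) ℝ,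
      ∃ p : Fin n → ℝ, (∀ j, 1 / 2 ≤ p j ∧ p j ≤ 1) ∧
      A = O₁ * (Matrix.blockDiagonal fun j => √(p j) • (1 : Matrix (Fin 2) (Fin 2) ℝ)) * O₂ ∧
      B = O₁ * (Matrix.blockDiagonal fun j => (1 - p j) • J) * O₁ᵀ := by
  obtain ⟨O, hO, b, hb, hBO⟩ := exists_orthogonal_of_skew hB
  have hO1 : O * Oᵀ = 1 := (Matrix.mem_orthogonalGroup_iff _ _).1 hO
  have hO2 : Oᵀ * O = 1 := (Matrix.mem_orthogonalGroup_iff' _ _).1 hO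
  set D := Matrix.blockDiagonal fun j => b j • J with hD
  have hBD : B = O * D * Oᵀ := by rw [← hBO, mul_assoc, hO1, mul_one]
  set Q := 1 - A * Aᵀ with hQ
  have hQQ := mul_self_eq_of_noise hN
  rw [← hQ] at hQQ
  have hQT : Qᵀ = Q := by
    rw [hQ, Matrix.transpose_sub, Matrix.transpose_mul, Matrix.transpose_transpose,
      Matrix.transpose_one]
  -- Substituting AAᵀ = 1 - Q in `hw` gives 2Q² ≤ Q, the source of both Q ≥ 0 and Q ≤ 1/2.
  have hQw : ∀ w, 2 * ((Q *ᵥ w) ⬝ᵥ (Q *ᵥ w)) ≤ w ⬝ᵥ (Q *ᵥ w) := by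
    intro w
    have h1 := hw w
    have h2 : A *ᵥ Aᵀ *ᵥ w = w - Q *ᵥ w := by
      rw [hQ, Matrix.sub_mulVec, Matrix.one_mulVec, Matrix.mulVec_mulVec]; abel
    have h3 : (Aᵀ *ᵥ w) ⬝ᵥ (Aᵀ *ᵥ w) = w ⬝ᵥ w - w ⬝ᵥ (Q *ᵥ w) := by
      rw [← dotProduct_sub, ← h2, Matrix.dotProduct_mulVec w A, Matrix.mulVec_transpose]
    rw [h3, h2, dotProduct_sub, sub_dotProduct, sub_dotProduct, dotProduct_comm (Q *ᵥ w) w] at h1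
    linarith
  set R := Oᵀ * Q * O with hR
  have hRw : ∀ w, 2 * ((R *ᵥ w) ⬝ᵥ (R *ᵥ w)) ≤ w ⬝ᵥ (R *ᵥ w) := by
    intro w
    have h1 := hQw (O *ᵥ w)
    have h2 : R *ᵥ w = Oᵀ *ᵥ Q *ᵥ O *ᵥ w := by
      rw [hR, Matrix.mulVec_mulVec, Matrix.mulVec_mulVec, mul_assoc]
    have h3 : ∀ x y : Maj n → ℝ, x ⬝ᵥ (Oᵀ *ᵥ y) = (O *ᵥ x) ⬝ᵥ y := by
      intro x y
      rw [Matrix.dotProduct_mulVec, Matrix.vecMul_transpose]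
    rw [h2, h3, h3, Matrix.mulVec_mulVec _ O, hO1, Matrix.one_mulVec]
    exact h1
  have hRpos : R.PosSemidef := by
    refine Matrix.PosSemidef.of_dotProduct_mulVec_nonneg ?_ fun w => ?_
    · rw [Matrix.IsHermitian, Matrix.conjTranspose_eq_transpose_of_trivial, hR,
        Matrix.transpose_mul, Matrix.transpose_mul, hQT, Matrix.transpose_transpose, mul_assoc]
    · have h1 := hRw w
      have h2 : 0 ≤ (R *ᵥ w) ⬝ᵥ (R *ᵥ w) :=
        Finset.sum_nonneg fun i _ => mul_self_nonneg _
      rw [star_trivial]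
      linarith
  have hJ : J * J = -1 := by
    ext i j
    fin_cases i <;> fin_cases j <;> simp [J, Matrix.mul_apply]
  have hRR : R * R = Matrix.diagonal (fun k : Maj n => b k.2) *
      Matrix.diagonal (fun k : Maj n => b k.2) := by
    have h1 : R * R = Oᵀ * (Q * Q) * O := by
      have : R * R = Oᵀ * Q * (O * Oᵀ) * Q * O := by rw [hR]; noncomm_ring
      rw [this, hO1]; noncomm_ring
    have h2 : Oᵀ * (B * B) * O = (Oᵀ * O) * D * (Oᵀ * O) * D * (Oᵀ * O) := by
      rw [hBD]; noncomm_ring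
    rw [h1, hQQ, mul_neg, neg_mul, h2, hO2, one_mul, mul_one, mul_one, hD,
      ← Matrix.blockDiagonal_mul, ← blockDiagonal_smul_one, ← Matrix.blockDiagonal_mul,
      ← Matrix.blockDiagonal_neg]
    congr 1
    ext1 j
    simp [hJ, smul_smul]
  -- Positive square roots are unique, so the basis adapted to B also diagonalises Q, with the same
  -- b_j on both Majorana labels of mode j.
  have hRd := eq_diagonal_of_mul_self hRpos (fun k => hb k.2) hRR
  have hb2 : ∀ j, b j ≤ 1 / 2 := by
    intro j
    have h1 := hRw (Pi.single (0, j) 1)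
    rw [hRd] at h1
    simp only [Matrix.mulVec_single_one, single_one_dotProduct] at h1
    have h2 : (Matrix.diagonal fun k : Maj n => b k.2).col (0, j) = Pi.single (0, j) (b j) := by
      ext k
      rw [Matrix.col_apply, Matrix.diagonal_apply, Pi.single_apply]
      split_ifs with h
      · rw [h]
      · rfl
    rw [h2, single_dotProduct, Pi.single_eq_same] at h1
    nlinarith [hb j]
  have hp : ∀ j, 0 < 1 - b j := fun j => by linarith [hb2 j]
  set S := Matrix.diagonal fun k : Maj n => √(1 - b k.2) with hS
  set S' := Matrix.diagonal fun k : Maj n => (√(1 - b k.2))⁻¹ with hS'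
  have hs : ∀ k : Maj n, √(1 - b k.2) ≠ 0 := fun k => (Real.sqrt_pos.2 (hp k.2)).ne'
  have hSS' : S * S' = 1 := by
    rw [hS, hS', Matrix.diagonal_mul_diagonal, ← Matrix.diagonal_one]
    congr 1
    ext k
    exact mul_inv_cancel₀ (hs k)
  have hAA : Oᵀ * (A * Aᵀ) * O = S * S := by
    have h1 : A * Aᵀ = 1 - Q := by rw [hQ]; abel
    rw [h1, mul_sub, sub_mul, mul_one, hO2, ← hR, hRd, hS, Matrix.diagonal_mul_diagonal,
      ← Matrix.diagonal_one, Matrix.diagonal_sub]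
    congr 1
    ext k
    rw [Real.mul_self_sqrt (hp k.2).le]
  have hS'S : S' * S = 1 := mul_eq_one_comm.1 hSS'
  -- The second rotation is the orthogonal factor in the polar decomposition of OᵀA, whose positive
  -- factor is S = diag √(1 - b_j); b_j ≤ 1/2 makes S invertible.
  refine ⟨O, hO, S' * Oᵀ * A, ?_, fun j => 1 - b j, fun j => ⟨by linarith [hb2 j], by
    linarith [hb j]⟩, ?_, ?_⟩
  · rw [Matrix.mem_orthogonalGroup_iff]
    have hST : S'ᵀ = S' := Matrix.diagonal_transpose _
    have h1 : S' * Oᵀ * A * (S' * Oᵀ * A)ᵀ = S' * (Oᵀ * (A * Aᵀ) * O) * S' := by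
      rw [Matrix.transpose_mul, Matrix.transpose_mul, hST, Matrix.transpose_transpose]
      noncomm_ring
    have h2 : S' * (S * S) * S' = (S' * S) * (S * S') := by noncomm_ring
    rw [h1, hAA, h2, hSS', hS'S, mul_one]
  · rw [blockDiagonal_smul_one]
    have h1 : O * S * (S' * Oᵀ * A) = O * (S * S') * Oᵀ * A := by noncomm_ring
    rw [h1, hSS', mul_one, hO1, one_mul]
  · simp_rw [sub_sub_cancel]
    exact hBD

end NormalForm

/-! ### Gaussian unitaries -/

/-- `W` is a parity-definite unitary that rotates the Clifford system `c` by `O`. -/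
structure IsRotation {ι h : Type*} [Fintype ι] [Fintype h] [DecidableEq h]
    (c : ι → Matrix h h ℂ) (Θ : Matrix h h ℂ) (O : Matrix ι ι ℂ) (W : Matrix h h ℂ) : Prop where
  unitary : W ∈ Matrix.unitaryGroup h ℂ
  parity_comm : ∃ ζ : ℂ, ζ * ζ = 1 ∧ Θ * W = ζ • (W * Θ)
  rotate : ∀ k, Wᴴ * c k * W = ∑ l, O k l • c l

namespace IsRotation

lemma trace_conj {h : Type*} [Fintype h] (W ρ X : Matrix h h ℂ) :
    (W * ρ * Wᴴ * X).trace = (ρ * (Wᴴ * X * W)).trace := by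
  rw [mul_assoc, mul_assoc, Matrix.trace_mul_comm]
  simp only [mul_assoc]

variable {ι h : Type*} [Fintype ι] [Fintype h] [DecidableEq h]
  {c : ι → Matrix h h ℂ} {Θ : Matrix h h ℂ} {O : Matrix ι ι ℂ} {W : Matrix h h ℂ}

lemma mul_conjTranspose (hW : IsRotation c Θ O W) : W * Wᴴ = 1 :=
  Matrix.mem_unitaryGroup_iff.1 hW.unitary

lemma conjTranspose_mul (hW : IsRotation c Θ O W) : Wᴴ * W = 1 :=
  Matrix.mem_unitaryGroup_iff'.1 hW.unitary

lemma conjTranspose [DecidableEq ι] (hW : IsRotation c Θ O W) (hO : Oᵀ * O = 1) : IsRotation c Θ Oᵀ Wᴴ := by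
  have h1 := hW.mul_conjTranspose
  have h2 := hW.conjTranspose_mul
  refine ⟨?_, ?_, fun k => ?_⟩
  · rw [Matrix.mem_unitaryGroup_iff, Matrix.star_eq_conjTranspose, Matrix.conjTranspose_conjTranspose,
      h2]
  · obtain ⟨ζ, hζ, hΘ⟩ := hW.parity_comm
    refine ⟨ζ, hζ, ?_⟩
    have h3 : Wᴴ * (Θ * W) * Wᴴ = Wᴴ * (ζ • (W * Θ)) * Wᴴ := by rw [hΘ]
    have h4 : Wᴴ * (Θ * W) * Wᴴ = Wᴴ * Θ * (W * Wᴴ) := by noncomm_ring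
    have h5 : Wᴴ * (ζ • (W * Θ)) * Wᴴ = ζ • (Wᴴ * W * Θ * Wᴴ) := by
      rw [mul_smul_comm, smul_mul_assoc]; simp only [mul_assoc]
    rw [h4, h5, h1, h2, mul_one, one_mul] at h3
    rw [h3, smul_smul, hζ, one_smul]
  · rw [Matrix.conjTranspose_conjTranspose]
    have h3 : ∀ l, c l = ∑ m, O l m • (W * c m * Wᴴ) := by
      intro l
      have h4 : W * (Wᴴ * c l * W) * Wᴴ = (W * Wᴴ) * c l * (W * Wᴴ) := by noncomm_ring
      rw [h1, one_mul, mul_one, hW.rotate, Finset.mul_sum, Finset.sum_mul] at h4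
      rw [← h4]
      refine Finset.sum_congr rfl fun m _ => ?_
      rw [mul_smul_comm, smul_mul_assoc]
    have h5 : ∑ l, Oᵀ k l • c l = ∑ m, (Oᵀ * O) k m • (W * c m * Wᴴ) := by
      conv_lhs => enter [2, l]; rw [h3 l]
      simp_rw [Finset.smul_sum, smul_smul]
      rw [Finset.sum_comm]
      refine Finset.sum_congr rfl fun m _ => ?_
      rw [Matrix.mul_apply, Finset.sum_smul]
    rw [h5, hO]
    simp [Matrix.one_apply, ite_smul]

/-- The sign ζ, which is -1 for odd unitaries, occurs on both sides of X and cancels. -/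
lemma parity_conj (hW : IsRotation c Θ O W) (X : Matrix h h ℂ) :
    Wᴴ * (Θ * X * Θ) * W = Θ * (Wᴴ * X * W) * Θ := by
  obtain ⟨ζ, hζ, hΘ⟩ := hW.parity_comm
  have h1 := hW.mul_conjTranspose
  have h2 := hW.conjTranspose_mul
  have hΘ' : Wᴴ * Θ = ζ • (Θ * Wᴴ) := by
    have h3 : Wᴴ * (Θ * W) * Wᴴ = Wᴴ * (ζ • (W * Θ)) * Wᴴ := by rw [hΘ]
    have h4 : Wᴴ * (Θ * W) * Wᴴ = Wᴴ * Θ * (W * Wᴴ) := by noncomm_ring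
    have h5 : Wᴴ * (ζ • (W * Θ)) * Wᴴ = ζ • (Wᴴ * W * Θ * Wᴴ) := by
      rw [mul_smul_comm, smul_mul_assoc]; simp only [mul_assoc]
    rwa [h4, h5, h1, h2, mul_one, one_mul] at h3
  have h3 : Wᴴ * (Θ * X * Θ) * W = (Wᴴ * Θ) * X * (Θ * W) := by noncomm_ring
  rw [h3, hΘ, hΘ', smul_mul_assoc, smul_mul_assoc, mul_smul_comm, smul_smul, hζ, one_smul]
  noncomm_ring

lemma conj_mul (hW : IsRotation c Θ O W) (X Y : Matrix h h ℂ) :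
    Wᴴ * (X * Y) * W = (Wᴴ * X * W) * (Wᴴ * Y * W) := by
  have h1 : (Wᴴ * X * W) * (Wᴴ * Y * W) = Wᴴ * X * (W * Wᴴ) * Y * W := by noncomm_ring
  rw [h1, hW.mul_conjTranspose]; noncomm_ring

lemma contract_conj (hW : IsRotation c Θ O W) (m : ι) (X : Matrix h h ℂ) :
    Wᴴ * contract Θ (c m) X * W = ∑ l, O m l • contract Θ (c l) (Wᴴ * X * W) := by
  have h1 : ∑ l, O m l • contract Θ (c l) (Wᴴ * X * W) =
      contract Θ (Wᴴ * c m * W) (Wᴴ * X * W) := by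
    rw [hW.rotate]
    simp only [map_sum, map_smul, LinearMap.sum_apply, LinearMap.smul_apply]
  rw [h1, contract_apply, contract_apply, mul_smul_comm, smul_mul_assoc, mul_sub, sub_mul,
    hW.conj_mul, hW.conj_mul (Θ * X * Θ), hW.parity_conj]

lemma isState (hW : IsRotation c Θ O W) {ρ : Matrix h h ℂ} (hρ : IsState ρ) :
    IsState (W * ρ * Wᴴ) := by
  refine ⟨hρ.1.mul_mul_conjTranspose_same W, ?_⟩
  have := trace_conj W ρ 1
  rw [mul_one, mul_one, hW.conjTranspose_mul, mul_one] at this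
  rw [this, hρ.2]

lemma trace_conj_mul_mul (hW : IsRotation c Θ O W) (ρ : Matrix h h ℂ) :
    (Matrix.of fun k m => (W * ρ * Wᴴ * (c k * c m)).trace) =
      O * (Matrix.of fun k m => (ρ * (c k * c m)).trace) * Oᵀ := by
  ext k m
  rw [Matrix.of_apply, trace_conj, hW.conj_mul, hW.rotate, hW.rotate, Matrix.mul_apply]
  simp only [Matrix.mul_apply, Matrix.of_apply, Matrix.transpose_apply, Finset.sum_mul,
    Finset.mul_sum, Matrix.trace_sum, smul_mul_assoc, mul_smul_comm, Matrix.trace_smul, smul_eq_mul]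
  refine Finset.sum_congr rfl fun i _ => Finset.sum_congr rfl fun j _ => by ring

/-- In the operator form of Wick's theorem the two-point matrix becomes OGOᵀ and the vector of
contractions becomes Ov; orthogonality cancels the inner OᵀO. -/
lemma isGaussianState [DecidableEq ι] (hW : IsRotation c Θ O W) (hc : IsCliffordSystem c Θ) (hO : Oᵀ * O = 1)
    {ρ : Matrix h h ℂ} (hρ : IsGaussianState c ρ) : IsGaussianState c (W * ρ * Wᴴ) := by
  obtain ⟨h1, h2⟩ := hc.wick_iff.1 hρ
  refine hc.wick_iff.2 ⟨hW.isState h1, fun k X => ?_⟩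
  set G := Matrix.of fun k m => (ρ * (c k * c m)).trace with hG
  have h3 : ∀ k m, (W * ρ * Wᴴ * (c k * c m)).trace = (O * G * Oᵀ) k m :=
    fun k m => congrFun (congrFun (hW.trace_conj_mul_mul ρ) k) m
  set v : ι → ℂ := fun m => (ρ * contract Θ (c m) (Wᴴ * X * W)).trace with hv
  have h4 : ∀ m, (W * ρ * Wᴴ * contract Θ (c m) X).trace = (O *ᵥ v) m := by
    intro m
    rw [trace_conj, hW.contract_conj, Finset.mul_sum, Matrix.trace_sum, Matrix.mulVec, dotProduct]
    refine Finset.sum_congr rfl fun l _ => ?_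
    rw [mul_smul_comm, Matrix.trace_smul, smul_eq_mul]
  have h5 : (W * ρ * Wᴴ * (c k * X)).trace = (O *ᵥ G *ᵥ v) k := by
    rw [trace_conj, hW.conj_mul, hW.rotate, Finset.sum_mul, Finset.mul_sum, Matrix.trace_sum,
      Matrix.mulVec, dotProduct]
    refine Finset.sum_congr rfl fun l _ => ?_
    rw [smul_mul_assoc, mul_smul_comm, Matrix.trace_smul, h2, smul_eq_mul]
    rfl
  rw [h5]
  simp_rw [h3, h4]
  change _ = ((O * G * Oᵀ) *ᵥ (O *ᵥ v)) k
  rw [Matrix.mulVec_mulVec, Matrix.mulVec_mulVec, Matrix.mul_assoc (O * G), hO, Matrix.mul_one]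

lemma covariance_conj (hW : IsRotation c Θ O W) (ρ : Matrix h h ℂ) :
    covariance c (W * ρ * Wᴴ) = O * covariance c ρ * Oᵀ := by
  have h1 : ∀ ρ : Matrix h h ℂ, covariance c ρ =
      (Complex.I / 2) • ((Matrix.of fun k m => (ρ * (c k * c m)).trace) -
        (Matrix.of fun k m => (ρ * (c k * c m)).trace)ᵀ) := by
    intro ρ
    ext k m
    simp [covariance, mul_sub]
  rw [h1, h1, hW.trace_conj_mul_mul, Matrix.mul_smul, Matrix.smul_mul, Matrix.mul_sub,
    Matrix.sub_mul]
  congr 2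
  rw [Matrix.transpose_mul, Matrix.transpose_mul, Matrix.transpose_transpose]
  simp only [Matrix.mul_assoc]

end IsRotation

/-! ### Implementing orthogonal matrices by unitaries -/

section GaussianUnitary

variable {n : ℕ}

lemma cliff_eq_sum (O : Matrix (Maj n) (Maj n) ℝ) (k : Maj n) :
    cliff n (toComplex (O k)) = ∑ l, (O.map Complex.ofReal) k l • majorana n l := rfl

/-- The unitary `U` implements the rotation `f`. -/
def Implements (f : EuclideanSpace ℝ (Maj n) ≃ₗᵢ[ℝ] EuclideanSpace ℝ (Maj n))
    (U : Matrix (Fock n) (Fock n) ℂ) : Prop :=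
  U * Uᴴ = 1 ∧ (∃ ζ : ℂ, ζ * ζ = 1 ∧ parity n * U = ζ • (U * parity n)) ∧
    ∀ v : EuclideanSpace ℝ (Maj n),
      Uᴴ * cliff n (toComplex v.ofLp) * U = cliff n (toComplex (f v).ofLp)

lemma Implements.mul {f g : EuclideanSpace ℝ (Maj n) ≃ₗᵢ[ℝ] EuclideanSpace ℝ (Maj n)}
    {U V : Matrix (Fock n) (Fock n) ℂ} (hU : Implements f U) (hV : Implements g V) :
    Implements (f * g) (V * U) := by
  obtain ⟨h1, ⟨ζ, hζ, h2⟩, h3⟩ := hU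
  obtain ⟨g1, ⟨ξ, hξ, g2⟩, g3⟩ := hV
  refine ⟨?_, ⟨ξ * ζ, by linear_combination (ζ * ζ) * hξ + hζ, ?_⟩, fun v => ?_⟩
  · have : V * U * (V * U)ᴴ = V * (U * Uᴴ) * Vᴴ := by
      rw [Matrix.conjTranspose_mul]; noncomm_ring
    rw [this, h1, mul_one, g1]
  · rw [← mul_assoc, g2, smul_mul_assoc, mul_assoc, h2, mul_smul_comm, smul_smul, mul_assoc]
  · have : (V * U)ᴴ * cliff n (toComplex v.ofLp) * (V * U) =
        Uᴴ * (Vᴴ * cliff n (toComplex v.ofLp) * V) * U := by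
      rw [Matrix.conjTranspose_mul]; noncomm_ring
    rw [this, g3, h3]
    rfl

lemma Implements.inv {f : EuclideanSpace ℝ (Maj n) ≃ₗᵢ[ℝ] EuclideanSpace ℝ (Maj n)}
    {U : Matrix (Fock n) (Fock n) ℂ} (hU : Implements f U) : Implements f⁻¹ Uᴴ := by
  obtain ⟨h1, ⟨ζ, hζ, h2⟩, h3⟩ := hU
  have h1' : Uᴴ * U = 1 := mul_eq_one_comm.1 h1
  refine ⟨by rw [Matrix.conjTranspose_conjTranspose, h1'], ⟨ζ, hζ, ?_⟩, fun v => ?_⟩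
  · have e3 : Uᴴ * (parity n * U) * Uᴴ = Uᴴ * (ζ • (U * parity n)) * Uᴴ := by rw [h2]
    have e4 : Uᴴ * (parity n * U) * Uᴴ = Uᴴ * parity n * (U * Uᴴ) := by noncomm_ring
    have e5 : Uᴴ * (ζ • (U * parity n)) * Uᴴ = ζ • (Uᴴ * U * parity n * Uᴴ) := by
      rw [mul_smul_comm, smul_mul_assoc]; simp only [mul_assoc]
    rw [e4, e5, h1, h1', mul_one, one_mul] at e3
    rw [e3, smul_smul, hζ, one_smul]
  · have e1 := h3 (f⁻¹ v)
    have e2 : f (f⁻¹ v) = v := f.apply_symm_apply v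
    rw [e2] at e1
    rw [← e1, Matrix.conjTranspose_conjTranspose]
    have e3 : U * (Uᴴ * cliff n (toComplex (f⁻¹ v).ofLp) * U) * Uᴴ =
        (U * Uᴴ) * cliff n (toComplex (f⁻¹ v).ofLp) * (U * Uᴴ) := by noncomm_ring
    rw [e3, h1, one_mul, mul_one]

lemma implements_one : Implements (1 : EuclideanSpace ℝ (Maj n) ≃ₗᵢ[ℝ] _) 1 := by
  refine ⟨by simp, ⟨1, by simp, by simp⟩, fun v => by simp⟩

/-- For the unit vector w along v, conjugation by c(w) implements minus the reflection in the
hyperplane orthogonal to w. The extra factor P corrects the sign, so P c(w) is used. -/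
lemma exists_implements_reflection (v : EuclideanSpace ℝ (Maj n)) :
    ∃ U, Implements (Submodule.reflection (ℝ ∙ v)ᗮ) U := by
  by_cases hv : v = 0
  · subst hv
    refine ⟨1, ?_⟩
    have : Submodule.reflection (ℝ ∙ (0 : EuclideanSpace ℝ (Maj n)))ᗮ = 1 := by
      ext1 x
      rw [Submodule.reflection_orthogonal_apply, Submodule.reflection_singleton_apply]
      simp
    rw [this]
    exact implements_one
  · have hn : 0 < ‖v‖ := norm_pos_iff.2 hv
    set w : Maj n → ℝ := fun k => ‖v‖⁻¹ * v k with hw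
    have hdot : ∀ x : EuclideanSpace ℝ (Maj n), w ⬝ᵥ x.ofLp = ‖v‖⁻¹ * inner ℝ v x := by
      intro x
      rw [EuclideanSpace.inner_eq_star_dotProduct, star_trivial, dotProduct_comm, dotProduct,
        dotProduct, Finset.mul_sum]
      exact Finset.sum_congr rfl fun k _ => by rw [hw]; ring
    have hww : w ⬝ᵥ w = 1 := by
      have h1 : w ⬝ᵥ w = ‖v‖⁻¹ * (w ⬝ᵥ v.ofLp) := by
        rw [dotProduct, dotProduct, Finset.mul_sum]
        exact Finset.sum_congr rfl fun k _ => by rw [hw]; ring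
      rw [h1, hdot, real_inner_self_eq_norm_sq]
      field_simp
    have hsq : cliff n (toComplex w) * cliff n (toComplex w) = 1 := by
      rw [cliff_toComplex_mul_self, hww, Complex.ofReal_one, one_smul]
    have hP := parity_mul_self (n := n)
    have hU : (parity n * cliff n (toComplex w))ᴴ = cliff n (toComplex w) * parity n := by
      rw [Matrix.conjTranspose_mul, parity_conjTranspose, cliff_toComplex_conjTranspose]
    refine ⟨parity n * cliff n (toComplex w), ?_, ⟨-1, by norm_num, ?_⟩, fun x => ?_⟩
    · rw [hU, mul_assoc, ← mul_assoc (cliff n _), hsq, one_mul, hP]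
    · rw [parity_mul_cliff, mul_neg, neg_one_smul, ← mul_assoc, parity_mul_cliff, neg_mul]
    · rw [hU]
      have h1 : cliff n (toComplex w) * parity n * cliff n (toComplex x.ofLp) *
          (parity n * cliff n (toComplex w)) =
          cliff n (toComplex w) * (parity n * cliff n (toComplex x.ofLp) * parity n) *
            cliff n (toComplex w) := by noncomm_ring
      have h2 := cliff_mul_add (toComplex x.ofLp) (toComplex w)
      have h3 : cliff n (toComplex x.ofLp) * cliff n (toComplex w) =
          (2 * (toComplex x.ofLp ⬝ᵥ toComplex w)) • 1 -
            cliff n (toComplex w) * cliff n (toComplex x.ofLp) := by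
        rw [← h2]; abel
      rw [h1, parity_conj_cliff, mul_neg, neg_mul, mul_assoc, h3, mul_sub, ← mul_assoc, hsq,
        one_mul, mul_smul_comm, mul_one, toComplex_dotProduct, dotProduct_comm, hdot, neg_sub,
        ← map_smul, ← map_sub]
      congr 1
      ext k
      rw [Submodule.reflection_orthogonal_apply, Submodule.reflection_singleton_apply]
      simp only [toComplex, Pi.sub_apply, Pi.smul_apply, smul_eq_mul, PiLp.neg_apply,
        PiLp.sub_apply, PiLp.smul_apply, hw]
      have key : -(2 • (inner ℝ v x / ‖v‖ ^ 2 * v.ofLp k) - x.ofLp k) =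
          x.ofLp k - 2 * (‖v‖⁻¹ * inner ℝ v x) * (‖v‖⁻¹ * v.ofLp k) := by
        rw [nsmul_eq_mul]; push_cast; field_simp; ring
      simp only [RCLike.ofReal_real_eq_id, id_eq]
      rw [key]; push_cast; rfl

/-- By Cartan-Dieudonné the hyperplane reflections generate the orthogonal group. -/
lemma exists_implements (f : EuclideanSpace ℝ (Maj n) ≃ₗᵢ[ℝ] EuclideanSpace ℝ (Maj n)) :
    ∃ U, Implements f U := by
  have hf : f ∈ Subgroup.closure
      (Set.range fun v : EuclideanSpace ℝ (Maj n) => Submodule.reflection (ℝ ∙ v)ᗮ) := by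
    rw [LinearIsometryEquiv.reflections_generate]; trivial
  induction hf using Subgroup.closure_induction with
  | mem x hx =>
    obtain ⟨v, rfl⟩ := hx
    exact exists_implements_reflection v
  | one => exact ⟨1, implements_one⟩
  | mul x y _ _ hx hy =>
    obtain ⟨U, hU⟩ := hx
    obtain ⟨V, hV⟩ := hy
    exact ⟨_, hU.mul hV⟩
  | inv x _ hx =>
    obtain ⟨U, hU⟩ := hx
    exact ⟨_, hU.inv⟩

/-- Every orthogonal matrix is implemented by a Gaussian unitary. -/
theorem exists_isRotation {O : Matrix (Maj n) (Maj n) ℝ}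
    (hO : O ∈ Matrix.orthogonalGroup (Maj n) ℝ) :
    ∃ U, IsRotation (majorana n) (parity n) (O.map Complex.ofReal) U := by
  have hO1 : O * Oᵀ = 1 := (Matrix.mem_orthogonalGroup_iff _ _).1 hO
  set f : EuclideanSpace ℝ (Maj n) →ₗᵢ[ℝ] EuclideanSpace ℝ (Maj n) :=
    -- The transpose appears because c k must go to the combination with coefficients from row k of
    -- O, which is Oᵀ applied to the k-th basis vector.
    (Matrix.toLpLin 2 2 Oᵀ).isometryOfInner fun x y => by
      simp only [EuclideanSpace.inner_eq_star_dotProduct, Matrix.ofLp_toLpLin, Matrix.toLin'_apply,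
        star_trivial]
      rw [Matrix.dotProduct_mulVec, Matrix.vecMul_transpose, Matrix.mulVec_mulVec, hO1,
        Matrix.one_mulVec] with hf
  obtain ⟨U, h1, h2, h3⟩ := exists_implements (f.toLinearIsometryEquiv rfl)
  refine ⟨U, Matrix.mem_unitaryGroup_iff.2 h1, h2, fun k => ?_⟩
  have h4 := h3 (EuclideanSpace.single k 1)
  have h5 : cliff n (toComplex (EuclideanSpace.single k (1 : ℝ)).ofLp) = majorana n k := by
    rw [cliff_apply, Finset.sum_eq_single k]
    · simp [toComplex]
    · intro b _ hb; simp [toComplex, hb]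
    · simp
  have h6 : (f (EuclideanSpace.single k 1)).ofLp = O k := by
    ext l
    simp [hf, Matrix.ofLp_toLpLin]
  rw [h5, LinearIsometry.coe_toLinearIsometryEquiv, h6, cliff_eq_sum] at h4
  exact h4

lemma IsRotation.isGaussianUnitary {O : Matrix (Maj n) (Maj n) ℝ} {U : Matrix (Fock n) (Fock n) ℂ}
    (hO : O ∈ Matrix.orthogonalGroup (Maj n) ℝ)
    (hU : IsRotation (majorana n) (parity n) (O.map Complex.ofReal) U) : IsGaussianUnitary U :=
  ⟨hU.unitary, O, hO, hU.rotate⟩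

/-- The Jordan-Wigner string of the last n modes acts on the reference factor only, so 1 ⊗ U
commutes with it and leaves the reference operators fixed. -/
lemma IsRotation.one_kronecker {O : Matrix (Maj n) (Maj n) ℝ} {U : Matrix (Fock n) (Fock n) ℂ}
    (hU : IsRotation (majorana n) (parity n) (O.map Complex.ofReal) U) (r : ℕ) :
    IsRotation (jointMajorana r n) (parity r ⊗ₖ parity n) (padOne r O)
      ((1 : Matrix (Fock r) (Fock r) ℂ) ⊗ₖ U) := by
  have hW : ((1 : Matrix (Fock r) (Fock r) ℂ) ⊗ₖ U)ᴴ = (1 : Matrix (Fock r) (Fock r) ℂ) ⊗ₖ Uᴴ := by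
    rw [Matrix.conjTranspose_kronecker, Matrix.conjTranspose_one]
  refine ⟨?_, ?_, ?_⟩
  · rw [Matrix.mem_unitaryGroup_iff, Matrix.star_eq_conjTranspose, hW, ← Matrix.mul_kronecker_mul,
      hU.mul_conjTranspose, one_mul, Matrix.one_kronecker_one]
  · obtain ⟨ζ, hζ, h⟩ := hU.parity_comm
    refine ⟨ζ, hζ, ?_⟩
    rw [← Matrix.mul_kronecker_mul, ← Matrix.mul_kronecker_mul, mul_one, one_mul, h,
      Matrix.kronecker_smul]
  · rw [hW]
    rintro (k | k)
    · rw [Fintype.sum_sum_type]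
      simp only [padOne, Matrix.fromBlocks_apply₁₁, Matrix.fromBlocks_apply₁₂, Matrix.zero_apply,
        zero_smul, Finset.sum_const_zero, add_zero, Matrix.one_apply, ite_smul, one_smul,
        Finset.sum_ite_eq, Finset.mem_univ, if_true]
      rw [jointMajorana, Sum.elim_inl, ← Matrix.mul_kronecker_mul, ← Matrix.mul_kronecker_mul,
        mul_one, one_mul, mul_one, hU.conjTranspose_mul]
    · rw [Fintype.sum_sum_type]
      simp only [padOne, Matrix.fromBlocks_apply₂₁, Matrix.fromBlocks_apply₂₂, Matrix.zero_apply,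
        zero_smul, Finset.sum_const_zero, zero_add]
      simp only [jointMajorana, Sum.elim_inr]
      rw [← Matrix.mul_kronecker_mul, ← Matrix.mul_kronecker_mul, mul_one, one_mul, hU.rotate,
        IsGaussianChannelWith.kronecker_sum]
      exact Finset.sum_congr rfl fun l _ => by rw [Matrix.kronecker_smul]

lemma conjBy_apply {h : Type*} [Fintype h] [DecidableEq h] (U X : Matrix h h ℂ) :
    conjBy U X = U * X * Uᴴ := by
  simp [conjBy, mul_assoc]

lemma ampliation_conjBy {r h : Type*} [Fintype r] [DecidableEq r] [Fintype h] [DecidableEq h]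
    (U : Matrix h h ℂ) (X : Matrix (r × h) (r × h) ℂ) :
    ampliation r (conjBy U) X =
      ((1 : Matrix r r ℂ) ⊗ₖ U) * X * ((1 : Matrix r r ℂ) ⊗ₖ U)ᴴ := by
  ext ⟨a, i⟩ ⟨b, j⟩
  rw [ampliation, Matrix.of_apply, conjBy_apply, Matrix.conjTranspose_kronecker,
    Matrix.conjTranspose_one, Matrix.mul_apply, Matrix.mul_apply, Fintype.sum_prod_type,
    Finset.sum_eq_single b]
  · refine Finset.sum_congr rfl fun l _ => ?_
    rw [Matrix.mul_apply, Matrix.mul_apply, Fintype.sum_prod_type, Finset.sum_eq_single a]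
    · simp [Matrix.kroneckerMap_apply]
    · intro a' _ ha; simp [Matrix.kroneckerMap_apply, Ne.symm ha]
    · simp
  · intro b' _ hb; simp [Matrix.kroneckerMap_apply, hb]
  · simp

lemma ampliation_comp {r h h' h'' : Type*} (W : Matrix h' h' ℂ →ₗ[ℂ] Matrix h'' h'' ℂ)
    (T : Matrix h h ℂ →ₗ[ℂ] Matrix h' h' ℂ) (X : Matrix (r × h) (r × h) ℂ) :
    ampliation r (W ∘ₗ T) X = ampliation r W (ampliation r T X) := rfl

lemma isChannel_conjBy {h : Type*} [Fintype h] [DecidableEq h] {U : Matrix h h ℂ}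
    (hU : Uᴴ * U = 1) : IsChannel (conjBy U) := by
  refine ⟨fun d X hX => ?_, fun X => ?_⟩
  · rw [ampliation_conjBy]
    exact hX.mul_mul_conjTranspose_same _
  · rw [conjBy_apply, mul_assoc, Matrix.trace_mul_comm, mul_assoc, hU, mul_one]

lemma IsChannel.comp {h h' h'' : Type*} [Fintype h] [DecidableEq h] [Fintype h'] [DecidableEq h']
    [Fintype h''] [DecidableEq h''] {W : Matrix h' h' ℂ →ₗ[ℂ] Matrix h'' h'' ℂ}
    {T : Matrix h h ℂ →ₗ[ℂ] Matrix h' h' ℂ} (hW : IsChannel W) (hT : IsChannel T) :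
    IsChannel (W ∘ₗ T) :=
  ⟨fun d X hX => hW.1 d _ (hT.1 d X hX), fun X => (hW.2 _).trans (hT.2 X)⟩

lemma padOne_mul (r : ℕ) (A A' : Matrix (Maj n) (Maj n) ℝ) :
    padOne r (A * A') = padOne r A * padOne r A' := by
  rw [padOne, padOne, padOne, Matrix.fromBlocks_multiply]
  simp only [Matrix.mul_one, Matrix.mul_zero, Matrix.zero_mul, add_zero, zero_add]
  rw [show (A * A').map Complex.ofReal = A.map Complex.ofReal * A'.map Complex.ofReal from
    (Matrix.map_mul (f := Complex.ofRealHom))]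

lemma padOne_transpose (r : ℕ) (A : Matrix (Maj n) (Maj n) ℝ) : (padOne r A)ᵀ = padOne r Aᵀ := by
  rw [padOne, padOne, Matrix.fromBlocks_transpose, Matrix.transpose_one, Matrix.transpose_zero,
    Matrix.transpose_zero, Matrix.transpose_map]

lemma padOne_one (r : ℕ) : padOne r (1 : Matrix (Maj n) (Maj n) ℝ) = 1 := by
  rw [padOne, Matrix.map_one _ Complex.ofReal_zero Complex.ofReal_one, Matrix.fromBlocks_one]

lemma padOne_mul_padZero_mul (r : ℕ) (O B : Matrix (Maj n) (Maj n) ℝ) :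
    padOne r O * padZero r B * (padOne r O)ᵀ = padZero r (O * B * Oᵀ) := by
  rw [padOne_transpose, padOne, padOne, padZero, padZero, Matrix.fromBlocks_multiply,
    Matrix.fromBlocks_multiply]
  simp only [Matrix.mul_one, Matrix.mul_zero, Matrix.zero_mul, add_zero, zero_add]
  rw [show (O * B * Oᵀ).map Complex.ofReal =
    O.map Complex.ofReal * B.map Complex.ofReal * Oᵀ.map Complex.ofReal from by
      rw [← show (O * B).map Complex.ofReal = O.map Complex.ofReal * B.map Complex.ofReal from
        (Matrix.map_mul (f := Complex.ofRealHom))]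
      exact Matrix.map_mul (f := Complex.ofRealHom)]

/-- Gaussian channels are stable under composition with Gaussian unitaries. -/
theorem IsGaussianChannelWith.conj
    {T : Matrix (Fock n) (Fock n) ℂ →ₗ[ℂ] Matrix (Fock n) (Fock n) ℂ}
    {A B O O' : Matrix (Maj n) (Maj n) ℝ} (hT : IsGaussianChannelWith T A B)
    {U V : Matrix (Fock n) (Fock n) ℂ}
    (hO : Oᵀ * O = 1) (hO' : O'ᵀ * O' = 1)
    (hU : IsRotation (majorana n) (parity n) (O.map Complex.ofReal) U)
    (hV : IsRotation (majorana n) (parity n) (O'.map Complex.ofReal) V) :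
    IsGaussianChannelWith (conjBy U ∘ₗ T ∘ₗ conjBy V) (O * A * O') (O * B * Oᵀ) := by
  have hpad : ∀ (r : ℕ) {M : Matrix (Maj n) (Maj n) ℝ}, Mᵀ * M = 1 →
      (padOne r M)ᵀ * padOne r M = 1 := by
    intro r M hM
    rw [padOne_transpose, ← padOne_mul, hM, padOne_one]
  refine ⟨(isChannel_conjBy hU.conjTranspose_mul).comp
    (hT.1.comp (isChannel_conjBy hV.conjTranspose_mul)), ?_, fun r ρ hρ => ?_⟩
  · rw [Matrix.transpose_mul, Matrix.transpose_mul, hT.2.1, Matrix.transpose_transpose]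
    noncomm_ring
  · have hc := isCliffordSystem_jointMajorana r n
    rw [ampliation_comp, ampliation_comp, ampliation_conjBy, ampliation_conjBy]
    have h1 := (hV.one_kronecker r).isGaussianState hc (hpad r hO') hρ
    obtain ⟨h2, h3⟩ := hT.2.2 r _ h1
    refine ⟨(hU.one_kronecker r).isGaussianState hc (hpad r hO) h2, ?_⟩
    rw [(hU.one_kronecker r).covariance_conj, h3, (hV.one_kronecker r).covariance_conj,
      ← padOne_mul_padZero_mul, padOne_mul, padOne_mul, Matrix.transpose_mul, Matrix.transpose_mul]
    simp only [Matrix.mul_add, Matrix.add_mul, Matrix.mul_assoc]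

end GaussianUnitary

/-- A degradable Gaussian channel is lossy up to Gaussian unitaries. -/
theorem IsDegradable.exists_lossy {n : ℕ}
    {T : Matrix (Fock n) (Fock n) ℂ →ₗ[ℂ] Matrix (Fock n) (Fock n) ℂ}
    (hT : IsGaussianChannel T) (hdeg : IsDegradable T) :
    ∃ (U V : Matrix (Fock n) (Fock n) ℂ) (p : Fin n → ℝ)
      (L : Matrix (Fock n) (Fock n) ℂ →ₗ[ℂ] Matrix (Fock n) (Fock n) ℂ),
      IsGaussianUnitary U ∧ IsGaussianUnitary V ∧ (∀ j, 1 / 2 ≤ p j ∧ p j ≤ 1) ∧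
      IsLossySum p L ∧ T = conjBy U ∘ₗ L ∘ₗ conjBy V := by
  obtain ⟨A, B, hT⟩ := hT
  obtain ⟨hN, hw⟩ := hdeg.noise hT
  obtain ⟨O, hO, O', hO', p, hp, hA, hB⟩ := exists_normal_form hT.2.1 hN hw
  obtain ⟨U, hU⟩ := exists_isRotation hO
  obtain ⟨V, hV⟩ := exists_isRotation hO'
  have hO1 : O * Oᵀ = 1 := (Matrix.mem_orthogonalGroup_iff _ _).1 hO
  have hO2 : Oᵀ * O = 1 := (Matrix.mem_orthogonalGroup_iff' _ _).1 hO
  have hO1' : O' * O'ᵀ = 1 := (Matrix.mem_orthogonalGroup_iff _ _).1 hO'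
  have hO2' : O'ᵀ * O' = 1 := (Matrix.mem_orthogonalGroup_iff' _ _).1 hO'
  have hmap : ∀ {M : Matrix (Maj n) (Maj n) ℝ}, Mᵀ * M = 1 →
      (M.map Complex.ofReal)ᵀ * M.map Complex.ofReal = 1 := by
    intro M hM
    rw [← Matrix.transpose_map, show Mᵀ.map Complex.ofReal * M.map Complex.ofReal =
      (Mᵀ * M).map Complex.ofReal from (Matrix.map_mul (f := Complex.ofRealHom)).symm, hM,
      Matrix.map_one _ Complex.ofReal_zero Complex.ofReal_one]
  have hU' := hU.conjTranspose (hmap hO2)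
  have hV' := hV.conjTranspose (hmap hO2')
  rw [← Matrix.transpose_map] at hU' hV'
  have hL := hT.conj (by rw [Matrix.transpose_transpose, hO1])
    (by rw [Matrix.transpose_transpose, hO1']) hU' hV'
  -- L is T with both rotations undone; this reduces A and B to their block diagonal cores.
  refine ⟨U, V, p, conjBy Uᴴ ∘ₗ T ∘ₗ conjBy Vᴴ, hU.isGaussianUnitary hO, hV.isGaussianUnitary hO', hp, ?_, ?_⟩
  · rw [IsLossySum]
    convert hL using 1
    · rw [hA]
      have : ∀ D : Matrix (Maj n) (Maj n) ℝ, Oᵀ * (O * D * O') * O'ᵀ = (Oᵀ * O) * D * (O' * O'ᵀ) :=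
        fun D => by noncomm_ring
      rw [this, hO2, hO1', one_mul, mul_one]
    · rw [hB, Matrix.transpose_transpose]
      have : ∀ D : Matrix (Maj n) (Maj n) ℝ, Oᵀ * (O * D * Oᵀ) * O = (Oᵀ * O) * D * (Oᵀ * O) :=
        fun D => by noncomm_ring
      rw [this, hO2, one_mul, mul_one]
  · refine LinearMap.ext fun X => ?_
    simp only [LinearMap.comp_apply, conjBy_apply, Matrix.conjTranspose_conjTranspose]
    have h1 : Vᴴ * (V * X * Vᴴ) * V = (Vᴴ * V) * X * (Vᴴ * V) := by noncomm_ring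
    rw [h1, hV.conjTranspose_mul, one_mul, mul_one]
    have h2 : ∀ Y, U * (Uᴴ * Y * U) * Uᴴ = (U * Uᴴ) * Y * (U * Uᴴ) := fun Y => by noncomm_ring
    rw [h2, hU.mul_conjTranspose, one_mul, mul_one]

end FermionicGaussian

theorem theorem1 {n : ℕ}
    (T : Matrix (FermionicGaussian.Fock n) (FermionicGaussian.Fock n) ℂ →ₗ[ℂ]
      Matrix (FermionicGaussian.Fock n) (FermionicGaussian.Fock n) ℂ)
    (hT : FermionicGaussian.IsGaussianChannel T) (hdeg : FermionicGaussian.IsDegradable T) :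
    ∃ (U V : Matrix (FermionicGaussian.Fock n) (FermionicGaussian.Fock n) ℂ)
      (p : Fin n → ℝ)
      (L : Matrix (FermionicGaussian.Fock n) (FermionicGaussian.Fock n) ℂ →ₗ[ℂ]
        Matrix (FermionicGaussian.Fock n) (FermionicGaussian.Fock n) ℂ),
      FermionicGaussian.IsGaussianUnitary U ∧ FermionicGaussian.IsGaussianUnitary V ∧
      (∀ j, 1 / 2 ≤ p j ∧ p j ≤ 1) ∧
      FermionicGaussian.IsLossySum p L ∧
      T = FermionicGaussian.conjBy U ∘ₗ L ∘ₗ FermionicGaussian.conjBy V :=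
  FermionicGaussian.IsDegradable.exists_lossy hT hdeg
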